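/- Let $M$ be a connected, Hausdorff, paracompact smooth manifold of dimension $d$, and let $(M,\mathscr L)$ be a Finsler spacetime: $\mathscr L\colon TM\setminus 0\to\mathbb R$ is smooth, $\mathscr L(x,sv)=s^2\mathscr L(x,v)$ for $s>0$, the metric $g_v=\big(\partial^2\mathscr L/\partial v^\mu\partial v^\nu\big)(x,v)$ has signature $(-,+,\dots,+)$ for every $v\ne 0$, and a connected component of $\{\mathscr L<0\}$ has been chosen as future timelike cone; the nonzero vectors in its boundary are the future-directed lightlike vectors. Put $$2G^\alpha=g^{\alpha\delta}\Big(\frac{\partial^2\mathscr L}{\partial x^\gamma\partial v^\delta}v^\gamma-\frac{\partial\mathscr L}{\partial x^\delta}\Big),\qquad N^\mu_\alpha=\frac{\partial G^\mu}{\partial v^\alpha},\qquad \frac{\delta}{\delta x^\alpha}=\frac{\partial}{\partial x^\alpha}-N^\nu_\alpha\frac{\partial}{\partial v^\nu},$$ $$R^\mu{}_{\alpha\beta}=\frac{\delta N^\mu_\beta}{\delta x^\alpha}-\frac{\delta N^\mu_\alpha}{\delta x^\beta},\qquad R_v(X)^\mu=R^\mu{}_{\alpha\beta}(x,v)X^\alpha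 v^\beta,\qquad Ric(v)=\operatorname{tr}R_v,$$ and $(D_Xs)^\alpha=\big(\partial_\mu s^\alpha+N^\alpha_\mu(x,s(x))\big)X^\mu$ for a nowhere vanishing vector field $s$. Let $H\subset M$ be an (embedded) $C^2$ null hypersurface, i.e. for every $p\in H$ there is a future-directed lightlike $v\in T_pH$ with $\ker g_v(v,\cdot)=T_pH$, and let $n$ be a $C^1$ vector field on $H$ all of whose values $n(p)$ are such vectors. Let $V=TH/\mathbb Rn$, let $\overline X$ be the class of $X\in TH$ in $V$, and set $h(\overline X,\overline Y)=g_n(X,Y)$, $b(\overline X)=\overline{D_Xn}$, $\bar R(\overline X)=\overline{R_n(X)}$, $\bar C=\bar R-\frac1{d-2}(\operatorname{tr}\bar R)\,\mathrm{Id}$ (with $\bar C=0$ if $d=2$, when $V=0$), and $L_n\overline X=\overline{[n,X]}$ for $C^1$ vector fields $X$ on $H$ tangent to $H$. Then all of these are well defined: $D_Xn,\,R_n(X),\,[n,X]\in TH$ for $X$ tangent to $H$, $D_nn$ and $R_n(n)$ are multiples of $n$, and $h$ does not depend on the representatives. Moreover, the following conditions are equivalent: (i) $b=0$ on $H$; (ii)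 $L_n\hat g=0$ on $H$, where $\hat g=g_n|_{TH\times TH}$; (iii) $L_nh=0$ on $H$; (iv) there is a 1-form $\omega\colon H\to T^*H$ such that $D_Xn=\omega(X)\,n$ for every $X\in TH$; (v) for some extension of $n$ to a nowhere vanishing (not necessarily causal) $C^1$ vector field on a neighborhood of $H$, still denoted $n$, one has $\nabla^{g_n}_XY\in TH$ for every $X\in T_pH$, $p\in H$, and every $C^1$ vector field $Y$ on $H$ tangent to $H$, where $\nabla^{g_n}$ is the Levi-Civita connection of the Lorentzian metric $g_n$, $x\mapsto g_{n(x)}$; (v') the same as (v), for every such extension of $n$. If they hold, then on $H$ we have $\bar R=0$, $Ric(n)=0$ and $\bar C=0$. -/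

import Mathlib

open Set Filter Topology Manifold
open scoped ContDiff

noncomputable section

namespace LorentzFinsler

/-! ### Linear algebra: quotients `W / K` and the objects induced on them -/

section Algebra

variable {F : Type*} [AddCommGroup F] [Module ℝ F]

/-- The quotient of `W` by (its intersection with) `K`. -/
abbrev QuotSpace (W K : Submodule ℝ F) : Type _ := W ⧸ K.submoduleOf W

/-- The class of a vector `w ∈ W` in `W / K` (and `0` if `w ∉ W`). -/
def quotClass (W K : Submodule ℝ F) (w : F) : QuotSpace W K :=
  open Classical in
  if h : w ∈ W then (K.submoduleOf W).mkQ ⟨w, h⟩ else 0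

/-- `A` induces an endomorphism of `W / K`. -/
def Descends (W K : Submodule ℝ F) (A : F →ₗ[ℝ] F) : Prop :=
  (∀ w ∈ W, A w ∈ W) ∧ (∀ k ∈ K, A k ∈ K)

/-- The endomorphism of `W / K` induced by `A`, `[w] ↦ [A w]`
(with value `0` if `A` does not descend to the quotient). -/
def quotEndo (W K : Submodule ℝ F) (A : F →ₗ[ℝ] F) : QuotSpace W K →ₗ[ℝ] QuotSpace W K :=
  open Classical in
  if h : Descends W K A then
    Submodule.mapQ (K.submoduleOf W) (K.submoduleOf W) (A.restrict h.1)
      (fun x hx => h.2 x.1 hx)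
  else 0

/-- The bilinear form on `W / K` induced by `B`, evaluated on representatives. -/
def quotForm (W K : Submodule ℝ F) (B : F → F → ℝ) (x y : QuotSpace W K) : ℝ :=
  B (Function.surjInv (K.submoduleOf W).mkQ_surjective x : W)
    (Function.surjInv (K.submoduleOf W).mkQ_surjective y : W)

theorem quotEndo_quotClass (W K : Submodule ℝ F) (A : F →ₗ[ℝ] F) (h : Descends W K A)
    (w : F) (hw : w ∈ W) :
    quotEndo W K A (quotClass W K w) = quotClass W K (A w) := by
  simp [quotEndo, quotClass, h, hw, h.1 w hw]
  rfl

end Algebra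

/-! ### Local coordinate expressions

`ℓ (x, v)` is the Lagrangian in coordinates `(x, v)` of the tangent bundle, `z = (x, v)`. -/

section Local

variable {E : Type*} [NormedAddCommGroup E] [NormedSpace ℝ E]

/-- `g_{μν} = ∂²ℓ / ∂v^μ ∂v^ν`. -/
def fiberHess (ℓ : E × E → ℝ) (z : E × E) : E →L[ℝ] E →L[ℝ] ℝ :=
  fderiv ℝ (fderiv ℝ (fun w : E => ℓ (z.1, w))) z.2

/-- The covector `∂²ℓ/∂x^γ∂v^δ v^γ - ∂ℓ/∂x^δ`. -/
def sprayForm (ℓ : E × E → ℝ) (z : E × E) : E →L[ℝ] ℝ :=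
  fderiv ℝ (fun x : E => fderiv ℝ (fun w : E => ℓ (x, w)) z.2) z.1 z.2
    - fderiv ℝ (fun x : E => ℓ (x, z.2)) z.1

/-- The spray coefficients `G^α`,
`2 G^α = g^{αδ} (∂²ℓ/∂x^γ∂v^δ v^γ - ∂ℓ/∂x^δ)`. -/
def spray (ℓ : E × E → ℝ) (z : E × E) : E :=
  (1 / 2 : ℝ) • (fiberHess ℓ z).inverse (sprayForm ℓ z)

/-- The non-linear connection `N^μ_α = ∂G^μ/∂v^α`. -/
def nonlinConn (ℓ : E × E → ℝ) (z : E × E) : E →L[ℝ] E :=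
  fderiv ℝ (fun w : E => spray ℓ (z.1, w)) z.2

/-- `X ↦ X^α δN/δx^α`, where `δ/δx^α = ∂/∂x^α - N^ν_α ∂/∂v^ν`. -/
def horDerivConn (ℓ : E × E → ℝ) (z : E × E) : E →L[ℝ] E →L[ℝ] E :=
  fderiv ℝ (fun x : E => nonlinConn ℓ (x, z.2)) z.1
    - (fderiv ℝ (fun w : E => nonlinConn ℓ (z.1, w)) z.2).comp (nonlinConn ℓ z)

/-- The curvature of the non-linear connection,
`R^μ_{αβ} = δN^μ_β/δx^α - δN^μ_α/δx^β`, as `(X, Y) ↦ R^μ_{αβ} X^α Y^β`. -/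
def nonlinCurv (ℓ : E × E → ℝ) (z : E × E) : E →L[ℝ] E →L[ℝ] E :=
  horDerivConn ℓ z - (horDerivConn ℓ z).flip

/-- The Christoffel symbols `Γ(X, Y)` of a metric `γ` on (an open subset of) `E`:
`γ (Γ(X, Y), Z) = (∂_X γ(Y, Z) + ∂_Y γ(X, Z) - ∂_Z γ(X, Y)) / 2`. -/
def christoffel (γ : E → E →L[ℝ] E →L[ℝ] ℝ) (x X Y : E) : E :=
  (γ x).inverse ((1 / 2 : ℝ) •
    (fderiv ℝ γ x X Y + fderiv ℝ γ x Y X - ((fderiv ℝ γ x).flip X).flip Y))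

/-- A (symmetric) bilinear form of signature `(-, +, …, +)`. -/
def IsLorentzian (B : E →L[ℝ] E →L[ℝ] ℝ) : Prop :=
  (∀ a b, B a b = B b a) ∧
    ∃ t, B t t < 0 ∧ ∀ w, w ≠ 0 → B t w = 0 → 0 < B w w

end Local

/-! ### Manifolds -/

section Global

variable {E : Type*} [NormedAddCommGroup E] [NormedSpace ℝ E]
  {M : Type*} [TopologicalSpace M] [ChartedSpace E M]

/-- The tangent space of `M` at `p`. It is identified with `E` by the preferred chart at `p`. -/
abbrev TS (E : Type*) [NormedAddCommGroup E] [NormedSpace ℝ E]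
    {M : Type*} [TopologicalSpace M] [ChartedSpace E M] (p : M) : Type _ :=
  TangentSpace 𝓘(ℝ, E) p

/-- The metric `g_v` at `v ∈ T_p M`: the Hessian at `v` of the restriction of `L` to `T_p M`. -/
def metric [IsManifold 𝓘(ℝ, E) 1 M] (L : TangentBundle 𝓘(ℝ, E) M → ℝ) (p : M) (v : TS E p) :
    E →L[ℝ] E →L[ℝ] ℝ :=
  fderiv ℝ (fderiv ℝ (fun w : E => L ⟨p, w⟩)) v

variable [IsManifold 𝓘(ℝ, E) ∞ M]

variable (E M) in
/-- A Finsler spacetime: a smooth Lagrangian on the slit tangent bundle, positively homogeneous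
of degree two, with Lorentzian vertical Hessian, and a choice of a connected component (the
future timelike cone) of the locus `L < 0`. Values of `L` on the zero section are irrelevant. -/
structure FinslerSpacetime where
  L : TangentBundle 𝓘(ℝ, E) M → ℝ
  smooth : ContMDiffOn 𝓘(ℝ, E).tangent 𝓘(ℝ, ℝ) ∞ L {u | u.2 ≠ 0}
  homogeneous : ∀ (p : M) (v : TS E p), v ≠ 0 → ∀ s : ℝ, 0 < s →
    L ⟨p, s • v⟩ = s ^ 2 * L ⟨p, v⟩
  lorentzian : ∀ (p : M) (v : TS E p), v ≠ 0 → IsLorentzian (metric L p v)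
  future : Set (TangentBundle 𝓘(ℝ, E) M)
  future_component : ∃ u ∈ {u : TangentBundle 𝓘(ℝ, E) M | u.2 ≠ 0 ∧ L u < 0},
    future = connectedComponentIn {u : TangentBundle 𝓘(ℝ, E) M | u.2 ≠ 0 ∧ L u < 0} u

/-- The vector field `V` as a map to the tangent bundle. -/
def toSection (V : (q : M) → TS E q) (q : M) : TangentBundle 𝓘(ℝ, E) M := ⟨q, V q⟩

/-- The Lagrangian in the coordinates `(x, v)` of `TM` induced by the preferred chart at `p`. -/
def chartLag (L : TangentBundle 𝓘(ℝ, E) M → ℝ) (p : M) (z : E × E) : ℝ :=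
  L ((extChartAt 𝓘(ℝ, E).tangent (⟨p, 0⟩ : TangentBundle 𝓘(ℝ, E) M)).symm z)

/-- The components of the vector field `V` in the preferred chart at `p`. -/
def chartField (V : (q : M) → TS E q) (p : M) (x : E) : E :=
  (extChartAt 𝓘(ℝ, E).tangent (⟨p, 0⟩ : TangentBundle 𝓘(ℝ, E) M)
    (toSection V ((extChartAt 𝓘(ℝ, E) p).symm x))).2

variable (E) in
/-- The expression of the subset `S` in the preferred chart at `p`. -/
def chartSet (S : Set M) (p : M) : Set E :=
  (extChartAt 𝓘(ℝ, E) p).symm ⁻¹' S ∩ (extChartAt 𝓘(ℝ, E) p).target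

/-! ### Hypersurfaces -/

variable (E) in
/-- Embedded `C^2` hypersurface: locally the zero set of a `C^2` function with non-vanishing
differential. -/
def IsC2Hypersurface (S : Set M) : Prop :=
  ∀ p ∈ S, ∃ U : Set M, IsOpen U ∧ p ∈ U ∧ ∃ f : M → ℝ,
    ContMDiffOn 𝓘(ℝ, E) 𝓘(ℝ, ℝ) 2 f U ∧
    (∀ q ∈ U, mfderiv 𝓘(ℝ, E) 𝓘(ℝ, ℝ) f q ≠ 0) ∧
    S ∩ U = {q ∈ U | f q = 0}

/-- The tangent space `T_p S`: the vectors annihilated by the differentials at `p` of all `C^1`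
functions that vanish on `S` near `p`. -/
def tangentOf (S : Set M) (p : M) : Submodule ℝ (TS E p) where
  carrier := {X | ∀ f : M → ℝ, ContMDiffAt 𝓘(ℝ, E) 𝓘(ℝ, ℝ) 1 f p →
    (∀ᶠ q in 𝓝[S] p, f q = 0) → mfderiv 𝓘(ℝ, E) 𝓘(ℝ, ℝ) f p X = 0}
  add_mem' := fun ha hb f hf h0 => by rw [map_add, ha f hf h0, hb f hf h0, add_zero]
  zero_mem' := fun f _ _ => map_zero _
  smul_mem' := fun c X hX f hf h0 => by rw [map_smul, hX f hf h0, smul_zero]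

/-- `X` is, near `p`, a `C^1` vector field on `S` tangent to `S`. -/
def IsC1TangentFieldAt (S : Set M) (X : (q : M) → TS E q) (p : M) : Prop :=
  ContMDiffWithinAt 𝓘(ℝ, E) 𝓘(ℝ, E).tangent 1 (toSection X) S p ∧
    ∀ᶠ q in 𝓝[S] p, X q ∈ tangentOf S q

/-- The derivative at `p` of the components of `V` (in the preferred chart at `p`) along `S`;
only its values on `T_p S` are meaningful. -/
def derivAlong (S : Set M) (V : (q : M) → TS E q) (p : M) : E →L[ℝ] E :=
  fderivWithin ℝ (chartField V p) (chartSet E S p) (extChartAt 𝓘(ℝ, E) p p)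

namespace FinslerSpacetime

variable (F : FinslerSpacetime E M)

/-- Future-directed lightlike vectors: non-zero elements of the boundary of the future
timelike cone. -/
def FutureLightlike (u : TangentBundle 𝓘(ℝ, E) M) : Prop :=
  u.2 ≠ 0 ∧ u ∈ frontier F.future

/-- `v` is a future-directed lightlike vector in `T_p S` with `ker g_v(v, ·) = T_p S`. -/
def IsNullTangent (S : Set M) (p : M) (v : TS E p) : Prop :=
  F.FutureLightlike ⟨p, v⟩ ∧ v ∈ tangentOf S p ∧
    ∀ X : TS E p, X ∈ tangentOf S p ↔ metric F.L p v v X = 0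

/-- `C^2` null hypersurface. -/
def IsNullHypersurface (S : Set M) : Prop :=
  IsC2Hypersurface E S ∧ ∀ p ∈ S, ∃ v : TS E p, F.IsNullTangent S p v

/-- `n` is a `C^1` future-directed lightlike vector field on `S`, tangent to `S`
(and normal to `S` in the sense `ker g_n(n, ·) = TS`). -/
def IsNullField (S : Set M) (n : (q : M) → TS E q) : Prop :=
  ContMDiffOn 𝓘(ℝ, E) 𝓘(ℝ, E).tangent 1 (toSection n) S ∧
    ∀ p ∈ S, F.IsNullTangent S p (n p)

/-- The covariant derivative `X ↦ D_X n`, `(D_X n)^α = (∂_μ n^α + N^α_μ(x, n(x))) X^μ`, of the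
non-linear connection, for a vector field `n` along `S`; meaningful for `X ∈ T_p S`. -/
def covDeriv (S : Set M) (n : (q : M) → TS E q) (p : M) : TS E p →ₗ[ℝ] TS E p :=
  ((derivAlong S n p
    + nonlinConn (chartLag F.L p) (extChartAt 𝓘(ℝ, E) p p, n p) : E →L[ℝ] E) : E →ₗ[ℝ] E)

/-- The non-linear curvature `R^N_v(X, Y)`. -/
def curvN (p : M) (v : TS E p) : E →L[ℝ] E →L[ℝ] E :=
  nonlinCurv (chartLag F.L p) (extChartAt 𝓘(ℝ, E) p p, v)

/-- The curvature endomorphism `R_v(X) = R^N_v(X, v)`. -/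
def curvEndo (p : M) (v : TS E p) : TS E p →ₗ[ℝ] TS E p :=
  (((F.curvN p v).flip v : E →L[ℝ] E) : E →ₗ[ℝ] E)

/-- The Ricci scalar `Ric(v) = tr R_v`. -/
def ricci (p : M) (v : TS E p) : ℝ :=
  LinearMap.trace ℝ (TS E p) (F.curvEndo p v)

/-! ### The bundle `V = TS / n` -/

/-- The fibre `V_p = T_p S / ℝ n`. -/
abbrev VFibre (S : Set M) (n : (q : M) → TS E q) (p : M) : Type _ :=
  QuotSpace (tangentOf S p) (Submodule.span ℝ {n p})

/-- The class in `V_p` of a vector of `T_p S`. -/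
def bar (S : Set M) (n : (q : M) → TS E q) (p : M) (X : TS E p) : VFibre S n p :=
  quotClass (tangentOf S p) (Submodule.span ℝ {n p}) X

/-- The scalar product `h` on `V_p`. -/
def hForm (S : Set M) (n : (q : M) → TS E q) (p : M) (X Y : VFibre S n p) : ℝ :=
  quotForm (tangentOf S p) (Submodule.span ℝ {n p}) (fun a b => metric F.L p (n p) a b) X Y

/-- The null Weingarten map `b`, induced on `V_p` by `X ↦ D_X n`. -/
def weingarten (S : Set M) (n : (q : M) → TS E q) (p : M) :
    VFibre S n p →ₗ[ℝ] VFibre S n p :=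
  quotEndo (tangentOf S p) (Submodule.span ℝ {n p}) (F.covDeriv S n p)

/-- The endomorphism `R̄` of `V_p`, induced by `R_n`. -/
def curvBar (S : Set M) (n : (q : M) → TS E q) (p : M) :
    VFibre S n p →ₗ[ℝ] VFibre S n p :=
  quotEndo (tangentOf S p) (Submodule.span ℝ {n p}) (F.curvEndo p (n p))

/-- The trace-free part `C̄ = R̄ - (tr R̄ / (dim M - 2)) Id` of `R̄`. -/
def weylBar (S : Set M) (n : (q : M) → TS E q) (p : M) :
    VFibre S n p →ₗ[ℝ] VFibre S n p :=
  F.curvBar S n p - (((Module.finrank ℝ E : ℝ) - 2)⁻¹ *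
    LinearMap.trace ℝ (VFibre S n p) (F.curvBar S n p)) • LinearMap.id

/-! ### Lie derivatives along `n` -/

/-- The derivative at `p` of the function `f` on `S` in the direction `X ∈ T_p S`. -/
def dirDeriv (S : Set M) (f : M → ℝ) (p : M) (X : TS E p) : ℝ :=
  (mfderivWithin 𝓘(ℝ, E) 𝓘(ℝ, ℝ) f S p X : ℝ)

/-- `[n, X]` for vector fields tangent to `S`. -/
def bracket (S : Set M) (n X : (q : M) → TS E q) (p : M) : TS E p :=
  VectorField.mlieBracketWithin 𝓘(ℝ, E) n X S p

/-- `(L_n ĝ)(X, Y) = n(g_n(X, Y)) - g_n([n, X], Y) - g_n(X, [n, Y])` for vector fields `X`, `Y`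
tangent to `S`. -/
def lieMetric (S : Set M) (n X Y : (q : M) → TS E q) (p : M) : ℝ :=
  dirDeriv S (fun q => metric F.L q (n q) (X q) (Y q)) p (n p)
    - metric F.L p (n p) (bracket S n X p) (Y p)
    - metric F.L p (n p) (X p) (bracket S n Y p)

/-- `(L_n h)(X̄, Ȳ) = n(h(X̄, Ȳ)) - h(L_n X̄, Ȳ) - h(X̄, L_n Ȳ)` for the sections `X̄`, `Ȳ` of
`V` represented by `X` and `Y`, where `L_n X̄` is the class of `[n, X]`. -/
def lieH (S : Set M) (n X Y : (q : M) → TS E q) (p : M) : ℝ :=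
  dirDeriv S (fun q => F.hForm S n q (bar S n q (X q)) (bar S n q (Y q))) p (n p)
    - F.hForm S n p (bar S n p (bracket S n X p)) (bar S n p (Y p))
    - F.hForm S n p (bar S n p (X p)) (bar S n p (bracket S n Y p))

/-! ### The Levi-Civita connection of `g_n` -/

/-- `m` is a `C^1` nowhere vanishing vector field on an open neighborhood `U` of `S` that
extends `n`. -/
def IsExtension (S : Set M) (n : (q : M) → TS E q) (U : Set M) (m : (q : M) → TS E q) : Prop :=
  IsOpen U ∧ S ⊆ U ∧ ContMDiffOn 𝓘(ℝ, E) 𝓘(ℝ, E).tangent 1 (toSection m) U ∧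
    (∀ q ∈ U, m q ≠ 0) ∧ ∀ q ∈ S, m q = n q

/-- The pulled back metric `g_m`, `x ↦ g(x, m(x))`, in the preferred chart at `p`. -/
def pullbackMetric (m : (q : M) → TS E q) (p : M) (x : E) : E →L[ℝ] E →L[ℝ] ℝ :=
  fiberHess (chartLag F.L p) (x, chartField m p x)

/-- `∇^{g_m}_X Y` at `p`, for the Levi-Civita connection of `g_m`, where `X ∈ T_p S` and `Y` is a
vector field along `S`. -/
def leviCivita (m : (q : M) → TS E q) (S : Set M) (Y : (q : M) → TS E q) (p : M) (X : TS E p) :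
    TS E p :=
  (derivAlong S Y p X
    + christoffel (F.pullbackMetric m p) (extChartAt 𝓘(ℝ, E) p p) X (Y p) : E)

/-- `∇^{g_m}_X Y ∈ TS` for all `X ∈ T_p S`, `p ∈ S`, and all `C^1` vector fields `Y` tangent
to `S`. -/
def PreservesTangent (S : Set M) (m : (q : M) → TS E q) : Prop :=
  ∀ p ∈ S, ∀ X ∈ tangentOf S p, ∀ Y : (q : M) → TS E q, IsC1TangentFieldAt S Y p →
    F.leviCivita m S Y p X ∈ tangentOf S p

end FinslerSpacetime

end Global

end LorentzFinsler

end

open LorentzFinsler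

namespace LorentzFinsler

/-! ### Linear algebra of Lorentzian forms -/

section LorentzAlgebra

variable {E : Type*} [NormedAddCommGroup E] [NormedSpace ℝ E]

/-! Work in a chart: let `ℓ` be the Lagrangian, `m` the components of the null field and `θ = ∂ℓ/∂v
(x, m)`. Homogeneity gives `θ = g_m(m, ·)`, so along the hypersurface `H = {f = 0}` the null
condition reads `ker θ = ker df`. All six conditions reduce to the vanishing of one bilinear form on
`TH`, the Lie derivative `L` of `g_m` along `m` (`lieForm`).

Two properties of `N` matter first. The horizontal derivative of `ℓ` vanishes
(`fibreDeriv_nonlinConn`); as `ℓ(x, m) = 0` on `H`, this makes `D_X m` tangent to `H`. And the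
antisymmetric part of `g(N ·, ·)` is that of `∂²ℓ/∂x∂v` (`fiberHess_nonlinConn_antisymm`). Since `θ`
is a multiple of `df` on `H`, its derivative is symmetric on `TH`, so `X ↦ D_X m` is self-adjoint
there (`fiberHess_covDerivLocal_symm`). Hence `g(D_m m, X) = g(m, D_X m) = 0` for tangent `X`, and
`D_m m` is a multiple of `m`.

With this and the compatibility of `g` with `N` along the spray, `L(X, Y) = 2 g(D_X m, Y)` on `TH`
(`lieForm_eq`). The orthogonal complement of `TH` is `ℝ m`, so `b = 0` amounts to `L = 0`. Both Lie
derivatives in the theorem equal `L`, and `θ(∇_X Y) = -L(X, Y)/2` for every extension of the null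
field; thus one extension serves as well as all.

For the curvature, `D_X m = ω(X) m` cannot simply be differentiated again, because `m` is only
`C^1`. Dividing `m` by `φ(m)` for a constant functional `φ` gives a field `μ` with `dμ = A` on `TH`,
where `A` is built from `N` and `μ` and is again differentiable. Symmetry of second derivatives then
forces the curvature `R(X, Y)` into `ℝ m` (`nonlinCurv_mem_span`). Moreover `R_n` kills `n` by
antisymmetry and always takes values in `TH`, since `ℓ` is horizontally constant; so `R_n` is
nilpotent and the Ricci scalar vanishes.

Each tensor at a point is defined in the preferred chart of that point. Charts are compared only
through `L`, whose invariance (`lieForm_comp`) makes the transformation law of `N` unnecessary. -/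

theorem IsLorentzian.eq_zero {B : E →L[ℝ] E →L[ℝ] ℝ} (hB : IsLorentzian B) {a : E}
    (h : ∀ w, B a w = 0) : a = 0 := by
  obtain ⟨hs, t, ht, hp⟩ := hB
  by_contra ha
  -- A vector orthogonal to everything is orthogonal to the timelike `t`, hence spacelike or zero.
  have h1 := hp a ha (by rw [hs, h])
  rw [h a] at h1
  exact lt_irrefl _ h1

theorem IsLorentzian.eq_of_forall {B : E →L[ℝ] E →L[ℝ] ℝ} (hB : IsLorentzian B) {a b : E}
    (h : ∀ w, B a w = B b w) : a = b :=
  sub_eq_zero.1 (hB.eq_zero fun w => by simp [h w])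

/-- `ContinuousLinearMap.inverse` is zero on non-invertible maps; this is what makes the inverses in
`spray` and `christoffel` genuine. -/
theorem IsLorentzian.isInvertible [FiniteDimensional ℝ E] {B : E →L[ℝ] E →L[ℝ] ℝ}
    (hB : IsLorentzian B) : B.IsInvertible := by
  have hinj : Function.Injective (B : E →ₗ[ℝ] (E →L[ℝ] ℝ)) := by
    intro a b hab
    refine hB.eq_of_forall fun w => ?_
    exact congrArg (fun φ : E →L[ℝ] ℝ => φ w) hab
  have hdim : Module.finrank ℝ E = Module.finrank ℝ (E →L[ℝ] ℝ) := by
    rw [← (LinearMap.toContinuousLinearMap : (E →ₗ[ℝ] ℝ) ≃ₗ[ℝ] (E →L[ℝ] ℝ)).finrank_eq]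
    exact (Subspace.dual_finrank_eq (K := ℝ) (V := E)).symm
  let e := LinearEquiv.ofInjectiveOfFinrankEq (B : E →ₗ[ℝ] (E →L[ℝ] ℝ)) hinj hdim
  exact ⟨e.toContinuousLinearEquiv, by ext; rfl⟩

theorem IsLorentzian.apply_inverse [FiniteDimensional ℝ E] {B : E →L[ℝ] E →L[ℝ] ℝ}
    (hB : IsLorentzian B) (φ : E →L[ℝ] ℝ) : B (B.inverse φ) = φ := by
  obtain ⟨e, rfl⟩ := hB.isInvertible
  simp

/-- The orthogonal complement of `n^⊥` is the line spanned by `n`. -/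
theorem IsLorentzian.mem_span_of_orthogonal {B : E →L[ℝ] E →L[ℝ] ℝ} (hB : IsLorentzian B)
    {a n : E} (h : ∀ w, B n w = 0 → B a w = 0) : a ∈ Submodule.span ℝ {n} := by
  by_cases hn : ∀ w, B n w = 0
  · rw [hB.eq_zero fun w => h w (hn w)]
    exact Submodule.zero_mem _
  push Not at hn
  obtain ⟨z, hz⟩ := hn
  -- Any `w` splits into a multiple of `z` and a vector orthogonal to `n`; the functional `B a`
  -- kills the latter, so it is a multiple of `B n`, with the ratio read off at `z`.
  refine Submodule.mem_span_singleton.2 ⟨B a z / B n z, hB.eq_of_forall fun w => ?_⟩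
  have h1 := h (w - (B n w / B n z) • z) (by simp [hz])
  simp only [map_sub, map_smul, smul_eq_mul] at h1
  simp only [map_smul, smul_apply, smul_eq_mul]
  field_simp at h1 ⊢
  linarith

end LorentzAlgebra

/-! ### Partial derivatives on `E × E` -/

section Partial

variable {E : Type*} [NormedAddCommGroup E] [NormedSpace ℝ E]
  {W : Type*} [NormedAddCommGroup W] [NormedSpace ℝ W]

/-- The partial derivative with respect to the base point. -/
noncomputable def baseDeriv (F : E × E → W) (z : E × E) : E →L[ℝ] W :=
  fderiv ℝ (fun x : E => F (x, z.2)) z.1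

/-- The partial derivative with respect to the fibre coordinate. -/
noncomputable def fibreDeriv (F : E × E → W) (z : E × E) : E →L[ℝ] W :=
  fderiv ℝ (fun w : E => F (z.1, w)) z.2

theorem baseDeriv_eq {F : E × E → W} {z : E × E} (h : DifferentiableAt ℝ F z) :
    baseDeriv F z = (fderiv ℝ F z).comp (ContinuousLinearMap.inl ℝ E E) :=
  (h.hasFDerivAt.comp z.1 (hasFDerivAt_prodMk_left z.1 z.2)).fderiv

theorem fibreDeriv_eq {F : E × E → W} {z : E × E} (h : DifferentiableAt ℝ F z) :
    fibreDeriv F z = (fderiv ℝ F z).comp (ContinuousLinearMap.inr ℝ E E) :=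
  (h.hasFDerivAt.comp z.2 (hasFDerivAt_prodMk_right z.1 z.2)).fderiv

theorem fderiv_eq_partial {F : E × E → W} {z : E × E} (h : DifferentiableAt ℝ F z) (u : E × E) :
    fderiv ℝ F z u = baseDeriv F z u.1 + fibreDeriv F z u.2 := by
  rw [baseDeriv_eq h, fibreDeriv_eq h]
  simp [← map_add]

theorem baseDeriv_contDiffOn {F : E × E → W} {Ω : Set (E × E)} (hΩ : IsOpen Ω)
    (h : ContDiffOn ℝ ∞ F Ω) : ContDiffOn ℝ ∞ (baseDeriv F) Ω := by
  have h1 : ContDiffOn ℝ ∞ (fderiv ℝ F) Ω := h.fderiv_of_isOpen hΩ (by simp)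
  refine (h1.clm_comp contDiffOn_const).congr fun z hz => baseDeriv_eq ?_
  exact (h.differentiableOn (by simp)).differentiableAt (hΩ.mem_nhds hz)

theorem fibreDeriv_contDiffOn {F : E × E → W} {Ω : Set (E × E)} (hΩ : IsOpen Ω)
    (h : ContDiffOn ℝ ∞ F Ω) : ContDiffOn ℝ ∞ (fibreDeriv F) Ω := by
  have h1 : ContDiffOn ℝ ∞ (fderiv ℝ F) Ω := h.fderiv_of_isOpen hΩ (by simp)
  refine (h1.clm_comp contDiffOn_const).congr fun z hz => fibreDeriv_eq ?_
  exact (h.differentiableOn (by simp)).differentiableAt (hΩ.mem_nhds hz)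

theorem differentiableAt_of_contDiffOn {F : E × E → W} {Ω : Set (E × E)} (hΩ : IsOpen Ω)
    (h : ContDiffOn ℝ ∞ F Ω) {z : E × E} (hz : z ∈ Ω) : DifferentiableAt ℝ F z :=
  (h.differentiableOn (by simp)).differentiableAt (hΩ.mem_nhds hz)

/-- Expresses iterated partial derivatives as entries of the full second derivative, so that the
commutation rules below all follow from its symmetry. -/
theorem baseDeriv_apply_fderiv {F : E × E → W} {Ω : Set (E × E)} (hΩ : IsOpen Ω)
    (h : ContDiffOn ℝ ∞ F Ω) {z : E × E} (hz : z ∈ Ω) (u : E × E) (b : E) :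
    fderiv ℝ (baseDeriv F) z u b = fderiv ℝ (fderiv ℝ F) z u (b, 0) := by
  have h1 : ContDiffOn ℝ ∞ (fderiv ℝ F) Ω := h.fderiv_of_isOpen hΩ (by simp)
  have h2 : DifferentiableAt ℝ (fderiv ℝ F) z :=
    (h1.differentiableOn (by simp)).differentiableAt (hΩ.mem_nhds hz)
  have h3 : baseDeriv F =ᶠ[𝓝 z] fun y => (fderiv ℝ F y).comp (ContinuousLinearMap.inl ℝ E E) := by
    filter_upwards [hΩ.mem_nhds hz] with y hy
    exact baseDeriv_eq (differentiableAt_of_contDiffOn hΩ h hy)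
  rw [h3.fderiv_eq, (h2.hasFDerivAt.clm_comp
    (hasFDerivAt_const (ContinuousLinearMap.inl ℝ E E) z)).fderiv]
  simp

theorem fibreDeriv_apply_fderiv {F : E × E → W} {Ω : Set (E × E)} (hΩ : IsOpen Ω)
    (h : ContDiffOn ℝ ∞ F Ω) {z : E × E} (hz : z ∈ Ω) (u : E × E) (b : E) :
    fderiv ℝ (fibreDeriv F) z u b = fderiv ℝ (fderiv ℝ F) z u (0, b) := by
  have h1 : ContDiffOn ℝ ∞ (fderiv ℝ F) Ω := h.fderiv_of_isOpen hΩ (by simp)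
  have h2 : DifferentiableAt ℝ (fderiv ℝ F) z :=
    (h1.differentiableOn (by simp)).differentiableAt (hΩ.mem_nhds hz)
  have h3 : fibreDeriv F =ᶠ[𝓝 z] fun y => (fderiv ℝ F y).comp (ContinuousLinearMap.inr ℝ E E) := by
    filter_upwards [hΩ.mem_nhds hz] with y hy
    exact fibreDeriv_eq (differentiableAt_of_contDiffOn hΩ h hy)
  rw [h3.fderiv_eq, (h2.hasFDerivAt.clm_comp
    (hasFDerivAt_const (ContinuousLinearMap.inr ℝ E E) z)).fderiv]
  simp

theorem fderiv_fderiv_symm {F : E × E → W} {Ω : Set (E × E)} (hΩ : IsOpen Ω)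
    (h : ContDiffOn ℝ ∞ F Ω) {z : E × E} (hz : z ∈ Ω) (u w : E × E) :
    fderiv ℝ (fderiv ℝ F) z u w = fderiv ℝ (fderiv ℝ F) z w u := by
  refine ((h.contDiffAt (hΩ.mem_nhds hz)).isSymmSndFDerivAt ?_) u w
  rw [minSmoothness_of_isRCLikeNormedField]
  exact WithTop.coe_le_coe.2 le_top

theorem baseDeriv_baseDeriv_symm {F : E × E → W} {Ω : Set (E × E)} (hΩ : IsOpen Ω)
    (h : ContDiffOn ℝ ∞ F Ω) {z : E × E} (hz : z ∈ Ω) (a b : E) :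
    baseDeriv (baseDeriv F) z a b = baseDeriv (baseDeriv F) z b a := by
  rw [baseDeriv_eq (differentiableAt_of_contDiffOn hΩ (baseDeriv_contDiffOn hΩ h) hz)]
  simp [baseDeriv_apply_fderiv hΩ h hz, fderiv_fderiv_symm hΩ h hz (a, 0)]

theorem fibreDeriv_fibreDeriv_symm {F : E × E → W} {Ω : Set (E × E)} (hΩ : IsOpen Ω)
    (h : ContDiffOn ℝ ∞ F Ω) {z : E × E} (hz : z ∈ Ω) (a b : E) :
    fibreDeriv (fibreDeriv F) z a b = fibreDeriv (fibreDeriv F) z b a := by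
  rw [fibreDeriv_eq (differentiableAt_of_contDiffOn hΩ (fibreDeriv_contDiffOn hΩ h) hz)]
  simp [fibreDeriv_apply_fderiv hΩ h hz, fderiv_fderiv_symm hΩ h hz (0, a)]

theorem fibreDeriv_baseDeriv {F : E × E → W} {Ω : Set (E × E)} (hΩ : IsOpen Ω)
    (h : ContDiffOn ℝ ∞ F Ω) {z : E × E} (hz : z ∈ Ω) (a b : E) :
    fibreDeriv (baseDeriv F) z a b = baseDeriv (fibreDeriv F) z b a := by
  rw [fibreDeriv_eq (differentiableAt_of_contDiffOn hΩ (baseDeriv_contDiffOn hΩ h) hz),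
    baseDeriv_eq (differentiableAt_of_contDiffOn hΩ (fibreDeriv_contDiffOn hΩ h) hz)]
  simp [fibreDeriv_apply_fderiv hΩ h hz, baseDeriv_apply_fderiv hΩ h hz,
    fderiv_fderiv_symm hΩ h hz (0, a)]

theorem hasDerivAt_line (z : E × E) (a b : E) :
    HasDerivAt (fun t : ℝ => ((z.1 + t • a, z.2 + t • b) : E × E)) (a, b) 0 := by
  have h1 : HasDerivAt (fun t : ℝ => z.1 + t • a) a 0 := by
    simpa using ((hasDerivAt_id (0 : ℝ)).smul_const a).const_add z.1
  have h2 : HasDerivAt (fun t : ℝ => z.2 + t • b) b 0 := by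
    simpa using ((hasDerivAt_id (0 : ℝ)).smul_const b).const_add z.2
  exact h1.prodMk h2

theorem hasDerivAt_along_line {F : E × E → W} {z : E × E} (h : DifferentiableAt ℝ F z) (a b : E) :
    HasDerivAt (fun t : ℝ => F (z.1 + t • a, z.2 + t • b))
      (baseDeriv F z a + fibreDeriv F z b) 0 := by
  have h1 := hasDerivAt_line z a b
  have h2 : HasFDerivAt F (fderiv ℝ F z) ((fun t : ℝ => ((z.1 + t • a, z.2 + t • b) : E × E)) 0) := by
    simpa using h.hasFDerivAt
  have h3 := h2.comp_hasDerivAt (0 : ℝ) h1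
  rw [fderiv_eq_partial h] at h3
  exact h3

/-- Two functions that agree on an open set have the same derivatives along lines. -/
theorem deriv_line_eq_of_eqOn {A B : E × E → W} {Ω : Set (E × E)} (hΩ : IsOpen Ω)
    (h : ∀ z ∈ Ω, A z = B z) {z : E × E} (hz : z ∈ Ω) {a b : E} {A' B' : W}
    (hA : HasDerivAt (fun t : ℝ => A (z.1 + t • a, z.2 + t • b)) A' 0)
    (hB : HasDerivAt (fun t : ℝ => B (z.1 + t • a, z.2 + t • b)) B' 0) : A' = B' := by
  refine (hA.congr_of_eventuallyEq ?_).unique hB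
  have h1 := (hasDerivAt_line z a b).continuousAt
  have h2 := h1.preimage_mem_nhds (t := Ω) (hΩ.mem_nhds (by simpa using hz))
  filter_upwards [h2] with t ht
  exact (h _ ht).symm

theorem hasFDerivAt_comp_section {F : E × E → W} {m : E → E} {m' : E →L[ℝ] E} {x : E}
    (h : DifferentiableAt ℝ F (x, m x)) (hm : HasFDerivAt m m' x) :
    HasFDerivAt (fun y => F (y, m y)) (baseDeriv F (x, m x) + (fibreDeriv F (x, m x)).comp m') x := by
  have h1 := h.hasFDerivAt.comp x ((hasFDerivAt_id x).prodMk hm)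
  refine h1.congr_fderiv ?_
  ext u
  simp [fderiv_eq_partial h]

end Partial

/-! ### Identities for a Lorentz-Finsler Lagrangian in coordinates -/

section LocalLagrangian

variable {E : Type*} [NormedAddCommGroup E] [NormedSpace ℝ E]

/-- The tangent vectors with base point in `O`, without the zero section. -/
def slit (O : Set E) : Set (E × E) := O ×ˢ {0}ᶜ

/-- `ℓ` is the coordinate expression, over the open set `O`, of a Lorentz-Finsler Lagrangian. -/
structure IsLocalLagrangian (ℓ : E × E → ℝ) (O : Set E) : Prop where
  isOpen : IsOpen O
  smooth : ContDiffOn ℝ ∞ ℓ (slit O)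
  homogeneous : ∀ z ∈ slit O, ∀ s : ℝ, 0 < s → ℓ (z.1, s • z.2) = s ^ 2 * ℓ z
  lorentzian : ∀ z ∈ slit O, IsLorentzian (fiberHess ℓ z)

theorem fiberHess_eq (ℓ : E × E → ℝ) : fiberHess ℓ = fibreDeriv (fibreDeriv ℓ) := rfl

theorem sprayForm_eq (ℓ : E × E → ℝ) (z : E × E) :
    sprayForm ℓ z = baseDeriv (fibreDeriv ℓ) z z.2 - baseDeriv ℓ z := rfl

theorem nonlinConn_eq (ℓ : E × E → ℝ) : nonlinConn ℓ = fibreDeriv (spray ℓ) := rfl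

theorem horDerivConn_apply (ℓ : E × E → ℝ) (z : E × E) (X Y : E) :
    horDerivConn ℓ z X Y = baseDeriv (nonlinConn ℓ) z X Y
      - fibreDeriv (nonlinConn ℓ) z (nonlinConn ℓ z X) Y := rfl

theorem nonlinCurv_apply (ℓ : E × E → ℝ) (z : E × E) (X Y : E) :
    nonlinCurv ℓ z X Y = horDerivConn ℓ z X Y - horDerivConn ℓ z Y X := rfl

namespace IsLocalLagrangian

variable {ℓ : E × E → ℝ} {O : Set E} (h : IsLocalLagrangian ℓ O)
include h

theorem isOpen_slit : IsOpen (slit O) := h.isOpen.prod isOpen_compl_singleton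

theorem contDiffOn_fibreDeriv : ContDiffOn ℝ ∞ (fibreDeriv ℓ) (slit O) :=
  fibreDeriv_contDiffOn h.isOpen_slit h.smooth

theorem contDiffOn_baseDeriv : ContDiffOn ℝ ∞ (baseDeriv ℓ) (slit O) :=
  baseDeriv_contDiffOn h.isOpen_slit h.smooth

theorem contDiffOn_fiberHess : ContDiffOn ℝ ∞ (fiberHess ℓ) (slit O) :=
  fibreDeriv_contDiffOn h.isOpen_slit h.contDiffOn_fibreDeriv

theorem contDiffOn_mixedDeriv : ContDiffOn ℝ ∞ (baseDeriv (fibreDeriv ℓ)) (slit O) :=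
  baseDeriv_contDiffOn h.isOpen_slit h.contDiffOn_fibreDeriv

theorem contDiffOn_sprayForm : ContDiffOn ℝ ∞ (sprayForm ℓ) (slit O) :=
  (h.contDiffOn_mixedDeriv.clm_apply contDiffOn_snd).sub h.contDiffOn_baseDeriv

/-- Euler's relation, from differentiating `ℓ (x, (1 + t) v) = (1 + t)² ℓ (x, v)` at `t = 0`. -/
theorem fibreDeriv_apply_self {z : E × E} (hz : z ∈ slit O) : fibreDeriv ℓ z z.2 = 2 * ℓ z := by
  have hd := differentiableAt_of_contDiffOn h.isOpen_slit h.smooth hz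
  have h1 := hasDerivAt_along_line hd 0 z.2
  have h2 : HasDerivAt (fun t : ℝ => (1 + t) ^ 2 * ℓ z) (2 * ℓ z) 0 := by
    have := (((hasDerivAt_id (0 : ℝ)).const_add 1).pow 2).mul_const (ℓ z)
    simpa using this
  rw [map_zero, zero_add] at h1
  refine (h1.congr_of_eventuallyEq ?_).unique h2
  -- Homogeneity holds for positive factors only, hence `t > -1`.
  filter_upwards [lt_mem_nhds (show (-1 : ℝ) < 0 by norm_num)] with t ht
  rw [← h.homogeneous z hz (1 + t) (by linarith)]
  simp [add_smul]

theorem fiberHess_symm {z : E × E} (hz : z ∈ slit O) (a b : E) :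
    fiberHess ℓ z a b = fiberHess ℓ z b a := (h.lorentzian z hz).1 a b

/-- Euler's relation differentiated in the fibre direction `w`. It identifies the 1-form `g_v(v, ·)`
with `∂ℓ/∂v`, which is the form used in all later computations. -/
theorem fiberHess_apply_self {z : E × E} (hz : z ∈ slit O) (w : E) :
    fiberHess ℓ z z.2 w = fibreDeriv ℓ z w := by
  have hd := differentiableAt_of_contDiffOn h.isOpen_slit h.smooth hz
  have hd1 := differentiableAt_of_contDiffOn h.isOpen_slit h.contDiffOn_fibreDeriv hz
  have h1 := (hasDerivAt_along_line hd1 0 w).clm_apply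
    ((((hasDerivAt_id (0 : ℝ)).smul_const w).const_add z.2))
  have h2 := (hasDerivAt_along_line hd 0 w).const_mul 2
  have h3 := deriv_line_eq_of_eqOn (A := fun z => fibreDeriv ℓ z z.2) (B := fun z => 2 * ℓ z)
    h.isOpen_slit (fun z hz => h.fibreDeriv_apply_self hz) hz h1 h2
  simp only [map_zero, zero_add, id_eq, zero_smul, add_zero, one_smul, ← fiberHess_eq] at h3
  rw [h.fiberHess_symm hz]
  linarith

theorem fibreDeriv_fiberHess_comm {z : E × E} (hz : z ∈ slit O) (a b c : E) :
    fibreDeriv (fiberHess ℓ) z a b c = fibreDeriv (fiberHess ℓ) z b a c := by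
  rw [fiberHess_eq, fibreDeriv_fibreDeriv_symm h.isOpen_slit h.contDiffOn_fibreDeriv hz]

theorem baseDeriv_fiberHess_comm {z : E × E} (hz : z ∈ slit O) (a b c : E) :
    baseDeriv (fiberHess ℓ) z a b c = baseDeriv (fiberHess ℓ) z a c b := by
  have hd := differentiableAt_of_contDiffOn h.isOpen_slit h.contDiffOn_fiberHess hz
  have h1 := fun b c : E => ((hasDerivAt_along_line hd a 0).clm_apply
    (hasDerivAt_const (0 : ℝ) b)).clm_apply (hasDerivAt_const (0 : ℝ) c)
  have h3 := deriv_line_eq_of_eqOn (A := fun z => fiberHess ℓ z b c)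
    (B := fun z => fiberHess ℓ z c b) h.isOpen_slit (fun z hz => h.fiberHess_symm hz b c) hz
    (h1 b c) (h1 c b)
  simpa using h3

theorem fibreDeriv_fiberHess_symm {z : E × E} (hz : z ∈ slit O) (a b c : E) :
    fibreDeriv (fiberHess ℓ) z a b c = fibreDeriv (fiberHess ℓ) z a c b := by
  have hd := differentiableAt_of_contDiffOn h.isOpen_slit h.contDiffOn_fiberHess hz
  have h1 := fun b c : E => ((hasDerivAt_along_line hd 0 a).clm_apply
    (hasDerivAt_const (0 : ℝ) b)).clm_apply (hasDerivAt_const (0 : ℝ) c)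
  have h3 := deriv_line_eq_of_eqOn (A := fun z => fiberHess ℓ z b c)
    (B := fun z => fiberHess ℓ z c b) h.isOpen_slit (fun z hz => h.fiberHess_symm hz b c) hz
    (h1 b c) (h1 c b)
  simpa using h3

/-- The Cartan tensor vanishes on the supporting direction. -/
theorem fibreDeriv_fiberHess_self {z : E × E} (hz : z ∈ slit O) :
    fibreDeriv (fiberHess ℓ) z z.2 = 0 := by
  ext u w
  have hd := differentiableAt_of_contDiffOn h.isOpen_slit h.contDiffOn_fiberHess hz
  have hd1 := differentiableAt_of_contDiffOn h.isOpen_slit h.contDiffOn_fibreDeriv hz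
  have h1 := ((hasDerivAt_along_line hd 0 u).clm_apply
    ((((hasDerivAt_id (0 : ℝ)).smul_const u).const_add z.2))).clm_apply
    (hasDerivAt_const (0 : ℝ) w)
  have h2 := (hasDerivAt_along_line hd1 0 u).clm_apply (hasDerivAt_const (0 : ℝ) w)
  have h3 := deriv_line_eq_of_eqOn (A := fun z => fiberHess ℓ z z.2 w)
    (B := fun z => fibreDeriv ℓ z w)
    h.isOpen_slit (fun z hz => h.fiberHess_apply_self hz w) hz h1 h2
  simp only [map_zero, zero_add, id_eq, zero_smul, add_zero, one_smul, ← fiberHess_eq,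
    add_apply] at h3
  rw [h.fibreDeriv_fiberHess_comm hz]
  simpa using h3

theorem baseDeriv_fibreDeriv_apply_self {z : E × E} (hz : z ∈ slit O) (a : E) :
    baseDeriv (fibreDeriv ℓ) z a z.2 = 2 * baseDeriv ℓ z a := by
  have hd := differentiableAt_of_contDiffOn h.isOpen_slit h.smooth hz
  have hd1 := differentiableAt_of_contDiffOn h.isOpen_slit h.contDiffOn_fibreDeriv hz
  have h1 := (hasDerivAt_along_line hd1 a 0).clm_apply
    ((((hasDerivAt_id (0 : ℝ)).smul_const (0 : E)).const_add z.2))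
  have h2 := (hasDerivAt_along_line hd a 0).const_mul 2
  have h3 := deriv_line_eq_of_eqOn (A := fun z => fibreDeriv ℓ z z.2) (B := fun z => 2 * ℓ z)
    h.isOpen_slit (fun z hz => h.fibreDeriv_apply_self hz) hz h1 h2
  simpa using h3

theorem baseDeriv_fiberHess_apply_self {z : E × E} (hz : z ∈ slit O) (a w : E) :
    baseDeriv (fiberHess ℓ) z a z.2 w = baseDeriv (fibreDeriv ℓ) z a w := by
  have hd := differentiableAt_of_contDiffOn h.isOpen_slit h.contDiffOn_fiberHess hz
  have hd1 := differentiableAt_of_contDiffOn h.isOpen_slit h.contDiffOn_fibreDeriv hz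
  have h1 := ((hasDerivAt_along_line hd a 0).clm_apply
    ((((hasDerivAt_id (0 : ℝ)).smul_const (0 : E)).const_add z.2))).clm_apply
    (hasDerivAt_const (0 : ℝ) w)
  have h2 := (hasDerivAt_along_line hd1 a 0).clm_apply (hasDerivAt_const (0 : ℝ) w)
  have h3 := deriv_line_eq_of_eqOn (A := fun z => fiberHess ℓ z z.2 w)
    (B := fun z => fibreDeriv ℓ z w)
    h.isOpen_slit (fun z hz => h.fiberHess_apply_self hz w) hz h1 h2
  simpa using h3

variable [FiniteDimensional ℝ E]

theorem contDiffOn_spray : ContDiffOn ℝ ∞ (spray ℓ) (slit O) := by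
  have h1 : ContDiffOn ℝ ∞ (fun z => (fiberHess ℓ z).inverse) (slit O) := by
    intro z hz
    have h2 := ((h.lorentzian z hz).isInvertible.contDiffAt_map_inverse (n := ∞))
    exact h2.comp_contDiffWithinAt z (h.contDiffOn_fiberHess z hz)
  exact (h1.clm_apply h.contDiffOn_sprayForm).const_smul (1 / 2 : ℝ)

theorem contDiffOn_nonlinConn : ContDiffOn ℝ ∞ (nonlinConn ℓ) (slit O) :=
  fibreDeriv_contDiffOn h.isOpen_slit h.contDiffOn_spray

theorem fiberHess_spray {z : E × E} (hz : z ∈ slit O) (w : E) :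
    2 * fiberHess ℓ z (spray ℓ z) w
      = baseDeriv (fibreDeriv ℓ) z z.2 w - baseDeriv ℓ z w := by
  rw [spray, map_smul, (h.lorentzian z hz).apply_inverse, sprayForm_eq]
  simp

/-- The derivative of the defining equation of the spray in a fibre direction. -/
theorem fiberHess_nonlinConn_aux {z : E × E} (hz : z ∈ slit O) (u w : E) :
    2 * fibreDeriv (fiberHess ℓ) z u (spray ℓ z) w + 2 * fiberHess ℓ z (nonlinConn ℓ z u) w
      = baseDeriv (fiberHess ℓ) z z.2 u w + baseDeriv (fibreDeriv ℓ) z u w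
        - baseDeriv (fibreDeriv ℓ) z w u := by
  have hg := differentiableAt_of_contDiffOn h.isOpen_slit h.contDiffOn_fiberHess hz
  have hG := differentiableAt_of_contDiffOn h.isOpen_slit h.contDiffOn_spray hz
  have hxv := differentiableAt_of_contDiffOn h.isOpen_slit h.contDiffOn_mixedDeriv hz
  have hx := differentiableAt_of_contDiffOn h.isOpen_slit h.contDiffOn_baseDeriv hz
  have hw := hasDerivAt_const (0 : ℝ) w
  have h1 := (((hasDerivAt_along_line hg 0 u).clm_apply
    (hasDerivAt_along_line hG 0 u)).clm_apply hw).const_mul 2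
  have h2 := (((hasDerivAt_along_line hxv 0 u).clm_apply
    ((((hasDerivAt_id (0 : ℝ)).smul_const u).const_add z.2))).clm_apply hw).sub
    ((hasDerivAt_along_line hx 0 u).clm_apply hw)
  have h3 := deriv_line_eq_of_eqOn (A := fun z => 2 * fiberHess ℓ z (spray ℓ z) w)
    (B := fun z => baseDeriv (fibreDeriv ℓ) z z.2 w - baseDeriv ℓ z w)
    h.isOpen_slit (fun z hz => h.fiberHess_spray hz w) hz h1 h2
  have h4 := congrArg (fun φ : E →L[ℝ] ℝ => φ w)
    (fibreDeriv_baseDeriv h.isOpen_slit h.contDiffOn_fibreDeriv hz u z.2)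
  simp only [map_zero, zero_add, id_eq, zero_smul, add_zero, one_smul, smul_zero, Prod.mk.eta,
    add_apply, zero_apply, ← nonlinConn_eq, fibreDeriv_baseDeriv h.isOpen_slit h.smooth hz] at h3 h4
  rw [h4] at h3
  rw [fiberHess_eq] at h3 ⊢
  linarith

/-- In the differentiated spray equation the Cartan term and the `x`-derivative of `g` along `v` are
symmetric in `u`, `w`; only the mixed derivatives survive antisymmetrization. -/
theorem fiberHess_nonlinConn_antisymm {z : E × E} (hz : z ∈ slit O) (u w : E) :
    fiberHess ℓ z (nonlinConn ℓ z u) w - fiberHess ℓ z (nonlinConn ℓ z w) u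
      = baseDeriv (fibreDeriv ℓ) z u w - baseDeriv (fibreDeriv ℓ) z w u := by
  have h1 := h.fiberHess_nonlinConn_aux hz u w
  have h2 := h.fiberHess_nonlinConn_aux hz w u
  have h3 := h.baseDeriv_fiberHess_comm hz z.2 u w
  have h4 : fibreDeriv (fiberHess ℓ) z u (spray ℓ z) w
      = fibreDeriv (fiberHess ℓ) z w (spray ℓ z) u := by
    rw [h.fibreDeriv_fiberHess_comm hz u, h.fibreDeriv_fiberHess_comm hz w]
    exact h.fibreDeriv_fiberHess_symm hz _ _ _
  linarith

/-- Compatibility of `g` with `N` along the spray. Here the mixed derivatives cancel instead, and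
total symmetry of the Cartan tensor moves `spray ℓ z` into its first slot. -/
theorem fiberHess_nonlinConn_symm {z : E × E} (hz : z ∈ slit O) (u w : E) :
    fiberHess ℓ z (nonlinConn ℓ z u) w + fiberHess ℓ z u (nonlinConn ℓ z w)
      = baseDeriv (fiberHess ℓ) z z.2 u w - 2 * fibreDeriv (fiberHess ℓ) z (spray ℓ z) u w := by
  have h1 := h.fiberHess_nonlinConn_aux hz u w
  have h2 := h.fiberHess_nonlinConn_aux hz w u
  have h3 := h.baseDeriv_fiberHess_comm hz z.2 u w
  have h4 := h.fibreDeriv_fiberHess_symm hz (spray ℓ z) u w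
  rw [h.fibreDeriv_fiberHess_comm hz] at h1 h2
  rw [h.fiberHess_symm hz u]
  linarith

/-- The horizontal derivative of the Lagrangian vanishes. -/
theorem fibreDeriv_nonlinConn {z : E × E} (hz : z ∈ slit O) (u : E) :
    fibreDeriv ℓ z (nonlinConn ℓ z u) = baseDeriv ℓ z u := by
  -- The spray equation contracted with `v`. Differentiating it along `u` and subtracting the spray
  -- equation contracted with `u` gives the claim.
  have hA : ∀ z ∈ slit O, 2 * fibreDeriv ℓ z (spray ℓ z) = baseDeriv ℓ z z.2 := by
    intro z hz
    have h1 := h.fiberHess_spray hz z.2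
    rw [h.fiberHess_symm hz, h.fiberHess_apply_self hz,
      h.baseDeriv_fibreDeriv_apply_self hz] at h1
    linarith
  have hv := differentiableAt_of_contDiffOn h.isOpen_slit h.contDiffOn_fibreDeriv hz
  have hG := differentiableAt_of_contDiffOn h.isOpen_slit h.contDiffOn_spray hz
  have hx := differentiableAt_of_contDiffOn h.isOpen_slit h.contDiffOn_baseDeriv hz
  have h1 := ((hasDerivAt_along_line hv 0 u).clm_apply (hasDerivAt_along_line hG 0 u)).const_mul 2
  have h2 := (hasDerivAt_along_line hx 0 u).clm_apply
    ((((hasDerivAt_id (0 : ℝ)).smul_const u).const_add z.2))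
  have h3 := deriv_line_eq_of_eqOn (A := fun z => 2 * fibreDeriv ℓ z (spray ℓ z))
    (B := fun z => baseDeriv ℓ z z.2) h.isOpen_slit hA hz h1 h2
  simp only [map_zero, zero_add, id_eq, zero_smul, add_zero, one_smul, Prod.mk.eta,
    ← nonlinConn_eq, ← fiberHess_eq, fibreDeriv_baseDeriv h.isOpen_slit h.smooth hz] at h3
  have h4 := h.fiberHess_spray hz u
  rw [h.fiberHess_symm hz] at h4
  linarith

/-- Take `u = v` in the differentiated spray equation: the Cartan term drops and the right side
becomes twice that of the spray equation. -/
theorem nonlinConn_apply_self {z : E × E} (hz : z ∈ slit O) :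
    nonlinConn ℓ z z.2 = (2 : ℝ) • spray ℓ z := by
  refine (h.lorentzian z hz).eq_of_forall fun w => ?_
  have h1 := h.fiberHess_nonlinConn_aux hz z.2 w
  have h2 := h.fiberHess_spray hz w
  rw [h.fibreDeriv_fiberHess_self hz, h.baseDeriv_fiberHess_apply_self hz,
    h.baseDeriv_fibreDeriv_apply_self hz] at h1
  simp only [zero_apply, map_smul, smul_apply, smul_eq_mul] at h1 ⊢
  linarith

/-- Differentiate `N v = 2 G` along `u`; since `N = ∂G/∂v`, its fibre derivative is symmetric and
`v` may be exchanged with `u`. -/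
theorem fibreDeriv_nonlinConn_self {z : E × E} (hz : z ∈ slit O) :
    fibreDeriv (nonlinConn ℓ) z z.2 = nonlinConn ℓ z := by
  ext u
  have hN := differentiableAt_of_contDiffOn h.isOpen_slit h.contDiffOn_nonlinConn hz
  have hG := differentiableAt_of_contDiffOn h.isOpen_slit h.contDiffOn_spray hz
  have h1 := (hasDerivAt_along_line hN 0 u).clm_apply
    ((((hasDerivAt_id (0 : ℝ)).smul_const u).const_add z.2))
  have h2 := (hasDerivAt_along_line hG 0 u).const_smul (2 : ℝ)
  have h3 := deriv_line_eq_of_eqOn (A := fun z => nonlinConn ℓ z z.2)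
    (B := fun z => (2 : ℝ) • spray ℓ z) h.isOpen_slit (fun z hz => h.nonlinConn_apply_self hz) hz
    h1 h2
  simp only [map_zero, zero_add, id_eq, zero_smul, add_zero, one_smul, Prod.mk.eta] at h3
  rw [nonlinConn_eq, fibreDeriv_fibreDeriv_symm h.isOpen_slit h.contDiffOn_spray hz,
    ← nonlinConn_eq]
  rw [← nonlinConn_eq, two_smul] at h3
  exact add_right_cancel h3

/-- The curvature of the non-linear connection is tangent to the level sets of the Lagrangian. -/
theorem fibreDeriv_nonlinCurv {z : E × E} (hz : z ∈ slit O) (X Y : E) :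
    fibreDeriv ℓ z (nonlinCurv ℓ z X Y) = 0 := by
  have hv := differentiableAt_of_contDiffOn h.isOpen_slit h.contDiffOn_fibreDeriv hz
  have hN := differentiableAt_of_contDiffOn h.isOpen_slit h.contDiffOn_nonlinConn hz
  have hx := differentiableAt_of_contDiffOn h.isOpen_slit h.contDiffOn_baseDeriv hz
  -- The identity `∂ℓ/∂v (N Y) = ∂ℓ/∂x (Y)` differentiated in the horizontal direction `(X, -N X)`.
  -- The resulting expression is symmetric in `X` and `Y`, so it cancels in the curvature.
  have key : ∀ X Y : E, fibreDeriv ℓ z (horDerivConn ℓ z X Y)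
      = baseDeriv (baseDeriv ℓ) z X Y - baseDeriv (fibreDeriv ℓ) z Y (nonlinConn ℓ z X)
        - baseDeriv (fibreDeriv ℓ) z X (nonlinConn ℓ z Y)
        + fiberHess ℓ z (nonlinConn ℓ z X) (nonlinConn ℓ z Y) := by
    intro X Y
    have hY := hasDerivAt_const (0 : ℝ) Y
    have h1 := (hasDerivAt_along_line hv X (-nonlinConn ℓ z X)).clm_apply
      ((hasDerivAt_along_line hN X (-nonlinConn ℓ z X)).clm_apply hY)
    have h2 := (hasDerivAt_along_line hx X (-nonlinConn ℓ z X)).clm_apply hY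
    have h3 := deriv_line_eq_of_eqOn (A := fun z => fibreDeriv ℓ z (nonlinConn ℓ z Y))
      (B := fun z => baseDeriv ℓ z Y) h.isOpen_slit (fun z hz => h.fibreDeriv_nonlinConn hz Y) hz
      h1 h2
    simp only [map_zero, zero_smul, add_zero, Prod.mk.eta, map_neg, add_apply, neg_apply, map_add,
      ← fiberHess_eq, fibreDeriv_baseDeriv h.isOpen_slit h.smooth hz] at h3
    rw [horDerivConn_apply, map_sub]
    linarith
  rw [nonlinCurv_apply, map_sub, key X Y, key Y X,
    baseDeriv_baseDeriv_symm h.isOpen_slit h.smooth hz X Y, h.fiberHess_symm hz]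
  ring

end IsLocalLagrangian

end LocalLagrangian

/-! ### Level sets in a vector space -/

section LevelSet

variable {E : Type*} [NormedAddCommGroup E] [NormedSpace ℝ E]
  {W : Type*} [NormedAddCommGroup W] [NormedSpace ℝ W]

/-- Near `x₀ ∈ H`, the set `H` is the zero set of the `C^2` function `f`, whose differential at `x₀`
does not vanish. -/
structure IsLevelSetAt (f : E → ℝ) (H : Set E) (x₀ : E) : Prop where
  mem : x₀ ∈ H
  contDiffAt : ContDiffAt ℝ 2 f x₀
  fderiv_ne : fderiv ℝ f x₀ ≠ 0
  mem_iff : ∀ᶠ x in 𝓝 x₀, x ∈ H ↔ f x = 0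

namespace IsLevelSetAt

variable {f : E → ℝ} {H : Set E} {x₀ : E} (h : IsLevelSetAt f H x₀)
include h

theorem apply_eq_zero : f x₀ = 0 := h.mem_iff.self_of_nhds.1 h.mem

theorem contDiffAt_fderiv : ContDiffAt ℝ 1 (fderiv ℝ f) x₀ :=
  h.contDiffAt.fderiv_right (by norm_num)

theorem eventually_isLevelSetAt : ∀ᶠ x in 𝓝 x₀, x ∈ H → IsLevelSetAt f H x := by
  have h1 : ∀ᶠ x in 𝓝 x₀, fderiv ℝ f x ≠ 0 :=
    h.contDiffAt_fderiv.continuousAt.eventually_ne h.fderiv_ne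
  filter_upwards [h1, h.mem_iff.eventually_nhds, h.contDiffAt.eventually (by simp)]
    with x hx1 hx2 hx3 hx
  exact ⟨hx, hx3, hx1, hx2⟩

variable [CompleteSpace E]

/-- A level set is, near each of its points, the image of a `C^2` retraction. -/
theorem exists_retraction : ∃ r : E → E, ContDiffAt ℝ 2 r x₀ ∧ r x₀ = x₀ ∧
    (∀ᶠ x in 𝓝 x₀, r x ∈ H) ∧ (∀ᶠ x in 𝓝 x₀, x ∈ H → r x = x) ∧
    ∀ X, fderiv ℝ f x₀ X = 0 → fderiv ℝ r x₀ X = X := by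
  set φ := fderiv ℝ f x₀ with hφ
  obtain ⟨e, he⟩ : ∃ e, φ e = 1 := by
    obtain ⟨w, hw⟩ : ∃ w, φ w ≠ 0 := by
      by_contra! hc
      exact h.fderiv_ne (by ext w; exact hc w)
    exact ⟨(φ w)⁻¹ • w, by simp [hw]⟩
  have hf0 := h.apply_eq_zero
  have hfd : HasFDerivAt f φ x₀ := (h.contDiffAt.differentiableAt (by simp)).hasFDerivAt
  -- `Φ` straightens the level set: it is tangent to the identity at `x₀` and turns `f` into the
  -- affine function `φ (· - x₀)`, as checked in `hφΦ`.
  set Φ : E → E := fun x => x + (f x - φ (x - x₀)) • e with hΦ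
  have hΦc : ContDiffAt ℝ 2 Φ x₀ :=
    contDiffAt_id.add ((h.contDiffAt.sub
      (φ.contDiff.contDiffAt.comp x₀ (contDiffAt_id.sub contDiffAt_const))).smul contDiffAt_const)
  have hΦ0 : Φ x₀ = x₀ := by simp [hΦ, hf0]
  have hφd : HasFDerivAt (fun x => φ (x - x₀)) φ x₀ := by
    have h1 := φ.hasFDerivAt.comp x₀ ((hasFDerivAt_id x₀).sub_const x₀)
    rwa [ContinuousLinearMap.comp_id] at h1
  have hΦd : HasFDerivAt Φ ((ContinuousLinearEquiv.refl ℝ E : E ≃L[ℝ] E) : E →L[ℝ] E) x₀ := by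
    refine ((hasFDerivAt_id x₀).add ((hfd.sub hφd).smul_const e)).congr_fderiv ?_
    ext w
    simp
  have hφΦ : ∀ x, φ (Φ x - x₀) = f x := by
    intro x
    have : Φ x - x₀ = (x - x₀) + (f x - φ (x - x₀)) • e := by simp only [hΦ]; abel
    rw [this, map_add, map_smul, he]
    simp
  have hs := hΦc.hasStrictFDerivAt' hΦd (by simp)
  set Ψ : E → E := hs.localInverse Φ _ x₀ with hΨ
  have hΨc : ContDiffAt ℝ 2 Ψ x₀ := by
    have := hΦc.to_localInverse hΦd (by simp)
    rw [hΦ0] at this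
    exact this
  have hl : ∀ᶠ x in 𝓝 x₀, Ψ (Φ x) = x := hs.eventually_left_inverse
  have hr : ∀ᶠ y in 𝓝 x₀, Φ (Ψ y) = y := by
    have := hs.eventually_right_inverse
    rwa [hΦ0] at this
  have hΨ0 : Ψ x₀ = x₀ := by simpa [hΦ0] using hl.self_of_nhds
  have hΨd : HasFDerivAt Ψ (ContinuousLinearMap.id ℝ E) x₀ := by
    have := hs.to_localInverse.hasFDerivAt
    rw [hΦ0] at this
    exact this
  -- `p` is `Φ` followed by the projection along `e` onto the hyperplane `φ (· - x₀) = 0`; composing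
  -- with the local inverse `Ψ` of `Φ` lands in the level set.
  set p : E → E := fun x => Φ x - f x • e with hp
  have hp0 : p x₀ = x₀ := by simp [hp, hf0, hΦ0]
  have hpc : ContDiffAt ℝ 2 p x₀ := hΦc.sub (h.contDiffAt.smul contDiffAt_const)
  have hpd : HasFDerivAt p (ContinuousLinearMap.id ℝ E - φ.smulRight e) x₀ :=
    (hΦd.sub (hfd.smul_const e))
  have hrc : ContDiffAt ℝ 2 (Ψ ∘ p) x₀ := ContDiffAt.comp x₀ (by rwa [hp0]) hpc
  have hrd : HasFDerivAt (Ψ ∘ p) (ContinuousLinearMap.id ℝ E - φ.smulRight e) x₀ :=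
    HasFDerivAt.comp (g' := ContinuousLinearMap.id ℝ E) x₀ (by rwa [hp0]) hpd
  have hr0 : (Ψ ∘ p) x₀ = x₀ := by simp [hp0, hΨ0]
  have hpt : Tendsto p (𝓝 x₀) (𝓝 x₀) := by simpa [hp0] using hpc.continuousAt.tendsto
  have hrt : Tendsto (Ψ ∘ p) (𝓝 x₀) (𝓝 x₀) := by simpa [hp0, hΨ0] using hrc.continuousAt.tendsto
  refine ⟨Ψ ∘ p, hrc, hr0, ?_, ?_, ?_⟩
  · filter_upwards [hrt.eventually h.mem_iff, hpt.eventually hr] with x hx1 hx2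
    rw [hx1, ← hφΦ, Function.comp_apply, hx2]
    have : p x - x₀ = (Φ x - x₀) - f x • e := by simp only [hp]; abel
    rw [this, map_sub, hφΦ, map_smul, he]
    simp
  · filter_upwards [h.mem_iff, hl] with x hx1 hx2 hx
    simp [hp, hx1.1 hx, hx2]
  · intro X hX
    rw [hrd.fderiv]
    simp [hX]

theorem exists_curve {X : E} (hX : fderiv ℝ f x₀ X = 0) :
    ∃ c : ℝ → E, HasDerivAt c X 0 ∧ c 0 = x₀ ∧ ∀ᶠ t in 𝓝 0, c t ∈ H := by
  obtain ⟨r, hr, hr0, hrH, -, hrX⟩ := h.exists_retraction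
  have h1 : HasDerivAt (fun t : ℝ => x₀ + t • X) X 0 := by
    simpa using ((hasDerivAt_id (0 : ℝ)).smul_const X).const_add x₀
  have h2 : HasFDerivAt r (fderiv ℝ r x₀) (x₀ + (0 : ℝ) • X) := by
    simpa using (hr.differentiableAt (by simp)).hasFDerivAt
  have h3 := h2.comp_hasDerivAt (0 : ℝ) h1
  rw [hrX X hX] at h3
  refine ⟨_, h3, by simp [hr0], ?_⟩
  have h4 : Tendsto (fun t : ℝ => x₀ + t • X) (𝓝 0) (𝓝 x₀) := by
    simpa using h1.continuousAt.tendsto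
  exact h4.eventually hrH

/-- Derivatives along a level set are determined on its tangent space. -/
theorem hasFDerivWithinAt_unique {φ ψ : E → W} {φ' ψ' : E →L[ℝ] W}
    (hφ : HasFDerivWithinAt φ φ' H x₀) (hψ : HasFDerivWithinAt ψ ψ' H x₀)
    (he : φ =ᶠ[𝓝[H] x₀] ψ) {X : E} (hX : fderiv ℝ f x₀ X = 0) : φ' X = ψ' X := by
  obtain ⟨c, hc, hc0, hcH⟩ := h.exists_curve hX
  have hψ' : HasFDerivWithinAt φ ψ' H x₀ :=
    hψ.congr_of_eventuallyEq he (he.self_of_nhdsWithin h.mem)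
  have key : ∀ {χ' : E →L[ℝ] W}, HasFDerivWithinAt φ χ' H x₀ → HasDerivAt (φ ∘ c) (χ' X) 0 := by
    intro χ' hχ
    have hc' : HasDerivWithinAt c X (c ⁻¹' H) 0 := hc.hasDerivWithinAt
    have h1 := HasFDerivWithinAt.comp_hasDerivWithinAt (t := H) (0 : ℝ) (by rwa [hc0]) hc'
      (mapsTo_preimage c H)
    exact h1.hasDerivAt hcH
  exact (key hφ).unique (key hψ')

/-- Derivatives within a hypersurface are not unique, and `fderivWithin` selects one of them; on
tangent vectors they all agree, so any differentiable extension computes it. -/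
theorem fderivWithin_apply_eq {φ ψ : E → W} {ψ' : E →L[ℝ] W} (hψ : HasFDerivAt ψ ψ' x₀)
    (he : φ =ᶠ[𝓝[H] x₀] ψ) {X : E} (hX : fderiv ℝ f x₀ X = 0) :
    fderivWithin ℝ φ H x₀ X = ψ' X := by
  have h1 : HasFDerivWithinAt φ ψ' H x₀ :=
    hψ.hasFDerivWithinAt.congr_of_eventuallyEq he (he.self_of_nhdsWithin h.mem)
  exact h.hasFDerivWithinAt_unique h1.differentiableWithinAt.hasFDerivWithinAt h1
    (EventuallyEq.refl _ _) hX

theorem eq_zero_of_eventually_zero {ψ : E → W} {ψ' : E →L[ℝ] W} (hψ : HasFDerivAt ψ ψ' x₀)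
    (he : ∀ᶠ x in 𝓝[H] x₀, ψ x = 0) {X : E} (hX : fderiv ℝ f x₀ X = 0) : ψ' X = 0 := by
  have h1 : HasFDerivWithinAt (fun _ : E => (0 : W)) (0 : E →L[ℝ] W) H x₀ :=
    hasFDerivWithinAt_const _ _ _
  simpa using h.hasFDerivWithinAt_unique hψ.hasFDerivWithinAt h1 he hX

/-- A `C^1` map on a level set extends to a `C^1` map on a neighborhood. -/
theorem exists_extension {φ : E → W} (hφ : ContDiffWithinAt ℝ 1 φ H x₀) :
    ∃ ψ : E → W, ContDiffAt ℝ 1 ψ x₀ ∧ φ =ᶠ[𝓝[H] x₀] ψ := by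
  obtain ⟨r, hr, hr0, hrH, hrid, -⟩ := h.exists_retraction
  refine ⟨φ ∘ r, ?_, ?_⟩
  · have hr1 : ContDiffWithinAt ℝ 1 r (r ⁻¹' H) x₀ :=
      (hr.of_le (by norm_num)).contDiffWithinAt
    have h1 := ContDiffWithinAt.comp x₀ (by rwa [hr0]) hr1 (mapsTo_preimage r H)
    exact h1.contDiffAt hrH
  · filter_upwards [nhdsWithin_le_nhds hrid, self_mem_nhdsWithin] with x hx hxH
    simp [hx hxH]

end IsLevelSetAt

end LevelSet

/-! ### Null hypersurfaces in coordinates -/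

section LocalNull

variable {E : Type*} [NormedAddCommGroup E] [NormedSpace ℝ E]

/-- Near `x₀`, the level set `H` of `f` is a null hypersurface for the Lagrangian `ℓ`, with null
tangent field the restriction to `H` of the `C^1` field `m`. -/
structure IsLocalNull (ℓ : E × E → ℝ) (O : Set E) (f : E → ℝ) (H : Set E) (m : E → E) (x₀ : E) :
    Prop where
  lag : IsLocalLagrangian ℓ O
  mem : x₀ ∈ O
  level : IsLevelSetAt f H x₀
  smooth : ContDiffAt ℝ 1 m x₀
  ne_zero : m x₀ ≠ 0
  tangent : ∀ᶠ x in 𝓝[H] x₀, fderiv ℝ f x (m x) = 0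
  null : ∀ᶠ x in 𝓝[H] x₀, ∀ X, fderiv ℝ f x X = 0 ↔ fiberHess ℓ (x, m x) (m x) X = 0

/-- The derivative `X ↦ D_X m` in coordinates. -/
noncomputable def covDerivLocal (ℓ : E × E → ℝ) (m : E → E) (x : E) : E →L[ℝ] E :=
  fderiv ℝ m x + nonlinConn ℓ (x, m x)

/-- The Lie derivative of `g_m` along `m` in coordinates. -/
noncomputable def lieForm (ℓ : E × E → ℝ) (m : E → E) (x X Y : E) : ℝ :=
  fderiv ℝ (fun y => fiberHess ℓ (y, m y)) x (m x) X Y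
    + fiberHess ℓ (x, m x) (fderiv ℝ m x X) Y + fiberHess ℓ (x, m x) X (fderiv ℝ m x Y)

namespace IsLocalNull

variable {ℓ : E × E → ℝ} {O : Set E} {f : E → ℝ} {H : Set E} {m : E → E} {x₀ : E}
  (h : IsLocalNull ℓ O f H m x₀)
include h

theorem mem_slit : (x₀, m x₀) ∈ slit O := ⟨h.mem, h.ne_zero⟩

theorem eventually_mem_slit : ∀ᶠ x in 𝓝 x₀, (x, m x) ∈ slit O := by
  filter_upwards [h.lag.isOpen.mem_nhds h.mem, h.smooth.continuousAt.eventually_ne h.ne_zero]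
    with x h1 h2
  exact ⟨h1, h2⟩

theorem hasFDerivAt : HasFDerivAt m (fderiv ℝ m x₀) x₀ :=
  (h.smooth.differentiableAt (by simp)).hasFDerivAt

theorem eventually_isLocalNull : ∀ᶠ x in 𝓝[H] x₀, IsLocalNull ℓ O f H m x := by
  filter_upwards [nhdsWithin_le_nhds h.eventually_mem_slit,
    nhdsWithin_le_nhds h.level.eventually_isLevelSetAt,
    nhdsWithin_le_nhds (h.smooth.eventually (by simp)),
    eventually_eventually_nhdsWithin.2 h.tangent, eventually_eventually_nhdsWithin.2 h.null,
    self_mem_nhdsWithin] with x h1 h2 h3 h4 h5 h6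
  exact ⟨h.lag, h1.1, h2 h6, h3, h1.2, h4, h5⟩

theorem fderiv_self : fderiv ℝ f x₀ (m x₀) = 0 := h.tangent.self_of_nhdsWithin h.level.mem

theorem fderiv_eq_zero_iff (X : E) :
    fderiv ℝ f x₀ X = 0 ↔ fiberHess ℓ (x₀, m x₀) (m x₀) X = 0 :=
  h.null.self_of_nhdsWithin h.level.mem X

theorem fderiv_eq_zero_iff_fibreDeriv (X : E) :
    fderiv ℝ f x₀ X = 0 ↔ fibreDeriv ℓ (x₀, m x₀) X = 0 := by
  rw [h.fderiv_eq_zero_iff, ← h.lag.fiberHess_apply_self h.mem_slit]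

theorem hasFDerivAt_fiberHess : HasFDerivAt (fun y => fiberHess ℓ (y, m y))
    (baseDeriv (fiberHess ℓ) (x₀, m x₀)
      + (fibreDeriv (fiberHess ℓ) (x₀, m x₀)).comp (fderiv ℝ m x₀)) x₀ :=
  hasFDerivAt_comp_section
    (differentiableAt_of_contDiffOn h.lag.isOpen_slit h.lag.contDiffOn_fiberHess h.mem_slit)
    h.hasFDerivAt

theorem hasFDerivAt_fibreDeriv : HasFDerivAt (fun y => fibreDeriv ℓ (y, m y))
    (baseDeriv (fibreDeriv ℓ) (x₀, m x₀)
      + (fiberHess ℓ (x₀, m x₀)).comp (fderiv ℝ m x₀)) x₀ :=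
  hasFDerivAt_comp_section
    (differentiableAt_of_contDiffOn h.lag.isOpen_slit h.lag.contDiffOn_fibreDeriv h.mem_slit)
    h.hasFDerivAt

theorem fderiv_fiberHess_symm (X Y Z : E) :
    fderiv ℝ (fun y => fiberHess ℓ (y, m y)) x₀ X Y Z
      = fderiv ℝ (fun y => fiberHess ℓ (y, m y)) x₀ X Z Y := by
  rw [h.hasFDerivAt_fiberHess.fderiv]
  simp [h.lag.baseDeriv_fiberHess_comm h.mem_slit X Y Z,
    h.lag.fibreDeriv_fiberHess_symm h.mem_slit _ Y Z]

variable [FiniteDimensional ℝ E]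

/-- Since `m` lies in the kernel of `θ = ∂ℓ/∂v`, Euler's relation gives `ℓ (x, m x) = 0` on the
hypersurface. Its derivative along `X` is `∂ℓ/∂x (X) + θ (dm X)`, which equals `θ (D_X m)` because
`ℓ` is horizontally constant. -/
theorem fderiv_covDerivLocal {X : E} (hX : fderiv ℝ f x₀ X = 0) :
    fderiv ℝ f x₀ (covDerivLocal ℓ m x₀ X) = 0 := by
  have h1 := hasFDerivAt_comp_section
    (differentiableAt_of_contDiffOn h.lag.isOpen_slit h.lag.smooth h.mem_slit) h.hasFDerivAt
  have h2 : ∀ᶠ x in 𝓝[H] x₀, ℓ (x, m x) = 0 := by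
    filter_upwards [h.eventually_isLocalNull] with x hx
    have h3 := hx.lag.fibreDeriv_apply_self hx.mem_slit
    rw [(hx.fderiv_eq_zero_iff_fibreDeriv _).1 hx.fderiv_self] at h3
    linarith
  have h3 := h.level.eq_zero_of_eventually_zero h1 h2 hX
  rw [h.fderiv_eq_zero_iff_fibreDeriv, covDerivLocal, add_apply, map_add,
    h.lag.fibreDeriv_nonlinConn h.mem_slit]
  rw [add_comm]
  exact h3

/-- The derivative of the 1-form `g_m(m, ·)` is symmetric on the hypersurface. -/
theorem fderiv_fibreDeriv_symm {X Y : E} (hX : fderiv ℝ f x₀ X = 0) (hY : fderiv ℝ f x₀ Y = 0) :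
    baseDeriv (fibreDeriv ℓ) (x₀, m x₀) X Y + fiberHess ℓ (x₀, m x₀) (fderiv ℝ m x₀ X) Y
      = baseDeriv (fibreDeriv ℓ) (x₀, m x₀) Y X
        + fiberHess ℓ (x₀, m x₀) (fderiv ℝ m x₀ Y) X := by
  obtain ⟨e, he⟩ : ∃ w, fderiv ℝ f x₀ w ≠ 0 := by
    by_contra! hc
    exact h.level.fderiv_ne (by ext w; exact hc w)
  have hθ := h.hasFDerivAt_fibreDeriv
  have hf2 : HasFDerivAt (fderiv ℝ f) (fderiv ℝ (fderiv ℝ f) x₀) x₀ :=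
    (h.level.contDiffAt_fderiv.differentiableAt (by simp)).hasFDerivAt
  have hsymm := (h.level.contDiffAt.isSymmSndFDerivAt
    (by rw [minSmoothness_of_isRCLikeNormedField])) X Y
  -- With `θ` for `∂ℓ/∂v` along `m`, equality of kernels gives `df(e) θ(Y) = df(Y) θ(e)` on the
  -- hypersurface. Differentiating along `X` leaves `df(e) (∂_X θ)(Y) = θ(e) d²f(X, Y)`, as `df(Y)`
  -- and `θ(Y)` vanish at `x₀`; the factor between `θ` and `df` is never differentiated.
  have key : ∀ {X Y : E}, fderiv ℝ f x₀ X = 0 → fderiv ℝ f x₀ Y = 0 →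
      fderiv ℝ f x₀ e * (baseDeriv (fibreDeriv ℓ) (x₀, m x₀) X Y
        + fiberHess ℓ (x₀, m x₀) (fderiv ℝ m x₀ X) Y)
      = fibreDeriv ℓ (x₀, m x₀) e * fderiv ℝ (fderiv ℝ f) x₀ X Y := by
    intro X Y hX hY
    have hec := hasFDerivAt_const (𝕜 := ℝ) e x₀
    have hYc := hasFDerivAt_const (𝕜 := ℝ) Y x₀
    have h1 := ((hf2.clm_apply hec).mul (hθ.clm_apply hYc)).sub
      ((hθ.clm_apply hec).mul (hf2.clm_apply hYc))
    have h2 := h.level.eq_zero_of_eventually_zero h1 ?_ hX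
    · have hθY := (h.fderiv_eq_zero_iff_fibreDeriv Y).1 hY
      simp [hY, hθY] at h2
      linarith
    · filter_upwards [h.eventually_isLocalNull] with x hx
      have h3 := (hx.fderiv_eq_zero_iff_fibreDeriv
        (fderiv ℝ f x e • Y - fderiv ℝ f x Y • e)).1 (by simp; ring)
      simp only [map_sub, map_smul, smul_eq_mul] at h3
      simp only [Pi.sub_apply, Pi.mul_apply]
      linarith
  have h1 := key hX hY
  have h2 := key hY hX
  rw [← hsymm, ← h1] at h2
  exact (mul_left_cancel₀ he h2).symm

/-- The asymmetry contributed by `N` is exactly that of `∂²ℓ/∂x∂v`, and it is compensated by the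
symmetry of the derivative of `g_m(m, ·)` on the hypersurface. -/
theorem fiberHess_covDerivLocal_symm {X Y : E} (hX : fderiv ℝ f x₀ X = 0)
    (hY : fderiv ℝ f x₀ Y = 0) :
    fiberHess ℓ (x₀, m x₀) (covDerivLocal ℓ m x₀ X) Y
      = fiberHess ℓ (x₀, m x₀) X (covDerivLocal ℓ m x₀ Y) := by
  have h1 := h.fderiv_fibreDeriv_symm hX hY
  have h2 := h.lag.fiberHess_nonlinConn_antisymm h.mem_slit X Y
  rw [h.lag.fiberHess_symm h.mem_slit X]
  simp only [covDerivLocal, add_apply, map_add]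
  linarith

/-- For tangent `w`, self-adjointness gives `g(D_m m, w) = g(m, D_w m)`, which is zero because `D_w
m` is tangent: the integral curves of `m` are pregeodesics. -/
theorem covDerivLocal_self_mem : covDerivLocal ℓ m x₀ (m x₀) ∈ Submodule.span ℝ {m x₀} := by
  refine (h.lag.lorentzian _ h.mem_slit).mem_span_of_orthogonal fun w hw => ?_
  have hw' := (h.fderiv_eq_zero_iff w).2 hw
  rw [h.fiberHess_covDerivLocal_symm h.fderiv_self hw', ← h.fderiv_eq_zero_iff]
  exact h.fderiv_covDerivLocal hw'

/-- As `D_m m` is proportional to `m`, the derivative of `m` along itself is `c m - 2 G`. The Cartan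
tensor kills `m`, so the derivative of `g_m` along `m` is the one appearing in
`fiberHess_nonlinConn_symm`; self-adjointness then merges the two terms. -/
theorem lieForm_eq {X Y : E} (hX : fderiv ℝ f x₀ X = 0) (hY : fderiv ℝ f x₀ Y = 0) :
    lieForm ℓ m x₀ X Y = 2 * fiberHess ℓ (x₀, m x₀) (covDerivLocal ℓ m x₀ X) Y := by
  have h1 := h.fiberHess_covDerivLocal_symm hX hY
  have h2 := h.lag.fiberHess_nonlinConn_symm h.mem_slit X Y
  obtain ⟨c, hc⟩ := Submodule.mem_span_singleton.1 h.covDerivLocal_self_mem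
  have h3 : fderiv ℝ m x₀ (m x₀) = c • m x₀ - (2 : ℝ) • spray ℓ (x₀, m x₀) := by
    rw [hc, ← h.lag.nonlinConn_apply_self h.mem_slit]
    simp [covDerivLocal]
  rw [lieForm, h.hasFDerivAt_fiberHess.fderiv]
  have h4 : fibreDeriv (fiberHess ℓ) (x₀, m x₀) (m x₀) = 0 :=
    h.lag.fibreDeriv_fiberHess_self h.mem_slit
  simp only [add_apply, ContinuousLinearMap.comp_apply, h3, map_sub, map_smul, h4, sub_apply,
    smul_apply, zero_apply, smul_zero, smul_eq_mul]
  simp only [covDerivLocal, add_apply, map_add] at h1 ⊢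
  simp only at h2
  linarith

theorem covDerivLocal_mem_span_iff {X : E} (hX : fderiv ℝ f x₀ X = 0) :
    covDerivLocal ℓ m x₀ X ∈ Submodule.span ℝ {m x₀}
      ↔ ∀ Y, fderiv ℝ f x₀ Y = 0 → lieForm ℓ m x₀ X Y = 0 := by
  constructor
  · intro hs Y hY
    obtain ⟨c, hc⟩ := Submodule.mem_span_singleton.1 hs
    rw [h.lieForm_eq hX hY, ← hc]
    simp [(h.fderiv_eq_zero_iff Y).1 hY]
  · intro hs
    refine (h.lag.lorentzian _ h.mem_slit).mem_span_of_orthogonal fun w hw => ?_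
    have hw' := (h.fderiv_eq_zero_iff w).2 hw
    have := hs w hw'
    rw [h.lieForm_eq hX hw'] at this
    linarith

/-- The Levi-Civita connection of `g_m` along the hypersurface: its part transverse to the
hypersurface is the second fundamental form. -/
theorem fderiv_leviCivita_eq_zero_iff {Y : E → E} {Y' : E →L[ℝ] E} (hY : HasFDerivAt Y Y' x₀)
    (hYt : ∀ᶠ x in 𝓝[H] x₀, fderiv ℝ f x (Y x) = 0) {X : E} (hX : fderiv ℝ f x₀ X = 0) :
    fderiv ℝ f x₀ (Y' X + christoffel (fun y => fiberHess ℓ (y, m y)) x₀ X (Y x₀)) = 0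
      ↔ lieForm ℓ m x₀ X (Y x₀) = 0 := by
  have hY0 : fderiv ℝ f x₀ (Y x₀) = 0 := hYt.self_of_nhdsWithin h.level.mem
  set Γ := christoffel (fun y => fiberHess ℓ (y, m y)) x₀ X (Y x₀) with hΓ
  set γ' := fderiv ℝ (fun y => fiberHess ℓ (y, m y)) x₀ with hγ'
  have hθ := h.hasFDerivAt_fibreDeriv
  have h1 := h.level.eq_zero_of_eventually_zero (hθ.clm_apply hY) (by
    filter_upwards [hYt, h.eventually_isLocalNull] with x hx hx'
    exact (hx'.fderiv_eq_zero_iff_fibreDeriv _).1 hx) hX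
  have h2 := h.fderiv_fibreDeriv_symm hX hY0
  have hg := h.hasFDerivAt_fiberHess.clm_apply h.hasFDerivAt
  rw [← h.hasFDerivAt_fiberHess.fderiv, ← hγ'] at hg
  have heq : (fun y => fiberHess ℓ (y, m y) (m y)) =ᶠ[𝓝 x₀] fun y => fibreDeriv ℓ (y, m y) := by
    filter_upwards [h.eventually_mem_slit] with x hx
    ext w
    exact h.lag.fiberHess_apply_self hx w
  have hu := hg.unique (hθ.congr_of_eventuallyEq heq)
  -- Differentiate `g_m(m, ·) = ∂ℓ/∂v`; the terms containing the derivative of `m` are the same on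
  -- both sides.
  have hu' : ∀ a b, γ' a (m x₀) b = baseDeriv (fibreDeriv ℓ) (x₀, m x₀) a b := by
    intro a b
    have := congrArg (fun T : E →L[ℝ] E →L[ℝ] ℝ => T a b) hu
    simp at this
    linarith
  have h3 : fiberHess ℓ (x₀, m x₀) Γ (m x₀)
      = (γ' X (Y x₀) (m x₀) + γ' (Y x₀) X (m x₀) - γ' (m x₀) X (Y x₀)) / 2 := by
    rw [hΓ, christoffel, (h.lag.lorentzian _ h.mem_slit).apply_inverse]
    simp [← hγ']
    ring
  have hs := h.fderiv_fiberHess_symm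
  rw [← hγ'] at hs
  rw [hs X, hs (Y x₀), hu', hu',
    h.lag.fiberHess_symm h.mem_slit, h.lag.fiberHess_apply_self h.mem_slit] at h3
  simp only [add_apply, ContinuousLinearMap.comp_apply, ContinuousLinearMap.flip_apply] at h1
  -- The value of `∂ℓ/∂v` on the covariant derivative is minus one half of `lieForm`.
  rw [h.fderiv_eq_zero_iff_fibreDeriv, map_add, lieForm, h.lag.fiberHess_symm h.mem_slit X, h3,
    ← hγ']
  constructor <;> intro h4 <;> linarith

end IsLocalNull

end LocalNull

/-! ### Curvature along a null hypersurface with vanishing null Weingarten map, in coordinates -/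

section LocalCurvature

variable {E : Type*} [NormedAddCommGroup E] [NormedSpace ℝ E] [FiniteDimensional ℝ E]

/-- By the infinitesimal relation `∂N/∂v (v) = N`, the function `t ↦ t⁻¹ N(x, t v)` has zero
derivative on `t > 0`. It is needed to rescale the null field. -/
theorem IsLocalLagrangian.nonlinConn_smul {ℓ : E × E → ℝ} {O : Set E}
    (h : IsLocalLagrangian ℓ O) {x v : E} (hz : (x, v) ∈ slit O) {s : ℝ} (hs : 0 < s) :
    nonlinConn ℓ (x, s • v) = s • nonlinConn ℓ (x, v) := by
  have hd : ∀ t ∈ Ioi (0 : ℝ),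
      HasDerivAt (fun t : ℝ => t⁻¹ • nonlinConn ℓ (x, t • v)) 0 t := by
    intro t ht
    have ht0 : t ≠ 0 := ne_of_gt ht
    have hz' : (x, t • v) ∈ slit O := ⟨hz.1, smul_ne_zero ht0 hz.2⟩
    have hN := differentiableAt_of_contDiffOn h.isOpen_slit h.contDiffOn_nonlinConn hz'
    have h1 : HasDerivAt (fun t : ℝ => ((x, t • v) : E × E)) (0, v) t := by
      refine (hasDerivAt_const t x).prodMk ?_
      simpa using (hasDerivAt_id t).smul_const v
    have h2 := hN.hasFDerivAt.comp_hasDerivAt t h1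
    rw [fderiv_eq_partial hN] at h2
    have h3 := (hasDerivAt_inv ht0).smul h2
    refine h3.congr_deriv ?_
    have h4 := h.fibreDeriv_nonlinConn_self hz'
    simp only [map_smul] at h4
    simp only [map_zero, zero_add, Function.comp_apply]
    rw [← h4, smul_smul, ← add_smul]
    have : t⁻¹ + -(t ^ 2)⁻¹ * t = 0 := by field_simp; ring
    rw [this, zero_smul]
  have hc := isOpen_Ioi.is_const_of_deriv_eq_zero (𝕜 := ℝ) isPreconnected_Ioi
    (fun t ht => (hd t ht).differentiableAt.differentiableWithinAt)
    (fun t ht => (hd t ht).deriv) (mem_Ioi.2 hs) (mem_Ioi.2 one_pos)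
  simp only [inv_one, one_smul] at hc
  rw [← hc, smul_smul, mul_inv_cancel₀ hs.ne', one_smul]

namespace IsLocalNull

variable {ℓ : E × E → ℝ} {O : Set E} {f : E → ℝ} {H : Set E} {m : E → E} {x₀ : E}

/-- If `D_X m` is proportional to `m` along the hypersurface, then so is `R(X, Y)`, evaluated at
`m`. -/
theorem nonlinCurv_mem_span (h : IsLocalNull ℓ O f H m x₀)
    (hD : ∀ᶠ x in 𝓝[H] x₀, ∀ X, fderiv ℝ f x X = 0 →
      covDerivLocal ℓ m x X ∈ Submodule.span ℝ {m x})
    {X Y : E} (hX : fderiv ℝ f x₀ X = 0) (hY : fderiv ℝ f x₀ Y = 0) :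
    nonlinCurv ℓ (x₀, m x₀) X Y ∈ Submodule.span ℝ {m x₀} := by
  obtain ⟨φ, hφ⟩ := SeparatingDual.exists_eq_one (R := ℝ) h.ne_zero
  have hφm : ContDiffAt ℝ 1 (fun x => φ (m x)) x₀ := φ.contDiff.contDiffAt.comp x₀ h.smooth
  -- Normalizing by `φ (μ) = 1` determines the proportionality factor: applying `φ` to `dμ(Z) = c μ
  -- - N Z` gives `c = φ (N Z)`. So `dμ` is expressed through `N` and `μ` alone and can be
  -- differentiated again.
  set μ : E → E := fun x => (φ (m x))⁻¹ • m x with hμ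
  have hμ0 : μ x₀ = m x₀ := by simp [hμ, hφ]
  have hμc : ContDiffAt ℝ 1 μ x₀ := (hφm.inv (by simp [hφ])).smul h.smooth
  have hμd : HasFDerivAt μ (fderiv ℝ μ x₀) x₀ := (hμc.differentiableAt (by simp)).hasFDerivAt
  have hz0 : (x₀, μ x₀) ∈ slit O := by rw [hμ0]; exact h.mem_slit
  -- the normalized field is parallel up to the form `φ ∘ N`
  set A : E → E →L[ℝ] E := fun x =>
    -nonlinConn ℓ (x, μ x) + (φ.comp (nonlinConn ℓ (x, μ x))).smulRight (μ x) with hA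
  -- Positivity, not mere non-vanishing, since `N` is homogeneous only for positive factors.
  have hpos : ∀ᶠ x in 𝓝 x₀, 0 < φ (m x) :=
    hφm.continuousAt.eventually (lt_mem_nhds (by simp [hφ]))
  have hμA : ∀ᶠ x in 𝓝[H] x₀, ∀ Z, fderiv ℝ f x Z = 0 → fderiv ℝ μ x Z = A x Z := by
    filter_upwards [hD, h.eventually_isLocalNull, nhdsWithin_le_nhds hpos] with x hx hn hp Z hZ
    obtain ⟨c, hc⟩ := Submodule.mem_span_singleton.1 (hx Z hZ)
    have hm' : fderiv ℝ m x Z = c • m x - nonlinConn ℓ (x, m x) Z := by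
      rw [hc]; simp [covDerivLocal]
    have hφd : HasFDerivAt (fun x => φ (m x)) (φ.comp (fderiv ℝ m x)) x :=
      φ.hasFDerivAt.comp x hn.hasFDerivAt
    have h1 := ((hasDerivAt_inv hp.ne').comp_hasFDerivAt x hφd).smul hn.hasFDerivAt
    have h2 : fderiv ℝ μ x = _ := h1.fderiv
    have h3 : nonlinConn ℓ (x, μ x) = (φ (m x))⁻¹ • nonlinConn ℓ (x, m x) :=
      h.lag.nonlinConn_smul hn.mem_slit (inv_pos.2 hp)
    simp only [hμ] at h3
    rw [h2]
    simp only [hA, h3, hμ, Function.comp_apply, add_apply, smul_apply, neg_apply,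
      ContinuousLinearMap.smulRight_apply, ContinuousLinearMap.comp_apply, hm', map_sub, map_smul,
      smul_eq_mul]
    match_scalars <;> field_simp
    ring
  -- the pullback of the normalized field by the retraction
  obtain ⟨r, hr, hr0, hrH, hrid, hrX⟩ := h.level.exists_retraction
  have hrt : Tendsto r (𝓝 x₀) (𝓝[H] x₀) := by
    refine tendsto_nhdsWithin_iff.2 ⟨?_, hrH⟩
    simpa [hr0] using hr.continuousAt.tendsto
  have hrt' : Tendsto r (𝓝 x₀) (𝓝 x₀) := hrt.mono_right nhdsWithin_le_nhds
  have hrd : ContDiffAt ℝ 1 (fderiv ℝ r) x₀ := hr.fderiv_right (by norm_num)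
  -- The formula `dμ = A` is known only on tangent vectors at points of `H`. Since `f ∘ r = 0`, the
  -- derivative of `r` takes tangent values, so the composite satisfies it on a full neighborhood.
  have hu : ∀ᶠ x in 𝓝 x₀, HasFDerivAt (μ ∘ r) ((A (r x)).comp (fderiv ℝ r x)) x := by
    have hfr : ∀ᶠ x in 𝓝 x₀, f (r x) = 0 := by
      filter_upwards [hrH, hrt'.eventually h.level.mem_iff] with x hx1 hx2
      exact hx2.1 hx1
    filter_upwards [hr.eventually (by simp), hrt.eventually hμA,
      hrt'.eventually (hμc.eventually (by simp)), hfr.eventually_nhds,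
      hrt'.eventually (h.level.contDiffAt.eventually (by simp))] with x h1 h2 h3 h4 h5
    have hrx := (h1.differentiableAt (by simp)).hasFDerivAt
    have h6 := (h3.differentiableAt (by simp)).hasFDerivAt.comp x hrx
    have h7 := (h5.differentiableAt (by simp)).hasFDerivAt.comp x hrx
    have h8 : (fderiv ℝ f (r x)).comp (fderiv ℝ r x) = 0 := by
      have h9 : f ∘ r =ᶠ[𝓝 x] fun _ => (0 : ℝ) := h4
      exact (h7.congr_of_eventuallyEq h9.symm).unique (hasFDerivAt_const _ _)
    refine h6.congr_fderiv ?_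
    ext Z
    exact h2 _ (congrArg (fun T : E →L[ℝ] ℝ => T Z) h8)
  -- the derivative of `A`
  have hN := hasFDerivAt_comp_section
    (differentiableAt_of_contDiffOn h.lag.isOpen_slit h.lag.contDiffOn_nonlinConn hz0) hμd
  set N' := baseDeriv (nonlinConn ℓ) (x₀, μ x₀)
    + (fibreDeriv (nonlinConn ℓ) (x₀, μ x₀)).comp (fderiv ℝ μ x₀) with hN'
  have hAd : DifferentiableAt ℝ A x₀ := by
    have hsr := (ContinuousLinearMap.smulRightL ℝ E E).isBoundedBilinearMap
    exact hN.differentiableAt.neg.add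
      ((((ContinuousLinearMap.smulRightL ℝ E E).differentiableAt.comp x₀
        ((differentiableAt_const φ).clm_comp hN.differentiableAt))).clm_apply hμd.differentiableAt)
  have hAY : ∀ X Y : E, fderiv ℝ μ x₀ X = A x₀ X →
      fderiv ℝ A x₀ X Y = -N' X Y + φ (N' X Y) • μ x₀ + φ (nonlinConn ℓ (x₀, μ x₀) Y) • A x₀ X := by
    intro X Y hX
    have hNY := hN.clm_apply (hasFDerivAt_const (𝕜 := ℝ) Y x₀)
    have h1 := hNY.neg.add ((φ.hasFDerivAt.comp x₀ hNY).smul hμd)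
    have h2 := hAd.hasFDerivAt.clm_apply (hasFDerivAt_const (𝕜 := ℝ) Y x₀)
    have h3 := h2.unique (h1.congr_of_eventuallyEq (Eventually.of_forall fun x => by simp [hA]))
    have h4 := congrArg (fun T : E →L[ℝ] E => T X) h3
    simp [hX] at h4
    rw [h4]
    abel
  have hA0 : ∀ Z, fderiv ℝ f x₀ Z = 0 → fderiv ℝ μ x₀ Z = A x₀ Z :=
    hμA.self_of_nhdsWithin h.level.mem
  have hfirst : HasFDerivAt (fun x => (A (r x)).comp (fderiv ℝ r x)) _ x₀ :=
    HasFDerivAt.clm_comp (HasFDerivAt.comp x₀ (by rw [hr0]; exact hAd.hasFDerivAt)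
      (hr.differentiableAt (by simp)).hasFDerivAt) (hrd.differentiableAt (by simp)).hasFDerivAt
  -- Integrability condition for `μ ∘ r`. The terms with the second derivative of `r` are symmetric
  -- and cancel, leaving `dA(X) Y = dA(Y) X` for tangent `X`, `Y`.
  have hsymm := second_derivative_symmetric_of_eventually hu hfirst X Y
  have hrs := (hr.isSymmSndFDerivAt (by rw [minSmoothness_of_isRCLikeNormedField])) X Y
  simp only [add_apply, ContinuousLinearMap.comp_apply, ContinuousLinearMap.compL_apply,
    ContinuousLinearMap.flip_apply, hrX X hX, hrX Y hY, hr0, hrs, add_right_inj] at hsymm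
  rw [hAY X Y (hA0 X hX), hAY Y X (hA0 Y hY)] at hsymm
  have hself : fibreDeriv (nonlinConn ℓ) (x₀, μ x₀) (μ x₀) = nonlinConn ℓ (x₀, μ x₀) :=
    h.lag.fibreDeriv_nonlinConn_self hz0
  -- Substituting `dμ(X) = -N X + φ(N X) μ` into the chain rule yields the horizontal derivative of
  -- `N` plus a term simplified by `∂N/∂v (μ) = N`.
  have hNN : ∀ X Y : E, fderiv ℝ f x₀ X = 0 → N' X Y = horDerivConn ℓ (x₀, μ x₀) X Y
      + φ (nonlinConn ℓ (x₀, μ x₀) X) • nonlinConn ℓ (x₀, μ x₀) Y := by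
    intro X Y hX
    simp only [hN', add_apply, ContinuousLinearMap.comp_apply, hA0 X hX, hA, map_add, map_neg,
      neg_apply, ContinuousLinearMap.smulRight_apply, map_smul, smul_apply, hself,
      horDerivConn_apply]
    abel
  rw [hNN X Y hX, hNN Y X hY] at hsymm
  rw [← hμ0, nonlinCurv_apply]
  set a := horDerivConn ℓ (x₀, μ x₀) X Y
  set b := horDerivConn ℓ (x₀, μ x₀) Y X
  set N := nonlinConn ℓ (x₀, μ x₀) with hNdef
  have hAX : ∀ Z, A x₀ Z = -N Z + φ (N Z) • μ x₀ := fun Z => by simp [hA, hNdef]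
  rw [hAX, hAX] at hsymm
  -- The products of two factors `N` cancel by symmetry; what remains of `hsymm` is `a - b = φ(a -
  -- b) μ`.
  refine Submodule.mem_span_singleton.2 ⟨φ a - φ b, ?_⟩
  simp only [map_add, map_smul, smul_eq_mul, smul_add, smul_neg] at hsymm
  rw [← sub_eq_zero] at hsymm ⊢
  rw [← hsymm]
  module

end IsLocalNull

end LocalCurvature

/-! ### Charts of the tangent bundle, the Lagrangian and hypersurfaces in charts -/

section Charts

variable {E : Type*} [NormedAddCommGroup E] [NormedSpace ℝ E]
  {M : Type*} [TopologicalSpace M] [ChartedSpace E M] [IsManifold 𝓘(ℝ, E) ∞ M]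

variable (E) in
/-- The components in the chart at `p` of tangent vectors at `q`. -/
noncomputable def toChart (p q : M) : E →L[ℝ] E := tangentCoordChange 𝓘(ℝ, E) q p q

variable (E) in
/-- The tangent vector at `q` with given components in the chart at `p`. -/
noncomputable def ofChart (p q : M) : E →L[ℝ] E := tangentCoordChange 𝓘(ℝ, E) p q q

theorem ofChart_toChart {p q : M} (hq : q ∈ (extChartAt 𝓘(ℝ, E) p).source) (v : E) :
    ofChart E p q (toChart E p q v) = v := by
  have hqq := mem_extChartAt_source (I := 𝓘(ℝ, E)) q
  rw [ofChart, toChart, tangentCoordChange_comp ⟨⟨hqq, hq⟩, hqq⟩, tangentCoordChange_self hqq]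

theorem toChart_ofChart {p q : M} (hq : q ∈ (extChartAt 𝓘(ℝ, E) p).source) (v : E) :
    toChart E p q (ofChart E p q v) = v := by
  have hqq := mem_extChartAt_source (I := 𝓘(ℝ, E)) q
  rw [ofChart, toChart, tangentCoordChange_comp ⟨⟨hq, hqq⟩, hq⟩, tangentCoordChange_self hq]

theorem toChart_self (p : M) (v : E) : toChart E p p v = v :=
  tangentCoordChange_self (mem_extChartAt_source (I := 𝓘(ℝ, E)) p)

theorem ofChart_self (p : M) (v : E) : ofChart E p p v = v :=
  tangentCoordChange_self (mem_extChartAt_source (I := 𝓘(ℝ, E)) p)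

theorem extChartAt_tangent_apply (p q : M) (v : TS E q) :
    extChartAt 𝓘(ℝ, E).tangent (⟨p, 0⟩ : TangentBundle 𝓘(ℝ, E) M) ⟨q, v⟩
      = (extChartAt 𝓘(ℝ, E) p q, toChart E p q v) := rfl

theorem extChartAt_tangent_target (p : M) :
    (extChartAt 𝓘(ℝ, E).tangent (⟨p, 0⟩ : TangentBundle 𝓘(ℝ, E) M)).target
      = (extChartAt 𝓘(ℝ, E) p).target ×ˢ univ := by
  ext z
  simp only [ModelWithCorners.tangent, FiberBundle.extChartAt_target]
  simp +contextual [mfld_simps]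

theorem mem_extChartAt_tangent_source (p q : M) (v : TS E q) :
    (⟨q, v⟩ : TangentBundle 𝓘(ℝ, E) M) ∈
      (extChartAt 𝓘(ℝ, E).tangent (⟨p, 0⟩ : TangentBundle 𝓘(ℝ, E) M)).source
      ↔ q ∈ (extChartAt 𝓘(ℝ, E) p).source := by
  simp

theorem extChartAt_tangent_symm_apply {p q : M} (hq : q ∈ (extChartAt 𝓘(ℝ, E) p).source) (w : E) :
    (extChartAt 𝓘(ℝ, E).tangent (⟨p, 0⟩ : TangentBundle 𝓘(ℝ, E) M)).symm
      (extChartAt 𝓘(ℝ, E) p q, w) = ⟨q, ofChart E p q w⟩ := by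
  have h1 := extChartAt_tangent_apply p q (ofChart E p q w : E)
  rw [toChart_ofChart hq] at h1
  rw [← h1]
  exact PartialEquiv.left_inv _ ((mem_extChartAt_tangent_source p q _).2 hq)

theorem chartField_apply (V : (q : M) → TS E q) (p : M) (x : E) :
    chartField V p x = toChart E p ((extChartAt 𝓘(ℝ, E) p).symm x)
      (V ((extChartAt 𝓘(ℝ, E) p).symm x)) := rfl

theorem chartField_extChartAt (V : (q : M) → TS E q) {p q : M}
    (hq : q ∈ (extChartAt 𝓘(ℝ, E) p).source) :
    chartField V p (extChartAt 𝓘(ℝ, E) p q) = toChart E p q (V q) := by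
  rw [chartField_apply, (extChartAt 𝓘(ℝ, E) p).left_inv hq]

theorem chartField_self (V : (q : M) → TS E q) (p : M) :
    chartField V p (extChartAt 𝓘(ℝ, E) p p) = V p := by
  rw [chartField_extChartAt V (mem_extChartAt_source p)]
  exact toChart_self (E := E) p _

theorem chartLag_extChartAt (L : TangentBundle 𝓘(ℝ, E) M → ℝ) {p q : M}
    (hq : q ∈ (extChartAt 𝓘(ℝ, E) p).source) (w : E) :
    chartLag L p (extChartAt 𝓘(ℝ, E) p q, w) = L ⟨q, ofChart E p q w⟩ := by
  rw [chartLag, extChartAt_tangent_symm_apply hq]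

theorem metric_eq_fiberHess (L : TangentBundle 𝓘(ℝ, E) M → ℝ) (p : M) (v : TS E p) :
    metric L p v = fiberHess (chartLag L p) (extChartAt 𝓘(ℝ, E) p p, v) := by
  have : (fun w : E => L ⟨p, w⟩) = fun w : E => chartLag L p (extChartAt 𝓘(ℝ, E) p p, w) := by
    funext w
    rw [chartLag_extChartAt L (mem_extChartAt_source p)]
    congr 2
    exact (ofChart_self p w).symm
  simp only [metric, fiberHess, this]

theorem contDiffOn_chartLag {L : TangentBundle 𝓘(ℝ, E) M → ℝ}
    (hL : ContMDiffOn 𝓘(ℝ, E).tangent 𝓘(ℝ, ℝ) ∞ L {u | u.2 ≠ 0}) (p : M) :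
    ContDiffOn ℝ ∞ (chartLag L p) (slit (extChartAt 𝓘(ℝ, E) p).target) := by
  rw [← contMDiffOn_iff_contDiffOn]
  have h1 := contMDiffOn_extChartAt_symm (I := 𝓘(ℝ, E).tangent) (n := ∞)
    (⟨p, 0⟩ : TangentBundle 𝓘(ℝ, E) M)
  rw [extChartAt_tangent_target] at h1
  refine hL.comp (h1.mono (prod_mono Subset.rfl (subset_univ _))) ?_
  rintro ⟨x, w⟩ ⟨hx, hw⟩
  obtain ⟨q, hq, rfl⟩ : ∃ q ∈ (extChartAt 𝓘(ℝ, E) p).source, extChartAt 𝓘(ℝ, E) p q = x :=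
    ⟨_, (extChartAt 𝓘(ℝ, E) p).map_target hx, (extChartAt 𝓘(ℝ, E) p).right_inv hx⟩
  simp only [mem_preimage, extChartAt_tangent_symm_apply hq, mem_ofPred_eq]
  intro h0
  apply hw
  have := toChart_ofChart hq w
  change toChart E p q (ofChart E p q w) = w at this
  rw [show ofChart E p q w = 0 from h0, map_zero] at this
  exact this.symm

omit [IsManifold 𝓘(ℝ, E) ∞ M] in
theorem isOpen_target (p : M) : IsOpen (extChartAt 𝓘(ℝ, E) p).target :=
  isOpen_extChartAt_target p

theorem contDiffAt_chartChange {p q y : M} (hp : y ∈ (extChartAt 𝓘(ℝ, E) p).source)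
    (hq : y ∈ (extChartAt 𝓘(ℝ, E) q).source) :
    ContDiffAt ℝ ∞ (extChartAt 𝓘(ℝ, E) q ∘ (extChartAt 𝓘(ℝ, E) p).symm)
      (extChartAt 𝓘(ℝ, E) p y) := by
  have h' : extChartAt 𝓘(ℝ, E) p y
      ∈ ((extChartAt 𝓘(ℝ, E) p).symm ≫ (extChartAt 𝓘(ℝ, E) q)).source := by
    rw [PartialEquiv.trans_source'', PartialEquiv.symm_symm, PartialEquiv.symm_target]
    exact mem_image_of_mem _ ⟨hp, hq⟩
  have h1 := contDiffWithinAt_ext_coord_change (I := 𝓘(ℝ, E)) (n := ∞) q p h'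
  rwa [modelWithCornersSelf_coe, range_id, contDiffWithinAt_univ] at h1

theorem hasFDerivAt_chartChange {p q y : M} (hp : y ∈ (extChartAt 𝓘(ℝ, E) p).source)
    (hq : y ∈ (extChartAt 𝓘(ℝ, E) q).source) :
    HasFDerivAt (extChartAt 𝓘(ℝ, E) q ∘ (extChartAt 𝓘(ℝ, E) p).symm)
      (tangentCoordChange 𝓘(ℝ, E) p q y) (extChartAt 𝓘(ℝ, E) p y) := by
  have h1 := hasFDerivWithinAt_tangentCoordChange (I := 𝓘(ℝ, E)) (x := p) (y := q) ⟨hp, hq⟩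
  rwa [modelWithCornersSelf_coe, range_id, hasFDerivWithinAt_univ] at h1

theorem chartLag_chartChange (L : TangentBundle 𝓘(ℝ, E) M → ℝ) {p q y : M}
    (hp : y ∈ (extChartAt 𝓘(ℝ, E) p).source) (hq : y ∈ (extChartAt 𝓘(ℝ, E) q).source) (v : E) :
    chartLag L p (extChartAt 𝓘(ℝ, E) p y, v)
      = chartLag L q (extChartAt 𝓘(ℝ, E) q y, tangentCoordChange 𝓘(ℝ, E) p q y v) := by
  rw [chartLag_extChartAt L hp, chartLag_extChartAt L hq]
  congr 2
  rw [ofChart, ofChart, tangentCoordChange_comp ⟨⟨hp, hq⟩, mem_extChartAt_source y⟩]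

omit [IsManifold 𝓘(ℝ, E) ∞ M] in
theorem fderiv_fderiv_comp_clm {g : E → ℝ} {B : E →L[ℝ] E} {v : E}
    (hg : ContDiffAt ℝ 2 g (B v)) (a b : E) :
    fderiv ℝ (fderiv ℝ (fun w => g (B w))) v a b = fderiv ℝ (fderiv ℝ g) (B v) (B a) (B b) := by
  have h1 : fderiv ℝ (fun w => g (B w)) =ᶠ[𝓝 v] fun w => (fderiv ℝ g (B w)).comp B := by
    filter_upwards [B.continuous.continuousAt.eventually (hg.eventually (by simp))] with w hw
    exact ((hw.differentiableAt (by simp)).hasFDerivAt.comp w B.hasFDerivAt).fderiv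
  have h2 : ContDiffAt ℝ 1 (fderiv ℝ g) (B v) := hg.fderiv_right (by norm_num)
  have h3 := (h2.differentiableAt (by simp)).hasFDerivAt.comp v B.hasFDerivAt
  have h4 : fderiv ℝ (fun w => (fderiv ℝ g (B w)).comp B) v = _ :=
    (h3.clm_comp (hasFDerivAt_const B v)).fderiv
  rw [h1.fderiv_eq, h4]
  simp

theorem tangentCoordChange_ne_zero {p q y : M} (hp : y ∈ (extChartAt 𝓘(ℝ, E) p).source)
    (hq : y ∈ (extChartAt 𝓘(ℝ, E) q).source) {v : E} (hv : v ≠ 0) :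
    tangentCoordChange 𝓘(ℝ, E) p q y v ≠ 0 := by
  intro h0
  have h1 := tangentCoordChange_comp (I := 𝓘(ℝ, E)) (w := p) (x := q) (y := p) (z := y) (v := v)
    ⟨⟨hp, hq⟩, hp⟩
  rw [h0, map_zero, tangentCoordChange_self hp] at h1
  exact hv h1.symm

theorem contDiffAt_chartLag_fibre {L : TangentBundle 𝓘(ℝ, E) M → ℝ}
    (hL : ContMDiffOn 𝓘(ℝ, E).tangent 𝓘(ℝ, ℝ) ∞ L {u | u.2 ≠ 0}) {p y : M}
    (hp : y ∈ (extChartAt 𝓘(ℝ, E) p).source) {v : E} (hv : v ≠ 0) :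
    ContDiffAt ℝ 2 (fun w => chartLag L p (extChartAt 𝓘(ℝ, E) p y, w)) v := by
  have h1 : (extChartAt 𝓘(ℝ, E) p y, v) ∈ slit (extChartAt 𝓘(ℝ, E) p).target :=
    ⟨(extChartAt 𝓘(ℝ, E) p).map_source hp, hv⟩
  have h2 : IsOpen (slit (extChartAt 𝓘(ℝ, E) p).target) :=
    (isOpen_target p).prod isOpen_compl_singleton
  have h3 := ((contDiffOn_chartLag hL p).contDiffAt (h2.mem_nhds h1)).of_le
    (WithTop.coe_le_coe.2 le_top : (2 : WithTop ℕ∞) ≤ ∞)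
  exact h3.comp v (contDiffAt_const.prodMk contDiffAt_id)

theorem fiberHess_chartChange {L : TangentBundle 𝓘(ℝ, E) M → ℝ}
    (hL : ContMDiffOn 𝓘(ℝ, E).tangent 𝓘(ℝ, ℝ) ∞ L {u | u.2 ≠ 0}) {p q y : M}
    (hp : y ∈ (extChartAt 𝓘(ℝ, E) p).source) (hq : y ∈ (extChartAt 𝓘(ℝ, E) q).source)
    {v : E} (hv : v ≠ 0) (a b : E) :
    fiberHess (chartLag L p) (extChartAt 𝓘(ℝ, E) p y, v) a b
      = fiberHess (chartLag L q)
        (extChartAt 𝓘(ℝ, E) q y, tangentCoordChange 𝓘(ℝ, E) p q y v)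
        (tangentCoordChange 𝓘(ℝ, E) p q y a) (tangentCoordChange 𝓘(ℝ, E) p q y b) := by
  have h1 := funext (chartLag_chartChange L hp hq)
  simp only [fiberHess, h1]
  exact fderiv_fderiv_comp_clm (contDiffAt_chartLag_fibre hL hq
    (tangentCoordChange_ne_zero hp hq hv)) a b

theorem metric_eq_fiberHess_toChart {L : TangentBundle 𝓘(ℝ, E) M → ℝ}
    (hL : ContMDiffOn 𝓘(ℝ, E).tangent 𝓘(ℝ, ℝ) ∞ L {u | u.2 ≠ 0}) {p q : M}
    (hq : q ∈ (extChartAt 𝓘(ℝ, E) p).source) {v : TS E q} (hv : v ≠ 0) (a b : TS E q) :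
    metric L q v a b = fiberHess (chartLag L p) (extChartAt 𝓘(ℝ, E) p q, toChart E p q v)
      (toChart E p q a) (toChart E p q b) := by
  rw [metric_eq_fiberHess]
  exact fiberHess_chartChange hL (mem_extChartAt_source q) hq hv a b

/-- At a point `q` other than `p`, homogeneity and signature are carried over from the fibre at `q`
by the linear isomorphism `ofChart E p q`. -/
theorem FinslerSpacetime.isLocalLagrangian (F : FinslerSpacetime E M) (p : M) :
    IsLocalLagrangian (chartLag F.L p) (extChartAt 𝓘(ℝ, E) p).target := by
  refine ⟨isOpen_target p, contDiffOn_chartLag F.smooth p, ?_, ?_⟩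
  all_goals
    rintro ⟨x, w⟩ ⟨hx, hw⟩
    obtain ⟨q, hq, rfl⟩ : ∃ q ∈ (extChartAt 𝓘(ℝ, E) p).source, extChartAt 𝓘(ℝ, E) p q = x :=
      ⟨_, (extChartAt 𝓘(ℝ, E) p).map_target hx, (extChartAt 𝓘(ℝ, E) p).right_inv hx⟩
    have hw' : ofChart E p q w ≠ 0 :=
      tangentCoordChange_ne_zero hq (mem_extChartAt_source q) hw
  · intro s hs
    simp only [chartLag_extChartAt F.L hq]
    rw [map_smul]
    exact F.homogeneous q (ofChart E p q w) hw' s hs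
  · have hlor := F.lorentzian q (ofChart E p q w) hw'
    have key : ∀ a b, fiberHess (chartLag F.L p) (extChartAt 𝓘(ℝ, E) p q, w) a b
        = metric F.L q (ofChart E p q w) (ofChart E p q a) (ofChart E p q b) := by
      intro a b
      exact (fiberHess_chartChange F.smooth hq (mem_extChartAt_source q) hw a b).trans
        (congrArg (fun B : E →L[ℝ] E →L[ℝ] ℝ => B (ofChart E p q a) (ofChart E p q b))
          (metric_eq_fiberHess F.L q (ofChart E p q w)).symm)
    obtain ⟨hsymm, t, ht, hpos⟩ := hlor
    refine ⟨fun a b => by rw [key, key, hsymm], toChart E p q t, ?_, fun a ha hta => ?_⟩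
    · rw [key, ofChart_toChart hq]
      exact ht
    · rw [key, ofChart_toChart hq] at hta
      rw [key]
      exact hpos _ (tangentCoordChange_ne_zero hq (mem_extChartAt_source q) ha) hta

/-! ### Hypersurfaces in charts -/

theorem ContMDiffAt.contDiffAt_chart {g : M → ℝ} {k : WithTop ℕ∞} (hk : k ≤ ∞) {p q : M}
    (hq : q ∈ (extChartAt 𝓘(ℝ, E) p).source) (hg : ContMDiffAt 𝓘(ℝ, E) 𝓘(ℝ, ℝ) k g q) :
    ContDiffAt ℝ k (g ∘ (extChartAt 𝓘(ℝ, E) p).symm) (extChartAt 𝓘(ℝ, E) p q) := by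
  rw [← contMDiffAt_iff_contDiffAt]
  have h1 := ((contMDiffOn_extChartAt_symm (I := 𝓘(ℝ, E)) (n := ∞) p).contMDiffAt
    ((isOpen_target p).mem_nhds ((extChartAt 𝓘(ℝ, E) p).map_source hq))).of_le hk
  refine ContMDiffAt.comp _ ?_ h1
  rwa [(extChartAt 𝓘(ℝ, E) p).left_inv hq]

omit [IsManifold 𝓘(ℝ, E) ∞ M] in
theorem mfderiv_eq_fderiv_self {g : M → ℝ} {q : M}
    (hg : MDifferentiableAt 𝓘(ℝ, E) 𝓘(ℝ, ℝ) g q) (X : TS E q) :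
    (mfderiv 𝓘(ℝ, E) 𝓘(ℝ, ℝ) g q X : ℝ)
      = fderiv ℝ (g ∘ (extChartAt 𝓘(ℝ, E) q).symm) (extChartAt 𝓘(ℝ, E) q q) X := by
  have h1 := congrArg (fun T : E →L[ℝ] ℝ => T X) hg.mfderiv
  rw [modelWithCornersSelf_coe, range_id, fderivWithin_univ] at h1
  exact h1

theorem mfderiv_eq_fderiv_chart {g : M → ℝ} {p q : M} (hq : q ∈ (extChartAt 𝓘(ℝ, E) p).source)
    (hg : ContMDiffAt 𝓘(ℝ, E) 𝓘(ℝ, ℝ) 1 g q) (X : TS E q) :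
    (mfderiv 𝓘(ℝ, E) 𝓘(ℝ, ℝ) g q X : ℝ)
      = fderiv ℝ (g ∘ (extChartAt 𝓘(ℝ, E) p).symm) (extChartAt 𝓘(ℝ, E) p q) (toChart E p q X) := by
  rw [mfderiv_eq_fderiv_self (hg.mdifferentiableAt (by simp))]
  have hqq := mem_extChartAt_source (I := 𝓘(ℝ, E)) q
  have h1 := ContMDiffAt.contDiffAt_chart (by simp) hq hg
  have h2 := hasFDerivAt_chartChange hqq hq
  have hpt : (extChartAt 𝓘(ℝ, E) p ∘ (extChartAt 𝓘(ℝ, E) q).symm) (extChartAt 𝓘(ℝ, E) q q)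
      = extChartAt 𝓘(ℝ, E) p q := by simp
  have h3 := HasFDerivAt.comp (extChartAt 𝓘(ℝ, E) q q)
    (by rw [hpt]; exact (h1.differentiableAt (by simp)).hasFDerivAt) h2
  have h4 : g ∘ (extChartAt 𝓘(ℝ, E) q).symm =ᶠ[𝓝 (extChartAt 𝓘(ℝ, E) q q)]
      (g ∘ (extChartAt 𝓘(ℝ, E) p).symm) ∘
        (extChartAt 𝓘(ℝ, E) p ∘ (extChartAt 𝓘(ℝ, E) q).symm) := by
    have h5 : (extChartAt 𝓘(ℝ, E) q).symm ⁻¹' (extChartAt 𝓘(ℝ, E) p).source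
        ∈ 𝓝 (extChartAt 𝓘(ℝ, E) q q) := by
      refine (continuousAt_extChartAt_symm q).preimage_mem_nhds ?_
      rw [extChartAt_to_inv]
      exact (isOpen_extChartAt_source p).mem_nhds hq
    filter_upwards [h5] with x hx
    simp only [Function.comp_apply]
    rw [(extChartAt 𝓘(ℝ, E) p).left_inv hx]
  rw [h4.fderiv_eq, h3.fderiv]
  rfl

/-- `f` is a local equation of `S` on the open set `U`. -/
structure IsLocalEquation (S U : Set M) (f : M → ℝ) : Prop where
  isOpen : IsOpen U
  smooth : ContMDiffOn 𝓘(ℝ, E) 𝓘(ℝ, ℝ) 2 f U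
  mfderiv_ne : ∀ q ∈ U, mfderiv 𝓘(ℝ, E) 𝓘(ℝ, ℝ) f q ≠ 0
  inter_eq : S ∩ U = {q ∈ U | f q = 0}

omit [IsManifold 𝓘(ℝ, E) ∞ M] in
theorem tendsto_extChartAt_symm_chartSet (S : Set M) {p q : M}
    (hq : q ∈ (extChartAt 𝓘(ℝ, E) p).source) :
    Tendsto (extChartAt 𝓘(ℝ, E) p).symm (𝓝[chartSet E S p] (extChartAt 𝓘(ℝ, E) p q)) (𝓝[S] q) := by
  refine tendsto_nhdsWithin_iff.2 ⟨?_, ?_⟩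
  · have h1 := (continuousAt_extChartAt_symm' (I := 𝓘(ℝ, E)) hq).tendsto
    rw [(extChartAt 𝓘(ℝ, E) p).left_inv hq] at h1
    exact h1.mono_left nhdsWithin_le_nhds
  · filter_upwards [self_mem_nhdsWithin] with x hx using hx.1

omit [IsManifold 𝓘(ℝ, E) ∞ M] in
theorem tendsto_extChartAt_chartSet (S : Set M) {p q : M}
    (hq : q ∈ (extChartAt 𝓘(ℝ, E) p).source) :
    Tendsto (extChartAt 𝓘(ℝ, E) p) (𝓝[S] q) (𝓝[chartSet E S p] (extChartAt 𝓘(ℝ, E) p q)) := by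
  refine tendsto_nhdsWithin_iff.2
    ⟨(continuousAt_extChartAt' hq).tendsto.mono_left nhdsWithin_le_nhds, ?_⟩
  filter_upwards [self_mem_nhdsWithin,
    nhdsWithin_le_nhds ((isOpen_extChartAt_source p).mem_nhds hq)] with y hy hy'
  refine ⟨?_, (extChartAt 𝓘(ℝ, E) p).map_source hy'⟩
  rwa [mem_preimage, (extChartAt 𝓘(ℝ, E) p).left_inv hy']

namespace IsLocalEquation

variable {S U : Set M} {f : M → ℝ} (h : IsLocalEquation (E := E) S U f)
include h

omit [IsManifold 𝓘(ℝ, E) ∞ M] in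
theorem mem_iff {q : M} (hq : q ∈ U) : q ∈ S ↔ f q = 0 := by
  have := congrArg (fun s : Set M => q ∈ s) h.inter_eq
  simpa [hq] using this

theorem isLevelSetAt {p q : M} (hqS : q ∈ S) (hqU : q ∈ U)
    (hq : q ∈ (extChartAt 𝓘(ℝ, E) p).source) :
    IsLevelSetAt (f ∘ (extChartAt 𝓘(ℝ, E) p).symm) (chartSet E S p)
      (extChartAt 𝓘(ℝ, E) p q) := by
  have hf : ContMDiffAt 𝓘(ℝ, E) 𝓘(ℝ, ℝ) 2 f q := h.smooth.contMDiffAt (h.isOpen.mem_nhds hqU)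
  have hx := (extChartAt 𝓘(ℝ, E) p).map_source hq
  refine ⟨⟨?_, hx⟩, ContMDiffAt.contDiffAt_chart (WithTop.coe_le_coe.2 le_top) hq hf, ?_, ?_⟩
  · rwa [mem_preimage, (extChartAt 𝓘(ℝ, E) p).left_inv hq]
  · intro h0
    refine h.mfderiv_ne q hqU ?_
    ext X
    have := mfderiv_eq_fderiv_chart hq (hf.of_le (by norm_num)) X
    rw [h0] at this
    exact this
  · have h1 := (continuousAt_extChartAt_symm' (I := 𝓘(ℝ, E)) hq).tendsto
    rw [(extChartAt 𝓘(ℝ, E) p).left_inv hq] at h1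
    filter_upwards [(isOpen_target p).mem_nhds hx, h1.eventually (h.isOpen.mem_nhds hqU)]
      with x hx1 hx2
    rw [Function.comp_apply, ← h.mem_iff hx2]
    exact ⟨fun hh => hh.1, fun hh => ⟨hh, hx1⟩⟩

variable [CompleteSpace E]

/-- A single equation with non-zero differential suffices: a vector annihilated by it is the
velocity of a curve in the level set, hence annihilated by every `C^1` function vanishing there. -/
theorem mem_tangentOf_iff {p q : M} (hqS : q ∈ S) (hqU : q ∈ U)
    (hq : q ∈ (extChartAt 𝓘(ℝ, E) p).source) (X : TS E q) :
    X ∈ tangentOf S q ↔ fderiv ℝ (f ∘ (extChartAt 𝓘(ℝ, E) p).symm)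
      (extChartAt 𝓘(ℝ, E) p q) (toChart E p q X) = 0 := by
  have hf : ContMDiffAt 𝓘(ℝ, E) 𝓘(ℝ, ℝ) 2 f q := h.smooth.contMDiffAt (h.isOpen.mem_nhds hqU)
  have hf1 : ContMDiffAt 𝓘(ℝ, E) 𝓘(ℝ, ℝ) 1 f q := hf.of_le (by norm_num)
  constructor
  · intro hX
    rw [← mfderiv_eq_fderiv_chart hq hf1]
    refine hX f hf1 ?_
    filter_upwards [self_mem_nhdsWithin, nhdsWithin_le_nhds (h.isOpen.mem_nhds hqU)] with y hy hy'
    exact (h.mem_iff hy').1 hy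
  · intro hX g hg hg0
    have h1 := mfderiv_eq_fderiv_chart hq hg X
    refine h1.trans ?_
    have h2 := ContMDiffAt.contDiffAt_chart (by simp) hq hg
    exact (h.isLevelSetAt hqS hqU hq).eq_zero_of_eventually_zero
      (h2.differentiableAt (by simp)).hasFDerivAt
      ((tendsto_extChartAt_symm_chartSet S hq).eventually hg0) hX

theorem mem_tangentOf_iff_self {p : M} (hpS : p ∈ S) (hpU : p ∈ U) (X : TS E p) :
    X ∈ tangentOf S p ↔ fderiv ℝ (f ∘ (extChartAt 𝓘(ℝ, E) p).symm)
      (extChartAt 𝓘(ℝ, E) p p) X = 0 := by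
  rw [h.mem_tangentOf_iff hpS hpU (mem_extChartAt_source p) X]
  exact Eq.congr_left (congrArg _ (toChart_self (E := E) p X))

end IsLocalEquation

end Charts

/-! ### Vector fields, directional derivatives and brackets in charts -/

section ChartFields

variable {E : Type*} [NormedAddCommGroup E] [NormedSpace ℝ E]
  {M : Type*} [TopologicalSpace M] [ChartedSpace E M] [IsManifold 𝓘(ℝ, E) ∞ M]

theorem contDiffWithinAt_chartField {V : (q : M) → TS E q} {S : Set M} {p q : M}
    (hq : q ∈ (extChartAt 𝓘(ℝ, E) p).source)
    (hV : ContMDiffWithinAt 𝓘(ℝ, E) 𝓘(ℝ, E).tangent 1 (toSection V) S q) :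
    ContDiffWithinAt ℝ 1 (chartField V p) (chartSet E S p) (extChartAt 𝓘(ℝ, E) p q) := by
  have h1 : ContMDiffAt 𝓘(ℝ, E).tangent 𝓘(ℝ, E × E) 1
      (extChartAt 𝓘(ℝ, E).tangent (⟨p, 0⟩ : TangentBundle 𝓘(ℝ, E) M)) (toSection V q) := by
    refine contMDiffAt_extChartAt' ?_
    rw [← extChartAt_source 𝓘(ℝ, E).tangent]
    exact (mem_extChartAt_tangent_source p q _).2 hq
  have h2 := h1.comp_contMDiffWithinAt q hV
  have h3 : ContMDiffWithinAt 𝓘(ℝ, E) 𝓘(ℝ, E) 1 (extChartAt 𝓘(ℝ, E) p).symm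
      (chartSet E S p) (extChartAt 𝓘(ℝ, E) p q) :=
    ((contMDiffOn_extChartAt_symm (I := 𝓘(ℝ, E)) (n := 1) p).contMDiffAt
      ((isOpen_target p).mem_nhds ((extChartAt 𝓘(ℝ, E) p).map_source hq))).contMDiffWithinAt
  have h4 := ContMDiffWithinAt.comp (extChartAt 𝓘(ℝ, E) p q)
    (by rwa [(extChartAt 𝓘(ℝ, E) p).left_inv hq]) h3 (fun x hx => hx.1)
  have h5 := contMDiffWithinAt_iff_contDiffWithinAt.1 h4
  exact contDiff_snd.contDiffAt.comp_contDiffWithinAt _ h5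

/-- The vector field with components `ξ` in the chart at `p`. -/
noncomputable def ofChartField (ξ : E → E) (p : M) (q : M) : TS E q :=
  ofChart E p q (ξ (extChartAt 𝓘(ℝ, E) p q))

theorem toSection_ofChartField (ξ : E → E) {p q : M} (hq : q ∈ (extChartAt 𝓘(ℝ, E) p).source) :
    toSection (ofChartField ξ p) q
      = (extChartAt 𝓘(ℝ, E).tangent (⟨p, 0⟩ : TangentBundle 𝓘(ℝ, E) M)).symm
        (extChartAt 𝓘(ℝ, E) p q, ξ (extChartAt 𝓘(ℝ, E) p q)) := by
  rw [extChartAt_tangent_symm_apply hq]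
  rfl

theorem toChart_ofChartField (ξ : E → E) {p q : M} (hq : q ∈ (extChartAt 𝓘(ℝ, E) p).source) :
    toChart E p q (ofChartField ξ p q) = ξ (extChartAt 𝓘(ℝ, E) p q) :=
  toChart_ofChart hq _

theorem contMDiffAt_ofChartField {ξ : E → E} {p q : M} (hq : q ∈ (extChartAt 𝓘(ℝ, E) p).source)
    (hξ : ContDiffAt ℝ 1 ξ (extChartAt 𝓘(ℝ, E) p q)) :
    ContMDiffAt 𝓘(ℝ, E) 𝓘(ℝ, E).tangent 1 (toSection (ofChartField ξ p)) q := by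
  have h1 : ContMDiffAt 𝓘(ℝ, E × E) 𝓘(ℝ, E).tangent 1
      (extChartAt 𝓘(ℝ, E).tangent (⟨p, 0⟩ : TangentBundle 𝓘(ℝ, E) M)).symm
      (extChartAt 𝓘(ℝ, E) p q, ξ (extChartAt 𝓘(ℝ, E) p q)) := by
    refine (contMDiffOn_extChartAt_symm _).contMDiffAt ?_
    rw [extChartAt_tangent_target]
    exact ((isOpen_target p).prod isOpen_univ).mem_nhds
      ⟨(extChartAt 𝓘(ℝ, E) p).map_source hq, mem_univ _⟩
  have h2 : ContDiffAt ℝ 1 (fun x : E => (x, ξ x)) (extChartAt 𝓘(ℝ, E) p q) :=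
    contDiffAt_id.prodMk hξ
  have h3 : ContMDiffAt 𝓘(ℝ, E) 𝓘(ℝ, E) 1 (extChartAt 𝓘(ℝ, E) p) q :=
    contMDiffAt_extChartAt' (by rwa [← extChartAt_source 𝓘(ℝ, E)])
  have h4 := h1.comp q (ContMDiffAt.comp q h2.contMDiffAt h3)
  refine h4.congr_of_eventuallyEq ?_
  filter_upwards [(isOpen_extChartAt_source p).mem_nhds hq] with y hy
  exact toSection_ofChartField ξ hy

omit [IsManifold 𝓘(ℝ, E) ∞ M] in
variable (E) in
-- The manifold derivatives and brackets within `S` use the set on the left; derivatives within a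
-- set depend only on its germ.
theorem eventuallyEq_chartSet (S : Set M) (p : M) :
    ((extChartAt 𝓘(ℝ, E) p).symm ⁻¹' S ∩ range 𝓘(ℝ, E) : Set E)
      =ᶠ[𝓝 (extChartAt 𝓘(ℝ, E) p p)] chartSet E S p := by
  rw [eventuallyEq_set]
  filter_upwards [extChartAt_target_mem_nhds (I := 𝓘(ℝ, E)) p] with x hx
  simp only [modelWithCornersSelf_coe, range_id, inter_univ, chartSet]
  exact ⟨fun h => ⟨h, hx⟩, fun h => h.1⟩

omit [IsManifold 𝓘(ℝ, E) ∞ M] in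
-- `mfderivWithin` is zero for functions that are not differentiable, so differentiability on the
-- manifold, continuity included, has to be established before it can be unfolded in the chart.
theorem dirDeriv_eq {S : Set M} {p : M} {g : M → ℝ}
    (hg : DifferentiableWithinAt ℝ (g ∘ (extChartAt 𝓘(ℝ, E) p).symm) (chartSet E S p)
      (extChartAt 𝓘(ℝ, E) p p)) (X : TS E p) :
    FinslerSpacetime.dirDeriv S g p X
      = fderivWithin ℝ (g ∘ (extChartAt 𝓘(ℝ, E) p).symm) (chartSet E S p)
        (extChartAt 𝓘(ℝ, E) p p) X := by
  have hset := eventuallyEq_chartSet (E := E) S p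
  have hmd : MDifferentiableWithinAt 𝓘(ℝ, E) 𝓘(ℝ, ℝ) g S p := by
    rw [mdifferentiableWithinAt_iff]
    constructor
    · have h1 := hg.continuousWithinAt.tendsto.comp
        (tendsto_extChartAt_chartSet (E := E) S (mem_extChartAt_source p))
      have h2 : (g ∘ (extChartAt 𝓘(ℝ, E) p).symm) ∘ (extChartAt 𝓘(ℝ, E) p) =ᶠ[𝓝[S] p] g := by
        filter_upwards [nhdsWithin_le_nhds (extChartAt_source_mem_nhds (I := 𝓘(ℝ, E)) p)] with y hy
        exact congrArg g ((extChartAt 𝓘(ℝ, E) p).left_inv hy)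
      refine Tendsto.congr' h2 ?_
      simpa using h1
    · obtain ⟨g', hg'⟩ := hg
      exact ⟨g', (hasFDerivWithinAt_congr_set hset).2 hg'⟩
  have h1 := congrArg (fun T : E →L[ℝ] ℝ => T X) hmd.mfderivWithin
  refine h1.trans ?_
  rw [fderivWithin_congr_set hset]
  rfl

theorem mfderiv_extChartAt_apply {p q : M} (hq : q ∈ (extChartAt 𝓘(ℝ, E) p).source) (v : TS E q) :
    (mfderiv 𝓘(ℝ, E) 𝓘(ℝ, E) (extChartAt 𝓘(ℝ, E) p) q v : E) = toChart E p q v := by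
  have h1 : MDifferentiableAt 𝓘(ℝ, E) 𝓘(ℝ, E) (extChartAt 𝓘(ℝ, E) p) q :=
    mdifferentiableAt_extChartAt (by rwa [← extChartAt_source 𝓘(ℝ, E)])
  exact congrArg (fun T : E →L[ℝ] E => T v) h1.mfderiv

theorem mpullbackWithin_extChartAt_symm (V : (q : M) → TS E q) {p : M} {x : E}
    (hx : x ∈ (extChartAt 𝓘(ℝ, E) p).target) :
    VectorField.mpullbackWithin 𝓘(ℝ, E) 𝓘(ℝ, E) (extChartAt 𝓘(ℝ, E) p).symm V
      (range 𝓘(ℝ, E)) x = chartField V p x := by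
  rw [VectorField.mpullbackWithin_apply, ContinuousLinearMap.inverse_eq
    (mfderivWithin_extChartAt_symm_comp_mfderiv_extChartAt hx)
    (mfderiv_extChartAt_comp_mfderivWithin_extChartAt_symm hx)]
  exact mfderiv_extChartAt_apply ((extChartAt 𝓘(ℝ, E) p).map_target hx) _

/-- The preferred chart at `p` has identity derivative at `p`, so transporting the coordinate
bracket back changes nothing. -/
theorem bracket_eq {S : Set M} {p : M} (n X : (q : M) → TS E q) :
    FinslerSpacetime.bracket S n X p
      = (derivAlong S X p (n p) - derivAlong S n p (X p) : E) := by
  have hset := eventuallyEq_chartSet E S p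
  have hV : ∀ V : (q : M) → TS E q, (VectorField.mpullbackWithin 𝓘(ℝ, E) 𝓘(ℝ, E)
      (extChartAt 𝓘(ℝ, E) p).symm V (range 𝓘(ℝ, E)) : E → E)
        =ᶠ[𝓝 (extChartAt 𝓘(ℝ, E) p p)] chartField V p := by
    intro V
    filter_upwards [extChartAt_target_mem_nhds (I := 𝓘(ℝ, E)) p] with x hx
    exact mpullbackWithin_extChartAt_symm V hx
  have hd : ∀ V : (q : M) → TS E q, fderivWithin ℝ (VectorField.mpullbackWithin 𝓘(ℝ, E) 𝓘(ℝ, E)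
      (extChartAt 𝓘(ℝ, E) p).symm V (range 𝓘(ℝ, E)) : E → E)
        ((extChartAt 𝓘(ℝ, E) p).symm ⁻¹' S ∩ range 𝓘(ℝ, E)) (extChartAt 𝓘(ℝ, E) p p)
        = derivAlong S V p := by
    intro V
    exact (fderivWithin_congr_set hset).trans
      (((hV V).filter_mono nhdsWithin_le_nhds).fderivWithin_eq (hV V).self_of_nhds)
  have hval : ∀ V : (q : M) → TS E q, (VectorField.mpullbackWithin 𝓘(ℝ, E) 𝓘(ℝ, E)
      (extChartAt 𝓘(ℝ, E) p).symm V (range 𝓘(ℝ, E)) (extChartAt 𝓘(ℝ, E) p p) : E) = V p :=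
    fun V => (hV V).self_of_nhds.trans (chartField_self V p)
  have hb : VectorField.lieBracketWithin ℝ
      (VectorField.mpullbackWithin 𝓘(ℝ, E) 𝓘(ℝ, E) (extChartAt 𝓘(ℝ, E) p).symm n (range 𝓘(ℝ, E)))
      (VectorField.mpullbackWithin 𝓘(ℝ, E) 𝓘(ℝ, E) (extChartAt 𝓘(ℝ, E) p).symm X (range 𝓘(ℝ, E)))
      ((extChartAt 𝓘(ℝ, E) p).symm ⁻¹' S ∩ range 𝓘(ℝ, E)) (extChartAt 𝓘(ℝ, E) p p)
      = (derivAlong S X p (n p) - derivAlong S n p (X p) : E) := by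
    have h1 := congrArg₂ (fun (T : E →L[ℝ] E) (v : E) => T v) (hd X) (hval n)
    have h2 := congrArg₂ (fun (T : E →L[ℝ] E) (v : E) => T v) (hd n) (hval X)
    exact congrArg₂ (fun a b : E => a - b) h1 h2
  rw [FinslerSpacetime.bracket, VectorField.mlieBracketWithin_apply, hb, mfderiv_extChartAt_self]
  exact congrArg (fun T : E →L[ℝ] E => T (derivAlong S X p (n p) - derivAlong S n p (X p)))
    (ContinuousLinearMap.inverse_id (R := ℝ) (M := E))

end ChartFields

/-! ### Tangency of brackets and coordinate invariance of the Lie derivative of the metric -/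

section LocalInvariance

variable {E : Type*} [NormedAddCommGroup E] [NormedSpace ℝ E]

/-- The bracket of two fields tangent to a level set is tangent to it. -/
theorem IsLevelSetAt.fderiv_bracket [CompleteSpace E] {f : E → ℝ} {H : Set E} {x₀ : E}
    (h : IsLevelSetAt f H x₀) {ξ η : E → E} {ξ' η' : E →L[ℝ] E} (hξ : HasFDerivAt ξ ξ' x₀)
    (hη : HasFDerivAt η η' x₀) (hξt : ∀ᶠ x in 𝓝[H] x₀, fderiv ℝ f x (ξ x) = 0)
    (hηt : ∀ᶠ x in 𝓝[H] x₀, fderiv ℝ f x (η x) = 0) :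
    fderiv ℝ f x₀ (η' (ξ x₀) - ξ' (η x₀)) = 0 := by
  have hf2 : HasFDerivAt (fderiv ℝ f) (fderiv ℝ (fderiv ℝ f) x₀) x₀ :=
    (h.contDiffAt_fderiv.differentiableAt (by simp)).hasFDerivAt
  have hsymm := (h.contDiffAt.isSymmSndFDerivAt
    (by rw [minSmoothness_of_isRCLikeNormedField])) (ξ x₀) (η x₀)
  have h1 := h.eq_zero_of_eventually_zero (hf2.clm_apply hξ) hξt
    (hηt.self_of_nhdsWithin h.mem)
  have h2 := h.eq_zero_of_eventually_zero (hf2.clm_apply hη) hηt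
    (hξt.self_of_nhdsWithin h.mem)
  simp only [add_apply, ContinuousLinearMap.comp_apply, ContinuousLinearMap.flip_apply] at h1 h2
  rw [map_sub]
  linarith

/-- The Lie derivative of the metric along the null field is invariant under changes of
coordinates. -/
theorem IsLocalNull.lieForm_comp [FiniteDimensional ℝ E] {ℓ₁ ℓ₂ : E × E → ℝ} {O₁ O₂ : Set E}
    {f₁ f₂ : E → ℝ} {H₁ H₂ : Set E} {m₁ m₂ : E → E} {x₁ : E} {τ : E → E}
    (h₁ : IsLocalNull ℓ₁ O₁ f₁ H₁ m₁ x₁) (hτ : ContDiffAt ℝ 2 τ x₁)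
    (h₂ : IsLocalNull ℓ₂ O₂ f₂ H₂ m₂ (τ x₁))
    (hm : ∀ᶠ x in 𝓝[H₁] x₁, m₂ (τ x) = fderiv ℝ τ x (m₁ x))
    (hg : ∀ᶠ x in 𝓝[H₁] x₁, ∀ a b, fiberHess ℓ₁ (x, m₁ x) a b
      = fiberHess ℓ₂ (τ x, m₂ (τ x)) (fderiv ℝ τ x a) (fderiv ℝ τ x b))
    {X Y : E} (hX : fderiv ℝ f₁ x₁ X = 0) (hY : fderiv ℝ f₁ x₁ Y = 0) :
    lieForm ℓ₁ m₁ x₁ X Y = lieForm ℓ₂ m₂ (τ x₁) (fderiv ℝ τ x₁ X) (fderiv ℝ τ x₁ Y) := by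
  have hτd : HasFDerivAt τ (fderiv ℝ τ x₁) x₁ := (hτ.differentiableAt (by simp)).hasFDerivAt
  have hτ2c : ContDiffAt ℝ 1 (fderiv ℝ τ) x₁ := hτ.fderiv_right (by norm_num)
  have hτ2 : HasFDerivAt (fderiv ℝ τ) (fderiv ℝ (fderiv ℝ τ) x₁) x₁ :=
    (hτ2c.differentiableAt (by simp)).hasFDerivAt
  have hsymm := fun a b => (hτ.isSymmSndFDerivAt
    (by rw [minSmoothness_of_isRCLikeNormedField])) a b
  have hm0 : m₂ (τ x₁) = fderiv ℝ τ x₁ (m₁ x₁) := hm.self_of_nhdsWithin h₁.level.mem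
  have hg0 := hg.self_of_nhdsWithin h₁.level.mem
  -- The two fields are related only along the hypersurface, so their derivatives are compared only
  -- on tangent vectors.
  have hm₂ : ∀ Z, fderiv ℝ f₁ x₁ Z = 0 → fderiv ℝ m₂ (τ x₁) (fderiv ℝ τ x₁ Z)
      = fderiv ℝ τ x₁ (fderiv ℝ m₁ x₁ Z) + fderiv ℝ (fderiv ℝ τ) x₁ Z (m₁ x₁) := by
    intro Z hZ
    have h3 := h₁.level.hasFDerivWithinAt_unique
      (h₂.hasFDerivAt.comp x₁ hτd).hasFDerivWithinAt
      (hτ2.clm_apply h₁.hasFDerivAt).hasFDerivWithinAt hm hZ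
    simpa using h3
  have hγ₂ : HasFDerivAt (fun y => fiberHess ℓ₂ (y, m₂ y))
      (fderiv ℝ (fun y => fiberHess ℓ₂ (y, m₂ y)) (τ x₁)) (τ x₁) :=
    h₂.hasFDerivAt_fiberHess.differentiableAt.hasFDerivAt
  have hγ₁ : HasFDerivAt (fun y => fiberHess ℓ₁ (y, m₁ y))
      (fderiv ℝ (fun y => fiberHess ℓ₁ (y, m₁ y)) x₁) x₁ :=
    h₁.hasFDerivAt_fiberHess.differentiableAt.hasFDerivAt
  have hXc := hasFDerivAt_const (𝕜 := ℝ) X x₁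
  have hYc := hasFDerivAt_const (𝕜 := ℝ) Y x₁
  have hL := (hγ₁.clm_apply hXc).clm_apply hYc
  have hc : HasFDerivAt (fun x => fiberHess ℓ₂ (τ x, m₂ (τ x))) _ x₁ :=
    HasFDerivAt.comp (g := fun y => fiberHess ℓ₂ (y, m₂ y))
      (g' := fderiv ℝ (fun y => fiberHess ℓ₂ (y, m₂ y)) (τ x₁)) x₁ hγ₂ hτd
  have hR := (hc.clm_apply (hτ2.clm_apply hXc)).clm_apply (hτ2.clm_apply hYc)
  have h3 := h₁.level.hasFDerivWithinAt_unique hL.hasFDerivWithinAt hR.hasFDerivWithinAt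
    (by filter_upwards [hg] with x hx using hx X Y) h₁.fderiv_self
  simp only [add_apply, ContinuousLinearMap.comp_apply, ContinuousLinearMap.flip_apply, zero_apply,
    map_zero, zero_add] at h3
  -- The second derivatives of `τ` coming from the metric match those coming from the field, once
  -- their arguments are exchanged by symmetry.
  rw [lieForm, lieForm, h3, hg0, hg0, hm₂ X hX, hm₂ Y hY, hm0, hsymm (m₁ x₁) X, hsymm (m₁ x₁) Y]
  simp only [map_add, add_apply]
  ring

end LocalInvariance

/-! ### Null hypersurfaces on the manifold and their chart data -/

section NullChart

variable {E : Type*} [NormedAddCommGroup E] [NormedSpace ℝ E]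
  {M : Type*} [TopologicalSpace M] [ChartedSpace E M] [IsManifold 𝓘(ℝ, E) ∞ M]

/-- Near `p`, the hypersurface `S` has the equation `f`, and the components of the null field `n` in
the chart at `p` extend to the `C^1` field `m`. -/
structure NullChart (F : FinslerSpacetime E M) (S : Set M) (n : (q : M) → TS E q) (p : M)
    (U : Set M) (f : M → ℝ) (m : E → E) : Prop where
  mem : p ∈ S
  mem_nhd : p ∈ U
  eqn : IsLocalEquation (E := E) S U f
  null : IsLocalNull (chartLag F.L p) (extChartAt 𝓘(ℝ, E) p).target
    (f ∘ (extChartAt 𝓘(ℝ, E) p).symm) (chartSet E S p) m (extChartAt 𝓘(ℝ, E) p p)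
  eq : chartField n p =ᶠ[𝓝[chartSet E S p] (extChartAt 𝓘(ℝ, E) p p)] m

omit [IsManifold 𝓘(ℝ, E) ∞ M] in
/-- To check a property near `p₀` on `chartSet E S p`, one may use points of `S`. -/
theorem eventually_chartSet_of_mem {S : Set M} {p p₀ : M}
    (hp₀ : p₀ ∈ (extChartAt 𝓘(ℝ, E) p).source) {P : E → Prop} {Q : M → Prop}
    (hQ : ∀ᶠ q in 𝓝[S] p₀, Q q)
    (h : ∀ q ∈ S, q ∈ (extChartAt 𝓘(ℝ, E) p).source → Q q → P (extChartAt 𝓘(ℝ, E) p q)) :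
    ∀ᶠ x in 𝓝[chartSet E S p] (extChartAt 𝓘(ℝ, E) p p₀), P x := by
  filter_upwards [(tendsto_extChartAt_symm_chartSet (E := E) S hp₀).eventually hQ,
    self_mem_nhdsWithin] with x hx hxS
  have := h _ hxS.1 ((extChartAt 𝓘(ℝ, E) p).map_target hxS.2) hx
  rwa [(extChartAt 𝓘(ℝ, E) p).right_inv hxS.2] at this

omit [IsManifold 𝓘(ℝ, E) ∞ M] in
theorem eventually_chartSet {S : Set M} {p : M} {P : E → Prop} {Q : M → Prop}
    (hQ : ∀ᶠ q in 𝓝[S] p, Q q)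
    (h : ∀ q ∈ S, q ∈ (extChartAt 𝓘(ℝ, E) p).source → Q q → P (extChartAt 𝓘(ℝ, E) p q)) :
    ∀ᶠ x in 𝓝[chartSet E S p] (extChartAt 𝓘(ℝ, E) p p), P x :=
  eventually_chartSet_of_mem (mem_extChartAt_source p) hQ h

variable [FiniteDimensional ℝ E]

theorem IsLocalEquation.nullChart {F : FinslerSpacetime E M} {S : Set M} {n : (q : M) → TS E q}
    (hn : F.IsNullField S n) {U : Set M} {f : M → ℝ} (hf : IsLocalEquation (E := E) S U f) {p : M}
    (hp : p ∈ S) (hpU : p ∈ U) {m : E → E} (hm : ContDiffAt ℝ 1 m (extChartAt 𝓘(ℝ, E) p p))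
    (heq : chartField n p =ᶠ[𝓝[chartSet E S p] (extChartAt 𝓘(ℝ, E) p p)] m) :
    NullChart F S n p U f m := by
  have hmem := (hf.isLevelSetAt hp hpU (mem_extChartAt_source p)).mem
  have hm0 : m (extChartAt 𝓘(ℝ, E) p p) = n p := by
    rw [← heq.self_of_nhdsWithin hmem, chartField_self]
  have hU : ∀ᶠ q in 𝓝[S] p, q ∈ U := nhdsWithin_le_nhds (hf.isOpen.mem_nhds hpU)
  refine ⟨hp, hpU, hf, ⟨F.isLocalLagrangian p, mem_extChartAt_target p,
    hf.isLevelSetAt hp hpU (mem_extChartAt_source p), hm, ?_, ?_, ?_⟩, heq⟩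
  · rw [hm0]
    exact (hn.2 p hp).1.1
  · have h1 : ∀ᶠ x in 𝓝[chartSet E S p] (extChartAt 𝓘(ℝ, E) p p),
        fderiv ℝ (f ∘ (extChartAt 𝓘(ℝ, E) p).symm) x (chartField n p x) = 0 := by
      refine eventually_chartSet hU fun q hqS hq hqU => ?_
      rw [chartField_extChartAt n hq]
      exact (hf.mem_tangentOf_iff hqS hqU hq _).1 (hn.2 q hqS).2.1
    filter_upwards [h1, heq] with x hx hx'
    rwa [← hx']
  · have h1 : ∀ᶠ x in 𝓝[chartSet E S p] (extChartAt 𝓘(ℝ, E) p p),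
        ∀ X, fderiv ℝ (f ∘ (extChartAt 𝓘(ℝ, E) p).symm) x X = 0
          ↔ fiberHess (chartLag F.L p) (x, chartField n p x) (chartField n p x) X = 0 := by
      refine eventually_chartSet hU fun q hqS hq hqU X => ?_
      rw [chartField_extChartAt n hq]
      have h2 := hf.mem_tangentOf_iff hqS hqU hq (ofChart E p q X)
      have h3 := (hn.2 q hqS).2.2 (ofChart E p q X)
      have h4 := metric_eq_fiberHess_toChart F.smooth hq (hn.2 q hqS).1.1 (n q) (ofChart E p q X)
      have h5 : toChart E p q (ofChart E p q X) = X := toChart_ofChart hq X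
      have h2' := h2.trans (Eq.congr_left (congrArg _ h5))
      have h4' := h4.trans (congrArg _ h5)
      exact h2'.symm.trans (h3.trans (Eq.congr_left h4'))
    filter_upwards [h1, heq] with x hx hx'
    rwa [← hx']

theorem exists_nullChart {F : FinslerSpacetime E M} {S : Set M} (hS : IsC2Hypersurface E S)
    {n : (q : M) → TS E q} (hn : F.IsNullField S n) {p : M} (hp : p ∈ S) :
    ∃ U f m, NullChart F S n p U f m := by
  obtain ⟨U, hU, hpU, f, hf, hne, heq⟩ := hS p hp
  have hf' : IsLocalEquation (E := E) S U f := ⟨hU, hf, hne, heq⟩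
  have hlev := hf'.isLevelSetAt hp hpU (mem_extChartAt_source p)
  obtain ⟨m, hm, hnm⟩ := hlev.exists_extension
    (contDiffWithinAt_chartField (mem_extChartAt_source p) (hn.1 p hp))
  exact ⟨U, f, m, hf'.nullChart hn hp hpU hm hnm⟩

namespace NullChart

variable {F : FinslerSpacetime E M} {S : Set M} {n : (q : M) → TS E q} {p : M} {U : Set M}
  {f : M → ℝ} {m : E → E} (h : NullChart F S n p U f m)
include h

omit [FiniteDimensional ℝ E] in
theorem apply_self : m (extChartAt 𝓘(ℝ, E) p p) = n p := by
  rw [← h.eq.self_of_nhdsWithin h.null.level.mem, chartField_self]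

theorem mem_tangentOf_iff (X : TS E p) : X ∈ tangentOf S p ↔
    fderiv ℝ (f ∘ (extChartAt 𝓘(ℝ, E) p).symm) (extChartAt 𝓘(ℝ, E) p p) X = 0 :=
  h.eqn.mem_tangentOf_iff_self h.mem h.mem_nhd X

omit [FiniteDimensional ℝ E] in
theorem metric_eq : metric F.L p (n p)
    = fiberHess (chartLag F.L p) (extChartAt 𝓘(ℝ, E) p p, m (extChartAt 𝓘(ℝ, E) p p)) := by
  rw [metric_eq_fiberHess, h.apply_self]

theorem derivAlong_eq {X : TS E p} (hX : X ∈ tangentOf S p) :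
    derivAlong S n p X = fderiv ℝ m (extChartAt 𝓘(ℝ, E) p p) X :=
  h.null.level.fderivWithin_apply_eq h.null.hasFDerivAt h.eq ((h.mem_tangentOf_iff X).1 hX)

theorem covDeriv_eq {X : TS E p} (hX : X ∈ tangentOf S p) :
    F.covDeriv S n p X = covDerivLocal (chartLag F.L p) m (extChartAt 𝓘(ℝ, E) p p) X := by
  have h1 := h.derivAlong_eq hX
  have h2 : F.covDeriv S n p X = (derivAlong S n p X
    + nonlinConn (chartLag F.L p) (extChartAt 𝓘(ℝ, E) p p, n p) X : E) := rfl
  rw [h2, h1, covDerivLocal, h.apply_self]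
  rfl

/-- A tangent field in coordinates. -/
theorem exists_tangentField {X : (q : M) → TS E q} (hX : IsC1TangentFieldAt S X p) :
    ∃ ξ : E → E, HasFDerivAt ξ (fderiv ℝ ξ (extChartAt 𝓘(ℝ, E) p p)) (extChartAt 𝓘(ℝ, E) p p) ∧
      chartField X p =ᶠ[𝓝[chartSet E S p] (extChartAt 𝓘(ℝ, E) p p)] ξ ∧
      ξ (extChartAt 𝓘(ℝ, E) p p) = X p ∧
      (∀ᶠ x in 𝓝[chartSet E S p] (extChartAt 𝓘(ℝ, E) p p),
        fderiv ℝ (f ∘ (extChartAt 𝓘(ℝ, E) p).symm) x (ξ x) = 0) ∧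
      ∀ Z ∈ tangentOf S p, derivAlong S X p Z = fderiv ℝ ξ (extChartAt 𝓘(ℝ, E) p p) Z := by
  obtain ⟨ξ, hξ, hXξ⟩ := h.null.level.exists_extension
    (contDiffWithinAt_chartField (mem_extChartAt_source p) hX.1)
  have hd := (hξ.differentiableAt (by simp)).hasFDerivAt
  refine ⟨ξ, hd, hXξ, ?_, ?_, ?_⟩
  · rw [← hXξ.self_of_nhdsWithin h.null.level.mem, chartField_self]
  · have hU : ∀ᶠ q in 𝓝[S] p, q ∈ U :=
      nhdsWithin_le_nhds (h.eqn.isOpen.mem_nhds h.mem_nhd)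
    have h1 : ∀ᶠ x in 𝓝[chartSet E S p] (extChartAt 𝓘(ℝ, E) p p),
        fderiv ℝ (f ∘ (extChartAt 𝓘(ℝ, E) p).symm) x (chartField X p x) = 0 := by
      refine eventually_chartSet (hU.and hX.2) fun q hqS hq hqU => ?_
      rw [chartField_extChartAt X hq]
      exact (h.eqn.mem_tangentOf_iff hqS hqU.1 hq _).1 hqU.2
    filter_upwards [h1, hXξ] with x hx hx'
    rwa [← hx']
  · intro Z hZ
    exact h.null.level.fderivWithin_apply_eq hd hXξ ((h.mem_tangentOf_iff Z).1 hZ)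

/-- Every tangent vector extends to a `C^1` tangent field. -/
theorem exists_field {X : TS E p} (hX : X ∈ tangentOf S p) :
    ∃ V : (q : M) → TS E q, IsC1TangentFieldAt S V p ∧ V p = X := by
  set x₀ := extChartAt 𝓘(ℝ, E) p p with hx₀
  set φ := f ∘ (extChartAt 𝓘(ℝ, E) p).symm with hφ
  have hX' : fderiv ℝ φ x₀ X = 0 := (h.mem_tangentOf_iff X).1 hX
  obtain ⟨e, he⟩ : ∃ w, fderiv ℝ φ x₀ w ≠ 0 := by
    by_contra! hc
    exact h.null.level.fderiv_ne (by ext w; exact hc w)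
  have hc : ContDiffAt ℝ 1 (fderiv ℝ φ) x₀ := h.null.level.contDiffAt_fderiv
  let X₀ : E := X
  have hX₀ : fderiv ℝ φ x₀ X₀ = 0 := hX'
  -- The constant field `X₀` projected along `e` onto the kernel of the differential of `φ` at each
  -- point; at `x₀` the correction vanishes.
  set ξ : E → E := fun x => X₀ - (fderiv ℝ φ x X₀ / fderiv ℝ φ x e) • e with hξ
  have hξc : ContDiffAt ℝ 1 ξ x₀ :=
    contDiffAt_const.sub (((hc.clm_apply contDiffAt_const).div
      (hc.clm_apply contDiffAt_const) he).smul contDiffAt_const)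
  have hne : ∀ᶠ x in 𝓝 x₀, fderiv ℝ φ x e ≠ 0 :=
    (hc.continuousAt.clm_apply continuousAt_const).eventually_ne he
  refine ⟨ofChartField ξ p, ⟨(contMDiffAt_ofChartField (mem_extChartAt_source p)
    hξc).contMDiffWithinAt, ?_⟩, ?_⟩
  · have h1 := (tendsto_extChartAt_chartSet (E := E) S (mem_extChartAt_source p)).eventually
      (nhdsWithin_le_nhds hne)
    filter_upwards [h1, nhdsWithin_le_nhds (h.eqn.isOpen.mem_nhds h.mem_nhd), self_mem_nhdsWithin,
      nhdsWithin_le_nhds (extChartAt_source_mem_nhds (I := 𝓘(ℝ, E)) p)] with q hq1 hqU hqS hq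
    rw [h.eqn.mem_tangentOf_iff hqS hqU hq, toChart_ofChartField ξ hq]
    rw [← hφ]
    simp only [hξ, map_sub, map_smul, smul_eq_mul]
    rw [div_mul_cancel₀ _ hq1, sub_self]
  · have h1 : ofChartField ξ p p = ofChart E p p (ξ x₀) := rfl
    rw [h1, ofChart_self]
    simp only [hξ, hX₀]
    simp
    rfl

theorem bracket_mem {X : (q : M) → TS E q} (hX : IsC1TangentFieldAt S X p) :
    FinslerSpacetime.bracket S n X p ∈ tangentOf S p := by
  obtain ⟨ξ, hξ, hXξ, hξ0, hξt, hξd⟩ := h.exists_tangentField hX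
  have hXp : X p ∈ tangentOf S p := hX.2.self_of_nhdsWithin h.mem
  have hnp : n p ∈ tangentOf S p := by
    rw [h.mem_tangentOf_iff, ← h.apply_self]
    exact h.null.fderiv_self
  rw [h.mem_tangentOf_iff, bracket_eq, hξd _ hnp, h.derivAlong_eq hXp, ← h.apply_self, ← hξ0]
  exact h.null.level.fderiv_bracket h.null.hasFDerivAt hξ h.null.tangent hξt

/-- The derivatives of the components of `X` and `Y` along `n` cancel against those in the brackets.
What is left depends only on the values at `p`, so the vanishing of the Lie derivative is a
pointwise condition. -/
theorem lieMetric_eq {X Y : (q : M) → TS E q} (hX : IsC1TangentFieldAt S X p)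
    (hY : IsC1TangentFieldAt S Y p) (hn0 : ∀ q ∈ S, n q ≠ 0) :
    F.lieMetric S n X Y p
      = lieForm (chartLag F.L p) m (extChartAt 𝓘(ℝ, E) p p) (X p) (Y p) := by
  obtain ⟨ξ, hξ, hXξ, hξ0, hξt, hξd⟩ := h.exists_tangentField hX
  obtain ⟨η, hη, hYη, hη0, hηt, hηd⟩ := h.exists_tangentField hY
  have hXp : X p ∈ tangentOf S p := hX.2.self_of_nhdsWithin h.mem
  have hYp : Y p ∈ tangentOf S p := hY.2.self_of_nhdsWithin h.mem
  have hnp : n p ∈ tangentOf S p := by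
    rw [h.mem_tangentOf_iff, ← h.apply_self]
    exact h.null.fderiv_self
  have hγ := h.null.hasFDerivAt_fiberHess.differentiableAt.hasFDerivAt
  have hd := (hγ.clm_apply hξ).clm_apply hη
  have heq : (fun q => metric F.L q (n q) (X q) (Y q)) ∘ (extChartAt 𝓘(ℝ, E) p).symm
      =ᶠ[𝓝[chartSet E S p] (extChartAt 𝓘(ℝ, E) p p)]
      fun x => fiberHess (chartLag F.L p) (x, m x) (ξ x) (η x) := by
    have h1 : ∀ᶠ x in 𝓝[chartSet E S p] (extChartAt 𝓘(ℝ, E) p p),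
        ((fun q => metric F.L q (n q) (X q) (Y q)) ∘ (extChartAt 𝓘(ℝ, E) p).symm) x
          = fiberHess (chartLag F.L p) (x, chartField n p x) (chartField X p x)
            (chartField Y p x) := by
      refine eventually_chartSet (Q := fun _ => True) (by simp) fun q hqS hq _ => ?_
      rw [chartField_extChartAt n hq, chartField_extChartAt X hq, chartField_extChartAt Y hq,
        Function.comp_apply, (extChartAt 𝓘(ℝ, E) p).left_inv hq]
      exact metric_eq_fiberHess_toChart F.smooth hq (hn0 q hqS) _ _
    filter_upwards [h1, h.eq, hXξ, hYη] with x hx1 hx2 hx3 hx4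
    rw [hx1, hx2, hx3, hx4]
  have hdw := hd.hasFDerivWithinAt.congr_of_eventuallyEq heq
    (heq.self_of_nhdsWithin h.null.level.mem)
  rw [FinslerSpacetime.lieMetric, dirDeriv_eq hdw.differentiableWithinAt,
    h.null.level.fderivWithin_apply_eq hd heq ((h.mem_tangentOf_iff _).1 hnp), bracket_eq,
    bracket_eq, hξd _ hnp, hηd _ hnp, h.derivAlong_eq hXp, h.derivAlong_eq hYp, h.metric_eq,
    ← h.apply_self, ← hξ0, ← hη0, lieForm]
  simp only [add_apply, ContinuousLinearMap.comp_apply, ContinuousLinearMap.flip_apply, map_sub,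
    sub_apply]
  ring

end NullChart

end NullChart

/-! ### Forms and endomorphisms induced on quotients -/

section QuotientAlgebra

variable {V : Type*} [AddCommGroup V] [Module ℝ V]

/-- `quotForm` evaluates `B` on representatives chosen by `Function.surjInv`; these differ from `x`
and `y` by elements of `K`, which the hypothesis allows. -/
theorem quotForm_quotClass {W K : Submodule ℝ V} {B : V → V → ℝ}
    (hB : ∀ x ∈ W, ∀ y ∈ W, ∀ x' ∈ W, ∀ y' ∈ W, x' - x ∈ K → y' - y ∈ K → B x' y' = B x y)
    {x y : V} (hx : x ∈ W) (hy : y ∈ W) :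
    quotForm W K B (quotClass W K x) (quotClass W K y) = B x y := by
  have key : ∀ z (hz : z ∈ W), ((Function.surjInv (K.submoduleOf W).mkQ_surjective
      (quotClass W K z) : W) : V) - z ∈ K := by
    intro z hz
    have h1 := Function.surjInv_eq (K.submoduleOf W).mkQ_surjective (quotClass W K z)
    rw [quotClass, dif_pos hz] at h1 ⊢
    exact (Submodule.Quotient.eq (K.submoduleOf W)).1 h1
  exact hB x hx y hy _ (Subtype.mem _) _ (Subtype.mem _) (key x hx) (key y hy)

theorem quotEndo_eq_zero_iff {W K : Submodule ℝ V} {A : V →ₗ[ℝ] V} (h : Descends W K A) :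
    quotEndo W K A = 0 ↔ ∀ w ∈ W, A w ∈ K := by
  constructor
  · intro h0 w hw
    have h1 := quotEndo_quotClass W K A h w hw
    rw [h0, LinearMap.zero_apply, quotClass, dif_pos (h.1 w hw), Submodule.mkQ_apply] at h1
    exact (Submodule.Quotient.mk_eq_zero (K.submoduleOf W)).1 h1.symm
  · intro hA
    refine LinearMap.ext fun z => ?_
    obtain ⟨w, rfl⟩ := (K.submoduleOf W).mkQ_surjective z
    have h1 := quotEndo_quotClass W K A h w w.2
    rw [quotClass, dif_pos w.2, quotClass, dif_pos (h.1 w w.2)] at h1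
    rw [LinearMap.zero_apply]
    refine h1.trans ?_
    rw [Submodule.mkQ_apply, Submodule.Quotient.mk_eq_zero]
    exact hA w w.2

end QuotientAlgebra

/-! ### Pointwise equivalence of the conditions -/

section Pointwise

variable {E : Type*} [NormedAddCommGroup E] [NormedSpace ℝ E] [FiniteDimensional ℝ E]
  {M : Type*} [TopologicalSpace M] [ChartedSpace E M] [IsManifold 𝓘(ℝ, E) ∞ M]

namespace NullChart

variable {F : FinslerSpacetime E M} {S : Set M} {n : (q : M) → TS E q} {p : M} {U : Set M}
  {f : M → ℝ} {m : E → E} (h : NullChart F S n p U f m)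
include h

theorem self_mem_tangentOf : n p ∈ tangentOf S p := by
  rw [h.mem_tangentOf_iff, ← h.apply_self]
  exact h.null.fderiv_self

theorem mem_tangentOf_iff_metric (X : TS E p) :
    X ∈ tangentOf S p ↔ metric F.L p (n p) (n p) X = 0 := by
  rw [h.mem_tangentOf_iff, h.metric_eq, ← h.apply_self]
  exact h.null.fderiv_eq_zero_iff X

omit [FiniteDimensional ℝ E] in
theorem metric_symm (X Y : TS E p) : metric F.L p (n p) X Y = metric F.L p (n p) Y X := by
  rw [h.metric_eq]
  exact h.null.lag.fiberHess_symm h.null.mem_slit X Y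

/-- The vector `n p` is orthogonal to all of `tangentOf S p`, itself included, so adding multiples
of it does not change the metric. -/
theorem hForm_bar {X Y : TS E p} (hX : X ∈ tangentOf S p) (hY : Y ∈ tangentOf S p) :
    F.hForm S n p (FinslerSpacetime.bar S n p X) (FinslerSpacetime.bar S n p Y)
      = metric F.L p (n p) X Y := by
  refine quotForm_quotClass (fun x hx y hy x' hx' y' hy' hxx hyy => ?_) hX hY
  obtain ⟨a, ha⟩ := Submodule.mem_span_singleton.1 hxx
  obtain ⟨b, hb⟩ := Submodule.mem_span_singleton.1 hyy
  have hn0 := (h.mem_tangentOf_iff_metric _).1 h.self_mem_tangentOf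
  have hx0 := (h.mem_tangentOf_iff_metric _).1 hx
  have hy0 := (h.mem_tangentOf_iff_metric _).1 hy
  rw [h.metric_symm] at hx0
  obtain rfl : x' = x + a • n p := by rw [ha]; abel
  obtain rfl : y' = y + b • n p := by rw [hb]; abel
  have key : ∀ (B : E →L[ℝ] E →L[ℝ] ℝ) (x y v : E), B v v = 0 → B x v = 0 → B v y = 0 →
      B (x + a • v) (y + b • v) = B x y := by
    intro B x y v h1 h2 h3
    simp [h1, h2, h3]
  exact key _ x y (n p) hn0 hx0 hy0

theorem descends_covDeriv :
    Descends (tangentOf S p) (Submodule.span ℝ {n p}) (F.covDeriv S n p) := by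
  constructor
  · intro X hX
    rw [h.mem_tangentOf_iff, h.covDeriv_eq hX]
    exact h.null.fderiv_covDerivLocal ((h.mem_tangentOf_iff X).1 hX)
  · intro X hX
    obtain ⟨c, rfl⟩ := Submodule.mem_span_singleton.1 hX
    rw [map_smul]
    refine Submodule.smul_mem _ _ ?_
    rw [h.covDeriv_eq h.self_mem_tangentOf, ← h.apply_self]
    exact h.null.covDerivLocal_self_mem

omit [FiniteDimensional ℝ E] in
theorem curvEndo_apply (X : TS E p) : F.curvEndo p (n p) X = (nonlinCurv (chartLag F.L p)
    (extChartAt 𝓘(ℝ, E) p p, m (extChartAt 𝓘(ℝ, E) p p)) X (n p) : E) := by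
  rw [h.apply_self]
  rfl

omit [FiniteDimensional ℝ E] in
theorem curvEndo_self : F.curvEndo p (n p) (n p) = 0 := by
  rw [h.curvEndo_apply]
  exact sub_self (horDerivConn (chartLag F.L p)
    (extChartAt 𝓘(ℝ, E) p p, m (extChartAt 𝓘(ℝ, E) p p)) (n p) (n p))

theorem curvEndo_mem (X : TS E p) : F.curvEndo p (n p) X ∈ tangentOf S p := by
  rw [h.mem_tangentOf_iff, h.curvEndo_apply, h.null.fderiv_eq_zero_iff_fibreDeriv]
  exact h.null.lag.fibreDeriv_nonlinCurv h.null.mem_slit _ _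

theorem descends_curvEndo :
    Descends (tangentOf S p) (Submodule.span ℝ {n p}) (F.curvEndo p (n p)) := by
  refine ⟨fun X _ => h.curvEndo_mem X, fun X hX => ?_⟩
  obtain ⟨c, rfl⟩ := Submodule.mem_span_singleton.1 hX
  rw [map_smul, h.curvEndo_self, smul_zero]
  exact Submodule.zero_mem _

theorem covDeriv_mem_span_iff :
    (∀ X ∈ tangentOf S p, F.covDeriv S n p X ∈ Submodule.span ℝ {n p})
      ↔ ∀ X ∈ tangentOf S p, ∀ Y ∈ tangentOf S p,
        lieForm (chartLag F.L p) m (extChartAt 𝓘(ℝ, E) p p) X Y = 0 := by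
  refine forall₂_congr fun X hX => ?_
  have h1 := h.null.covDerivLocal_mem_span_iff ((h.mem_tangentOf_iff X).1 hX)
  rw [h.covDeriv_eq hX, ← h.apply_self]
  refine h1.trans (forall_congr' fun Y => ?_)
  exact imp_congr_left (h.mem_tangentOf_iff Y).symm

theorem weingarten_eq_zero_iff_mem_span :
    F.weingarten S n p = 0
      ↔ ∀ X ∈ tangentOf S p, F.covDeriv S n p X ∈ Submodule.span ℝ {n p} :=
  quotEndo_eq_zero_iff h.descends_covDeriv

theorem weingarten_eq_zero_iff :
    F.weingarten S n p = 0 ↔ ∀ X ∈ tangentOf S p, ∀ Y ∈ tangentOf S p,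
        lieForm (chartLag F.L p) m (extChartAt 𝓘(ℝ, E) p p) X Y = 0 :=
  h.weingarten_eq_zero_iff_mem_span.trans h.covDeriv_mem_span_iff

theorem lieMetric_eq_zero_iff (hn0 : ∀ q ∈ S, n q ≠ 0) :
    (∀ X Y : (q : M) → TS E q, IsC1TangentFieldAt S X p → IsC1TangentFieldAt S Y p →
        F.lieMetric S n X Y p = 0) ↔ F.weingarten S n p = 0 := by
  rw [h.weingarten_eq_zero_iff]
  constructor
  · intro h0 X hX Y hY
    obtain ⟨V, hV, rfl⟩ := h.exists_field hX
    obtain ⟨V', hV', rfl⟩ := h.exists_field hY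
    rw [← h.lieMetric_eq hV hV' hn0]
    exact h0 V V' hV hV'
  · intro h0 X Y hX hY
    rw [h.lieMetric_eq hX hY hn0]
    exact h0 _ (hX.2.self_of_nhdsWithin h.mem) _ (hY.2.self_of_nhdsWithin h.mem)

theorem leviCivita_mem_iff {k : (q : M) → TS E q} (hk : m = chartField k p) {X : TS E p}
    (hX : X ∈ tangentOf S p) {Y : (q : M) → TS E q} (hY : IsC1TangentFieldAt S Y p) :
    F.leviCivita k S Y p X ∈ tangentOf S p
      ↔ lieForm (chartLag F.L p) m (extChartAt 𝓘(ℝ, E) p p) X (Y p) = 0 := by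
  obtain ⟨η, hη, hYη, hη0, hηt, hηd⟩ := h.exists_tangentField hY
  have h1 := h.null.fderiv_leviCivita_eq_zero_iff hη hηt ((h.mem_tangentOf_iff X).1 hX)
  rw [h.mem_tangentOf_iff, FinslerSpacetime.leviCivita, hηd X hX, ← hη0]
  subst hk
  exact h1

end NullChart

/-- In the chart at `p`, an extension of the null field is an extension of its components. -/
theorem FinslerSpacetime.IsExtension.nullChart {F : FinslerSpacetime E M} {S : Set M}
    {n : (q : M) → TS E q} (hn : F.IsNullField S n) {O : Set M} {k : (q : M) → TS E q}
    (hk : FinslerSpacetime.IsExtension S n O k) {U : Set M} {f : M → ℝ}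
    (hf : IsLocalEquation (E := E) S U f) {p : M} (hp : p ∈ S) (hpU : p ∈ U) :
    NullChart F S n p U f (chartField k p) := by
  obtain ⟨hO, hSO, hkc, -, hkn⟩ := hk
  refine hf.nullChart hn hp hpU ?_ ?_
  · have h1 : ContMDiffAt 𝓘(ℝ, E) 𝓘(ℝ, E).tangent 1 (toSection k) p :=
      hkc.contMDiffAt (hO.mem_nhds (hSO hp))
    have h2 := contDiffWithinAt_chartField (mem_extChartAt_source p)
      (h1.contMDiffWithinAt (s := univ))
    refine h2.contDiffAt ?_
    filter_upwards [extChartAt_target_mem_nhds (I := 𝓘(ℝ, E)) p] with x hx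
    exact ⟨mem_univ _, hx⟩
  · refine eventually_chartSet (Q := fun _ => True) (by simp) fun q hqS hq _ => ?_
    rw [chartField_extChartAt n hq, chartField_extChartAt k hq, hkn q hqS]

/-- The components of any extension may serve as the field `m` of a `NullChart`. The vanishing of
the corresponding `lieForm` on tangent vectors is equivalent to that of the Weingarten map, which
involves `n` on `S` only; hence the choice of extension is immaterial. -/
theorem FinslerSpacetime.IsExtension.preservesTangent_iff {F : FinslerSpacetime E M} {S : Set M}
    (hS : IsC2Hypersurface E S) {n : (q : M) → TS E q} (hn : F.IsNullField S n) {O : Set M}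
    {k : (q : M) → TS E q} (hk : FinslerSpacetime.IsExtension S n O k) :
    F.PreservesTangent S k ↔ ∀ p ∈ S, F.weingarten S n p = 0 := by
  refine forall₂_congr fun p hp => ?_
  obtain ⟨U, hU, hpU, f, hf, hne, heq⟩ := hS p hp
  have hf' : IsLocalEquation (E := E) S U f := ⟨hU, hf, hne, heq⟩
  have h := hk.nullChart hn hf' hp hpU
  rw [h.weingarten_eq_zero_iff]
  refine forall₂_congr fun X hX => ⟨fun h0 Y hY => ?_, fun h0 Y hY => ?_⟩
  · obtain ⟨V, hV, rfl⟩ := h.exists_field hY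
    exact (h.leviCivita_mem_iff rfl hX hV).1 (h0 V hV)
  · exact (h.leviCivita_mem_iff rfl hX hY).2 (h0 _ (hY.2.self_of_nhdsWithin hp))

/-- At all points of `S` near `p`, `h` on classes equals `g_n` on the tangent representatives, so
the differentiated functions have the same germ on `S`; the brackets are tangent, so the other terms
agree too. -/
theorem lieH_eq_lieMetric {F : FinslerSpacetime E M} {S : Set M} (hS : IsC2Hypersurface E S)
    {n : (q : M) → TS E q} (hn : F.IsNullField S n) {p : M} (hp : p ∈ S)
    {X Y : (q : M) → TS E q} (hX : IsC1TangentFieldAt S X p) (hY : IsC1TangentFieldAt S Y p) :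
    F.lieH S n X Y p = F.lieMetric S n X Y p := by
  obtain ⟨U, f, m, h⟩ := exists_nullChart hS hn hp
  have hXp := hX.2.self_of_nhdsWithin hp
  have hYp := hY.2.self_of_nhdsWithin hp
  have heq : (fun q => F.hForm S n q (FinslerSpacetime.bar S n q (X q))
      (FinslerSpacetime.bar S n q (Y q))) =ᶠ[𝓝[S] p]
      fun q => metric F.L q (n q) (X q) (Y q) := by
    filter_upwards [hX.2, hY.2, self_mem_nhdsWithin] with q hXq hYq hq
    obtain ⟨U', f', m', h'⟩ := exists_nullChart hS hn hq
    exact h'.hForm_bar hXq hYq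
  have hd : FinslerSpacetime.dirDeriv S (fun q => F.hForm S n q
      (FinslerSpacetime.bar S n q (X q)) (FinslerSpacetime.bar S n q (Y q))) p (n p)
      = FinslerSpacetime.dirDeriv S (fun q => metric F.L q (n q) (X q) (Y q)) p (n p) := by
    exact congrArg (fun T : E →L[ℝ] ℝ => T (n p))
      (heq.mfderivWithin_eq (I := 𝓘(ℝ, E)) (I' := 𝓘(ℝ, ℝ)) (heq.self_of_nhdsWithin hp))
  rw [FinslerSpacetime.lieH, FinslerSpacetime.lieMetric, hd, h.hForm_bar (h.bracket_mem hX) hYp,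
    h.hForm_bar hXp (h.bracket_mem hY)]

/-- If the null Weingarten map vanishes, the curvature `R_n` maps `TS` to `ℝ n`. -/
theorem curvEndo_mem_span {F : FinslerSpacetime E M} {S : Set M} (hS : IsC2Hypersurface E S)
    {n : (q : M) → TS E q} (hn : F.IsNullField S n) (hb : ∀ p ∈ S, F.weingarten S n p = 0)
    {p : M} (hp : p ∈ S) {X : TS E p} (hX : X ∈ tangentOf S p) :
    F.curvEndo p (n p) X ∈ Submodule.span ℝ {n p} := by
  obtain ⟨U, f, m, h⟩ := exists_nullChart hS hn hp
  have hev := (tendsto_extChartAt_chartSet (E := E) S (mem_extChartAt_source p)).eventually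
    (h.null.eventually_isLocalNull.and (eventually_eventually_nhdsWithin.2 h.eq))
  have hevU : ∀ᶠ q in 𝓝[S] p, q ∈ U := nhdsWithin_le_nhds (h.eqn.isOpen.mem_nhds h.mem_nhd)
  -- The hypothesis at a nearby point `q` refers to the chart at `q`, whereas the curvature argument
  -- needs it at all nearby points in the single chart at `p`. The passage goes through `lieForm`,
  -- which is a tensor on the hypersurface, with `τ` the change of charts.
  have hD : ∀ᶠ x in 𝓝[chartSet E S p] (extChartAt 𝓘(ℝ, E) p p), ∀ X,
      fderiv ℝ (f ∘ (extChartAt 𝓘(ℝ, E) p).symm) x X = 0 →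
      covDerivLocal (chartLag F.L p) m x X ∈ Submodule.span ℝ {m x} := by
    refine eventually_chartSet (hev.and hevU) fun q hqS hq hQ X hX => ?_
    obtain ⟨⟨hnull, heq⟩, hqU⟩ := hQ
    obtain ⟨U', f', m', h'⟩ := exists_nullChart hS hn hqS
    have hqq := mem_extChartAt_source (I := 𝓘(ℝ, E)) q
    have hwein := h'.weingarten_eq_zero_iff.1 (hb q hqS)
    rw [hnull.covDerivLocal_mem_span_iff hX]
    intro Y hY
    set τ := extChartAt 𝓘(ℝ, E) q ∘ (extChartAt 𝓘(ℝ, E) p).symm with hτ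
    have hτ0 : τ (extChartAt 𝓘(ℝ, E) p q) = extChartAt 𝓘(ℝ, E) q q := by
      rw [hτ, Function.comp_apply, (extChartAt 𝓘(ℝ, E) p).left_inv hq]
    have hτc : ContDiffAt ℝ 2 τ (extChartAt 𝓘(ℝ, E) p q) :=
      (contDiffAt_chartChange hq hqq).of_le (WithTop.coe_le_coe.2 le_top)
    have hτd : ∀ {z : M}, z ∈ (extChartAt 𝓘(ℝ, E) p).source → z ∈ (extChartAt 𝓘(ℝ, E) q).source →
        fderiv ℝ τ (extChartAt 𝓘(ℝ, E) p z) = tangentCoordChange 𝓘(ℝ, E) p q z :=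
      fun hz hz' => (hasFDerivAt_chartChange hz hz').fderiv
    have hev' : ∀ᶠ z in 𝓝[S] q, z ∈ (extChartAt 𝓘(ℝ, E) q).source ∧
        m' (extChartAt 𝓘(ℝ, E) q z) = toChart E q z (n z) ∧
        m (extChartAt 𝓘(ℝ, E) p z) = toChart E p z (n z) := by
      filter_upwards [(tendsto_extChartAt_chartSet (E := E) S hqq).eventually h'.eq,
        (tendsto_extChartAt_chartSet (E := E) S hq).eventually heq,
        nhdsWithin_le_nhds (extChartAt_source_mem_nhds (I := 𝓘(ℝ, E)) q),
        nhdsWithin_le_nhds ((isOpen_extChartAt_source p).mem_nhds hq)] with z h1 h2 h3 h4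
      exact ⟨h3, by rw [← h1, chartField_extChartAt n h3], by rw [← h2, chartField_extChartAt n h4]⟩
    have hm : ∀ᶠ x in 𝓝[chartSet E S p] (extChartAt 𝓘(ℝ, E) p q),
        m' (τ x) = fderiv ℝ τ x (m x) := by
      refine eventually_chartSet_of_mem hq hev' fun z hzS hz hQ => ?_
      rw [hτd hz hQ.1, hτ, Function.comp_apply, (extChartAt 𝓘(ℝ, E) p).left_inv hz, hQ.2.1, hQ.2.2]
      exact (tangentCoordChange_comp ⟨⟨mem_extChartAt_source z, hz⟩, hQ.1⟩).symm
    have hg : ∀ᶠ x in 𝓝[chartSet E S p] (extChartAt 𝓘(ℝ, E) p q), ∀ a b,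
        fiberHess (chartLag F.L p) (x, m x) a b
          = fiberHess (chartLag F.L q) (τ x, m' (τ x)) (fderiv ℝ τ x a) (fderiv ℝ τ x b) := by
      have h1 : ∀ᶠ x in 𝓝[chartSet E S p] (extChartAt 𝓘(ℝ, E) p q), m x ≠ 0 →
          ∀ a b, fiberHess (chartLag F.L p) (x, m x) a b = fiberHess (chartLag F.L q)
            (τ x, fderiv ℝ τ x (m x)) (fderiv ℝ τ x a) (fderiv ℝ τ x b) := by
        refine eventually_chartSet_of_mem hq hev' fun z hzS hz hQ hmz a b => ?_
        rw [hτd hz hQ.1, hτ, Function.comp_apply, (extChartAt 𝓘(ℝ, E) p).left_inv hz]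
        exact fiberHess_chartChange F.smooth hz hQ.1 hmz a b
      filter_upwards [h1, hm, hnull.eventually_isLocalNull] with x hx1 hx2 hx3
      rw [hx2]
      exact hx1 hx3.ne_zero
    have hmem : ∀ Z, fderiv ℝ (f ∘ (extChartAt 𝓘(ℝ, E) p).symm) (extChartAt 𝓘(ℝ, E) p q) Z = 0 →
        (ofChart E p q Z : TS E q) ∈ tangentOf S q := by
      intro Z hZ
      refine (h.eqn.mem_tangentOf_iff hqS hqU hq _).2 ?_
      exact (congrArg _ (toChart_ofChart hq Z)).trans hZ
    rw [hnull.lieForm_comp hτc (by rw [hτ0]; exact h'.null) hm hg hX hY, hτ0, hτd hq hqq]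
    exact hwein _ (hmem X hX) _ (hmem Y hY)
  have h1 := h.null.nonlinCurv_mem_span hD ((h.mem_tangentOf_iff X).1 hX)
    ((h.mem_tangentOf_iff _).1 h.self_mem_tangentOf)
  rw [h.curvEndo_apply, ← h.apply_self]
  rw [← h.apply_self] at h1
  exact h1

end Pointwise

/-! ### Global extension of the null field to a neighborhood -/

section Extension

variable {E : Type*} [NormedAddCommGroup E] [NormedSpace ℝ E] [FiniteDimensional ℝ E]
  {M : Type*} [TopologicalSpace M] [ChartedSpace E M] [IsManifold 𝓘(ℝ, E) ∞ M]

/-- A family of open sets of a `σ`-compact manifold has a smooth partition of unity on its union,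
here described by finitely many functions near each point of the union. -/
theorem exists_partition_iUnion [T2Space M] [SigmaCompactSpace M] {ι : Type*} {O : ι → Set M}
    (hO : ∀ i, IsOpen (O i)) :
    ∃ ρ : ι → M → ℝ, ∀ q ∈ ⋃ i, O i, (∀ i, ContMDiffAt 𝓘(ℝ, E) 𝓘(ℝ, ℝ) ∞ (ρ i) q) ∧
      ∃ t : Finset ι, (∀ i ∈ t, q ∈ O i) ∧
        ∀ᶠ y in 𝓝 q, (∀ i, i ∉ t → ρ i y = 0) ∧ ∑ i ∈ t, ρ i y = 1 := by
  -- `S` need not be closed in `M`, so the partition of unity is taken on the open submanifold `W`,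
  -- which the family covers. The values outside `W`, set to zero by `Function.extend`, play no
  -- role.
  let W : TopologicalSpace.Opens M := ⟨⋃ i, O i, isOpen_iUnion hO⟩
  have : LocallyCompactSpace M := ChartedSpace.locallyCompactSpace E M
  have : SecondCountableTopology M := ChartedSpace.secondCountable_of_sigmaCompact E M
  have : LocallyCompactSpace W := W.isOpen.locallyCompactSpace
  have hcov : (univ : Set W) ⊆ ⋃ i, Subtype.val ⁻¹' O i := by
    intro q _
    obtain ⟨i, hi⟩ := mem_iUnion.1 q.2
    exact mem_iUnion.2 ⟨i, hi⟩
  obtain ⟨ρ, hρ⟩ := SmoothPartitionOfUnity.exists_isSubordinate 𝓘(ℝ, E) isClosed_univ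
    (fun i => (Subtype.val ⁻¹' O i : Set W)) (fun i => (hO i).preimage continuous_subtype_val) hcov
  have hext : ∀ i (y : W), Function.extend Subtype.val (ρ i) 0 (y : M) = ρ i y := fun i y =>
    Subtype.val_injective.extend_apply _ _ y
  refine ⟨fun i => Function.extend Subtype.val (ρ i) 0, fun q hq => ⟨fun i => ?_, ?_⟩⟩
  · refine (contMDiffAt_subtype_iff (U := W) (x := ⟨q, hq⟩)).1 ?_
    simp_rw [hext]
    exact (ρ i).contMDiff.contMDiffAt
  · refine ⟨ρ.fintsupport ⟨q, hq⟩, fun i hi => ?_, ?_⟩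
    · exact hρ i ((ρ.mem_fintsupport_iff _ i).1 hi)
    · have h1 := ρ.eventually_finsupport_subset ⟨q, hq⟩
      rw [nhds_subtype_eq_comap, eventually_comap] at h1
      filter_upwards [h1, W.isOpen.mem_nhds hq] with y hy hyW
      have h2 := hy ⟨y, hyW⟩ rfl
      simp_rw [fun i => hext i ⟨y, hyW⟩]
      refine ⟨fun i hi => ?_, ρ.sum_finsupport' _ (mem_univ _) h2⟩
      by_contra h0
      exact hi (h2 ((ρ.mem_finsupport _).2 h0))

/-- Local `C^1` extensions of a vector field along `S` can be glued. -/
theorem exists_contMDiffAt_extension [T2Space M] [SigmaCompactSpace M] {S : Set M}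
    {n : (q : M) → TS E q}
    (h : ∀ p ∈ S, ∃ k : (q : M) → TS E q, ∀ᶠ q in 𝓝 p,
      ContMDiffAt 𝓘(ℝ, E) 𝓘(ℝ, E).tangent 1 (toSection k) q ∧ (q ∈ S → k q = n q)) :
    ∃ (W : Set M) (m : (q : M) → TS E q), IsOpen W ∧ S ⊆ W ∧
      (∀ q ∈ W, ContMDiffAt 𝓘(ℝ, E) 𝓘(ℝ, E).tangent 1 (toSection m) q) ∧ ∀ q ∈ S, m q = n q := by
  have h' : ∀ p : S, ∃ (k : (q : M) → TS E q) (O : Set M), IsOpen O ∧ (p : M) ∈ O ∧ ∀ q ∈ O,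
      ContMDiffAt 𝓘(ℝ, E) 𝓘(ℝ, E).tangent 1 (toSection k) q ∧ (q ∈ S → k q = n q) := by
    intro p
    obtain ⟨k, hk⟩ := h p p.2
    obtain ⟨O, hO, hOo, hp⟩ := eventually_nhds_iff.1 hk
    exact ⟨k, O, hOo, hp, hO⟩
  choose k O hO hmem hk using h'
  obtain ⟨ρ, hρ⟩ := exists_partition_iUnion (E := E) hO
  have hSW : S ⊆ ⋃ i, O i := fun p hp => mem_iUnion.2 ⟨⟨p, hp⟩, hmem ⟨p, hp⟩⟩
  have hsum : ∀ {t : Finset S} {y : M}, (∀ i, i ∉ t → ρ i y = 0) →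
      ∑ᶠ i, ρ i y • k i y = ∑ i ∈ t, ρ i y • k i y := by
    intro t y ht
    refine finsum_eq_sum_of_support_subset _ fun i hi => ?_
    by_contra h0
    exact hi (by simp [ht i h0])
  -- On `S` every local extension that contributes has the value `n q`, and the weights add up to
  -- one.
  refine ⟨⋃ i, O i, fun q => ∑ᶠ i, ρ i q • k i q, isOpen_iUnion hO, hSW, fun q hq => ?_,
    fun q hq => ?_⟩
  · obtain ⟨hc, t, htO, ht⟩ := hρ q hq
    have h1 : ContMDiffAt 𝓘(ℝ, E) 𝓘(ℝ, E).tangent 1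
        (toSection fun y => ∑ i ∈ t, (ρ i • k i : (y : M) → TS E y) y) q :=
      ContMDiffAt.sum_section fun i hi =>
        ((hc i).of_le (by simp)).smul_section (hk i q (htO i hi)).1
    refine h1.congr_of_eventuallyEq ?_
    filter_upwards [ht] with y hy
    exact congrArg (fun v : TS E y => (⟨y, v⟩ : TangentBundle 𝓘(ℝ, E) M)) (hsum hy.1)
  · obtain ⟨-, t, htO, ht⟩ := hρ q (hSW hq)
    obtain ⟨h1, h2⟩ := ht.self_of_nhds
    refine (hsum h1).trans ?_
    rw [Finset.sum_congr rfl fun i hi => by rw [(hk i q (htO i hi)).2 hq],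
      ← Finset.sum_smul, h2, one_smul]

omit [FiniteDimensional ℝ E] in
/-- A vector field that is continuous and non-zero at a point is non-zero nearby. -/
theorem eventually_ne_zero {m : (q : M) → TS E q} {q : M}
    (hm : ContMDiffAt 𝓘(ℝ, E) 𝓘(ℝ, E).tangent 1 (toSection m) q) (h0 : m q ≠ 0) :
    ∀ᶠ y in 𝓝 q, m y ≠ 0 := by
  have h1 := contDiffWithinAt_chartField (mem_extChartAt_source q)
    (hm.contMDiffWithinAt (s := univ))
  have h2 := (tendsto_extChartAt_chartSet (E := E) univ (mem_extChartAt_source q)).eventually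
    (h1.continuousWithinAt.tendsto.eventually_ne (b₂ := (0 : E))
      (by rw [chartField_self]; exact h0))
  rw [nhdsWithin_univ] at h2
  filter_upwards [h2, extChartAt_source_mem_nhds (I := 𝓘(ℝ, E)) q] with y hy hys hy0
  rw [chartField_extChartAt m hys, hy0] at hy
  exact hy (map_zero _)

/-- Local extensions come from the `C^1` components `ξ` in charts. Gluing may create zeros off `S`;
they are removed by shrinking the domain to the open set where the field does not vanish. -/
theorem FinslerSpacetime.exists_isExtension [T2Space M] [SigmaCompactSpace M]
    {F : FinslerSpacetime E M} {S : Set M} (hS : IsC2Hypersurface E S)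
    {n : (q : M) → TS E q} (hn : F.IsNullField S n) :
    ∃ U m, FinslerSpacetime.IsExtension S n U m := by
  obtain ⟨W, m, hW, hSW, hm, hmn⟩ := exists_contMDiffAt_extension (S := S) (n := n) (by
    intro p hp
    obtain ⟨U, f, ξ, h⟩ := exists_nullChart hS hn hp
    refine ⟨ofChartField ξ p, ?_⟩
    have h1 := eventually_nhdsWithin_iff.1 ((tendsto_extChartAt_chartSet (E := E) S
      (mem_extChartAt_source p)).eventually h.eq)
    filter_upwards [h1, (continuousAt_extChartAt p).eventually (h.null.smooth.eventually (by simp)),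
      extChartAt_source_mem_nhds (I := 𝓘(ℝ, E)) p] with q hq hq1 hqs
    refine ⟨contMDiffAt_ofChartField hqs hq1, fun hqS => ?_⟩
    have h2 := hq hqS
    rw [chartField_extChartAt n hqs] at h2
    exact (congrArg (ofChart E p q) h2.symm).trans (ofChart_toChart hqs _))
  refine ⟨{q | q ∈ W ∧ m q ≠ 0}, m, ?_, fun p hp => ⟨hSW hp, ?_⟩,
    fun q hq => (hm q hq.1).contMDiffWithinAt, fun q hq => hq.2, hmn⟩
  · refine isOpen_iff_mem_nhds.2 fun q hq => ?_
    filter_upwards [hW.mem_nhds hq.1, eventually_ne_zero (hm q hq.1) hq.2] with y h1 h2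
    exact ⟨h1, h2⟩
  · rw [hmn p hp]
    exact (hn.2 p hp).1.1

end Extension

/-! ### Curvature consequences and the connection 1-form -/

section Curvature

/-- An endomorphism that maps everything to `W`, `W` to `K` and `K` to `0` is trace-free. -/
theorem trace_eq_zero_of_flag {V : Type*} [AddCommGroup V] [Module ℝ V]
    {W K : Submodule ℝ V} {A : V →ₗ[ℝ] V} (h₁ : ∀ v, A v ∈ W) (h₂ : ∀ w ∈ W, A w ∈ K)
    (h₃ : ∀ k ∈ K, A k = 0) : LinearMap.trace ℝ V A = 0 := by
  have h : IsNilpotent A := ⟨3, LinearMap.ext fun v => h₃ _ (h₂ _ (h₁ v))⟩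
  exact (LinearMap.isNilpotent_trace_of_isNilpotent h).eq_zero

variable {E : Type*} [NormedAddCommGroup E] [NormedSpace ℝ E] [FiniteDimensional ℝ E]
  {M : Type*} [TopologicalSpace M] [ChartedSpace E M] [IsManifold 𝓘(ℝ, E) ∞ M]
  {F : FinslerSpacetime E M} {S : Set M} {n : (q : M) → TS E q}

theorem curvBar_eq_zero (hS : IsC2Hypersurface E S) (hn : F.IsNullField S n)
    (hb : ∀ p ∈ S, F.weingarten S n p = 0) {p : M} (hp : p ∈ S) : F.curvBar S n p = 0 := by
  obtain ⟨U, f, m, h⟩ := exists_nullChart hS hn hp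
  exact (quotEndo_eq_zero_iff h.descends_curvEndo).2 fun X hX => curvEndo_mem_span hS hn hb hp hX

/-- Along the flag of the whole tangent space, `tangentOf S p`, the line of `n p` and zero, `R_n`
lowers each step by one; only the middle step uses the vanishing of the Weingarten map. -/
theorem ricci_eq_zero (hS : IsC2Hypersurface E S) (hn : F.IsNullField S n)
    (hb : ∀ p ∈ S, F.weingarten S n p = 0) {p : M} (hp : p ∈ S) : F.ricci p (n p) = 0 := by
  obtain ⟨U, f, m, h⟩ := exists_nullChart hS hn hp
  refine trace_eq_zero_of_flag (W := tangentOf S p) (K := Submodule.span ℝ {n p}) h.curvEndo_mem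
    (fun X hX => curvEndo_mem_span hS hn hb hp hX) fun X hX => ?_
  obtain ⟨c, rfl⟩ := Submodule.mem_span_singleton.1 hX
  rw [map_smul, h.curvEndo_self, smul_zero]

theorem weylBar_eq_zero (hS : IsC2Hypersurface E S) (hn : F.IsNullField S n)
    (hb : ∀ p ∈ S, F.weingarten S n p = 0) {p : M} (hp : p ∈ S) : F.weylBar S n p = 0 := by
  -- In dimension two the factor is `0⁻¹ = 0`, which is harmless: both terms vanish in any case.
  rw [FinslerSpacetime.weylBar, curvBar_eq_zero hS hn hb hp, map_zero, mul_zero, zero_smul,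
    sub_zero]

/-- The null Weingarten map vanishes if and only if `D n = θ ⊗ n` for a `1`-form `θ` on `S`. -/
theorem forall_weingarten_eq_zero_iff_exists_form (hS : IsC2Hypersurface E S)
    (hn : F.IsNullField S n) :
    (∀ p ∈ S, F.weingarten S n p = 0) ↔
      ∃ θ : (p : M) → (tangentOf S p : Submodule ℝ (TS E p)) →ₗ[ℝ] ℝ,
        ∀ p ∈ S, ∀ X : (tangentOf S p : Submodule ℝ (TS E p)),
          F.covDeriv S n p X = θ p X • n p := by
  constructor
  · intro hb
    have h1 : ∀ p : M, ∃ θ : (tangentOf S p : Submodule ℝ (TS E p)) →ₗ[ℝ] ℝ, p ∈ S →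
        ∀ X : (tangentOf S p : Submodule ℝ (TS E p)), F.covDeriv S n p X = θ X • n p := by
      intro p
      by_cases hp : p ∈ S
      · obtain ⟨U, f, m, h⟩ := exists_nullChart hS hn hp
        have hn0 : ∀ v : E, v ≠ 0 → ∃ φ : E →L[ℝ] ℝ, φ v = 1 := fun v hv =>
          SeparatingDual.exists_eq_one hv
        obtain ⟨φ, hφ⟩ := hn0 (n p) (hn.2 p hp).1.1
        -- The coefficient of `n p` is read off by a functional with value one on `n p`; this gives
        -- linearity in `X` at once.
        refine ⟨((φ : E →ₗ[ℝ] ℝ) ∘ₗ (F.covDeriv S n p : E →ₗ[ℝ] E)) ∘ₗ (tangentOf S p).subtype,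
          fun _ X => ?_⟩
        obtain ⟨c, hc⟩ := Submodule.mem_span_singleton.1
          (h.weingarten_eq_zero_iff_mem_span.1 (hb p hp) X X.2)
        have h2 : φ (F.covDeriv S n p X : E) = c := by
          rw [← hc]
          exact (φ.map_smul c _).trans (by rw [hφ, smul_eq_mul, mul_one])
        rw [← hc]
        exact congrArg (fun a : ℝ => a • n p) h2.symm
      · exact ⟨0, fun h => absurd h hp⟩
    choose θ hθ using h1
    exact ⟨θ, hθ⟩
  · rintro ⟨θ, hθ⟩ p hp
    obtain ⟨U, f, m, h⟩ := exists_nullChart hS hn hp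
    refine h.weingarten_eq_zero_iff_mem_span.2 fun X hX => ?_
    rw [hθ p hp ⟨X, hX⟩]
    exact Submodule.smul_mem _ _ (Submodule.mem_span_singleton_self _)

end Curvature

end LorentzFinsler

/-! ### The main theorem -/

theorem mainTheorem4
    {E : Type*} [NormedAddCommGroup E] [NormedSpace ℝ E] [FiniteDimensional ℝ E]
    {M : Type*} [TopologicalSpace M] [ChartedSpace E M] [IsManifold 𝓘(ℝ, E) ∞ M]
    [T2Space M] [SigmaCompactSpace M] [ConnectedSpace M]
    (F : FinslerSpacetime E M) (S : Set M) (hS : F.IsNullHypersurface S)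
    (n : (q : M) → TS E q) (hn : F.IsNullField S n) :
    -- `h`, `b`, `R̄` and `L_n` on sections of `V` are well defined
    (∀ p ∈ S,
      (∀ X ∈ tangentOf S p, ∀ Y ∈ tangentOf S p,
        F.hForm S n p (FinslerSpacetime.bar S n p X) (FinslerSpacetime.bar S n p Y)
          = metric F.L p (n p) X Y) ∧
      Descends (tangentOf S p) (Submodule.span ℝ {n p}) (F.covDeriv S n p) ∧
      Descends (tangentOf S p) (Submodule.span ℝ {n p}) (F.curvEndo p (n p)) ∧
      ∀ X : (q : M) → TS E q, IsC1TangentFieldAt S X p →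
        FinslerSpacetime.bracket S n X p ∈ tangentOf S p) ∧
    -- the equivalent conditions
    List.TFAE [
      ∀ p ∈ S, F.weingarten S n p = 0,
      ∀ p ∈ S, ∀ X Y : (q : M) → TS E q, IsC1TangentFieldAt S X p → IsC1TangentFieldAt S Y p →
        F.lieMetric S n X Y p = 0,
      ∀ p ∈ S, ∀ X Y : (q : M) → TS E q, IsC1TangentFieldAt S X p → IsC1TangentFieldAt S Y p →
        F.lieH S n X Y p = 0,
      ∃ θ : (p : M) → (tangentOf S p : Submodule ℝ (TS E p)) →ₗ[ℝ] ℝ,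
        ∀ p ∈ S, ∀ X : (tangentOf S p : Submodule ℝ (TS E p)),
          F.covDeriv S n p X = θ p X • n p,
      ∃ (U : Set M) (m : (q : M) → TS E q),
        FinslerSpacetime.IsExtension S n U m ∧ F.PreservesTangent S m,
      ∀ (U : Set M) (m : (q : M) → TS E q),
        FinslerSpacetime.IsExtension S n U m → F.PreservesTangent S m] ∧
    -- the consequences
    ((∀ p ∈ S, F.weingarten S n p = 0) →
      ∀ p ∈ S, F.curvBar S n p = 0 ∧ F.ricci p (n p) = 0 ∧ F.weylBar S n p = 0) := by
  have hn0 : ∀ q ∈ S, n q ≠ 0 := fun q hq => (hn.2 q hq).1.1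
  have h12 : (∀ p ∈ S, F.weingarten S n p = 0) ↔
      ∀ p ∈ S, ∀ X Y : (q : M) → TS E q, IsC1TangentFieldAt S X p → IsC1TangentFieldAt S Y p →
        F.lieMetric S n X Y p = 0 := by
    refine forall₂_congr fun p hp => ?_
    obtain ⟨U, f, m, h⟩ := exists_nullChart hS.1 hn hp
    exact (h.lieMetric_eq_zero_iff hn0).symm
  refine ⟨fun p hp => ?_, ?_, fun hb p hp => ⟨curvBar_eq_zero hS.1 hn hb hp,
    ricci_eq_zero hS.1 hn hb hp, weylBar_eq_zero hS.1 hn hb hp⟩⟩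
  · obtain ⟨U, f, m, h⟩ := exists_nullChart hS.1 hn hp
    exact ⟨fun X hX Y hY => h.hForm_bar hX hY, h.descends_covDeriv, h.descends_curvEndo,
      fun X hX => h.bracket_mem hX⟩
  tfae_have 1 ↔ 2 := h12
  tfae_have 2 ↔ 3 := forall₂_congr fun p hp => forall₄_congr fun X Y hX hY => by
    rw [lieH_eq_lieMetric hS.1 hn hp hX hY]
  tfae_have 1 ↔ 4 := forall_weingarten_eq_zero_iff_exists_form hS.1 hn
  tfae_have 1 → 6 := fun hb U m hm => (hm.preservesTangent_iff hS.1 hn).2 hb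
  -- A statement about all extensions yields one about some extension only because an extension
  -- exists.
  tfae_have 6 → 5 := fun h => by
    obtain ⟨U, m, hm⟩ := FinslerSpacetime.exists_isExtension hS.1 hn
    exact ⟨U, m, hm, h U m hm⟩
  tfae_have 5 → 1 := by
    rintro ⟨U, m, hm, h⟩
    exact (hm.preservesTangent_iff hS.1 hn).1 h
  tfae_finish
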